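/- **Setting.** A similarity graph $G$ on $V=\{v_1,\dots,v_n\}$, $n\ge 1$, is given by a symmetric matrix $(w_{ij})$ of non-negative real weights. An HC-tree is a rooted tree with leaf set $V$. The relation $\{i,j|k\}$ holds in $T$ if $\mathrm{LCA}(i,j)$ is a proper descendant of $\mathrm{LCA}(i,j,k)$. The cost of a triplet $\{i,j,k\}$ in $T$ is $w_{ik}+w_{jk}$ if $\{i,j|k\}$ holds (and symmetrically), and $w_{ij}+w_{ik}+w_{jk}$ if the three leaves are merged at the same time. Let $\mathrm{TC}_G(T)$ be the sum of these costs over all triplets, $\mathrm{BC}(G)=\sum_{\{i,j,k\}}\min\{w_{ij}+w_{ik},\,w_{ij}+w_{jk},\,w_{ik}+w_{jk}\}$ and $\rho_G(T)=\mathrm{TC}_G(T)/\mathrm{BC}(G)$ (with $0/0=1$ and $x/0=+\infty$ for $x>0$). An HC-tree is optimal if it minimizes $\rho_G$ over all HC-trees; $\rho_G^*$ is this minimum, and $G$ has perfect HC-structure if $\rho^*_G=1$. **Valid partitions.** A partition of a vertex set $S$ into at least two non-empty clusters is valid if, for all distinct $i,j,k\in S$: (i) if $w_{ij}>\max\{w_{ik},w_{jk}\}$,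 then either $i,j,k$ are in one cluster, or $i,j$ are in one cluster and $k$ in another; (ii) if $w_{ij}=w_{ik}>w_{jk}$, then it is not the case that $j,k$ are in one cluster and $i$ in another. **Procedure ValidBisect($S$).** If $S$ has no valid partition, return $(\emptyset,\emptyset)$. Otherwise let $\mathcal C$ be the valid partition that refines every valid partition of $S$. A claw $\{y\,|\,a,b,c\}$ consists of four points of four different clusters of $\mathcal C$ with $w_{ya}=w_{yb}=w_{yc}>\max\{w_{ab},w_{ac},w_{bc}\}$. - If there is a claw, choose one, $\{y\,|\,a,b,c\}$, and a set $Y\supseteq\{y,a,b,c\}$ of representatives, one of each cluster; let $K\subseteq Y$ be a maximum set containing $a,b,c$ whose pairwise weights are all $<w_{ya}$. If for some $x\in K$, with cluster $C\ni x$, the bi-partition $(C,S\setminus C)$ is valid, return such a bi-partition; otherwise return $(\emptyset,\emptyset)$. - If there is no claw, look for a $\{0,1\}$-assignment $z$ to the clusters that takes both values and satisfies $z(C_j)\ne z(C_k)$ whenever there are points $i\in C_i$, $j\in C_j$, $k\in C_k$ of three different clusters with $w_{ij}=w_{ik}>w_{jk}$. If there is one, return the unions of the clusters of value $1$ and of value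 $0$; otherwise return $(\emptyset,\emptyset)$. **Algorithm BiPartition($S$).** If $|S|=1$, return the single leaf. Otherwise let $(A,B)$ be the result of ValidBisect($S$); if $A=\emptyset$ or $B=\emptyset$, return the empty tree; else return the tree whose root has the two subtrees BiPartition($A$) and BiPartition($B$). Let BiPartition($G$) be BiPartition($V$). **Theorem.** Let $G$ be a similarity graph with $n\ge 1$ vertices. However the arbitrary choices in BiPartition($G$) are made, the tree that it returns spans all vertices of $V$ if and only if $G$ has perfect HC-structure, and in that case this tree is an optimal HC-tree. Moreover BiPartition can be implemented to run in $O(n^4\log n)$ time: there is one program for a unit-cost random access machine, which accesses the weights only by comparing them, that on every similarity graph $G$ with $n$ vertices outputs a tree that BiPartition($G$) can return, together with the correct answer to the question whether $G$ has perfect HC-structure, within $\tau(n)=O(n^4\log n)$ steps. Hence perfect HC-structure can be tested, and an optimal HC-tree computed if $G$ has it, in $O(n^4\log n)$ time. -/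

import Mathlib

open scoped ENNReal

namespace HC

/-! ### Similarity graphs -/

/-- A similarity graph on the vertices `v_0, …, v_{n-1}`, given by its symmetric matrix of
non-negative weights (a missing edge has weight `0`). The diagonal is never used. -/
structure SimGraph (n : ℕ) where
  w : Fin n → Fin n → ℝ
  symm : ∀ i j, w i j = w j i
  nonneg : ∀ i j, 0 ≤ w i j

/-! ### Hierarchical clustering trees -/

/-- Finite rooted trees with labelled leaves: the empty tree, a single leaf, or a root with any
finite number `k` of child subtrees. -/
inductive Tree (V : Type) : Type
  | empty : Tree V
  | leaf (v : V) : Tree V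
  | node (k : ℕ) (child : Fin k → Tree V) : Tree V

namespace Tree

variable {V : Type}

/-- The labels of the leaves, with multiplicity. -/
def leaves : Tree V → Multiset V
  | empty => 0
  | leaf v => {v}
  | node _ c => ∑ i, (c i).leaves

/-- No empty subtree occurs and every internal node has a child, so that the childless nodes are
exactly the labelled leaves. -/
def Proper : Tree V → Prop
  | empty => False
  | leaf _ => True
  | node k c => 0 < k ∧ ∀ i, (c i).Proper

/-- `Sub u T`: `u` is the subtree of `T` rooted at one of the nodes of `T`. A node of an HC-tree is
identified with the subtree rooted at it, and then `Sub u T` says that `u` is a descendant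
of the root of `T` (possibly the root itself). -/
inductive Sub : Tree V → Tree V → Prop
  | refl (T : Tree V) : Sub T T
  | child {u : Tree V} {k : ℕ} {c : Fin k → Tree V} (i : Fin k) (h : Sub u (c i)) :
      Sub u (node k c)

/-- `u` is the lowest common ancestor in `T` of the leaves in `s`: it is a common ancestor, and a
descendant of every common ancestor. -/
def IsLCA (T : Tree V) (s : Set V) (u : Tree V) : Prop :=
  (u.Sub T ∧ ∀ v ∈ s, v ∈ u.leaves) ∧
    ∀ u' : Tree V, u'.Sub T → (∀ v ∈ s, v ∈ u'.leaves) → u.Sub u'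

/-- The relation `{i, j | k}` holds in `T`: the lowest common ancestor of `i, j` is a proper
descendant of the lowest common ancestor of `i, j, k`. -/
def MergedBefore (T : Tree V) (i j k : V) : Prop :=
  ∃ u u' : Tree V, T.IsLCA {i, j} u ∧ T.IsLCA {i, j, k} u' ∧ u.Sub u' ∧ u ≠ u'

/-- Every element of `V` is the label of a leaf. -/
def Spans (T : Tree V) : Prop := ∀ v, v ∈ T.leaves

/-- `T` is a rooted tree whose leaf set equals `V`. -/
def IsHCTree [Fintype V] (T : Tree V) : Prop :=
  T.Proper ∧ T.leaves = (Finset.univ : Finset V).val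

end Tree

/-! ### The cost functions -/

section Costs

variable {n : ℕ}

open Classical in
/-- The cost of the triplet `{i, j, k}` induced by `T`; the last case is that of three leaves which
are merged at the same time. -/
noncomputable def tripleCost (G : SimGraph n) (T : Tree (Fin n)) (i j k : Fin n) : ℝ :=
  if T.MergedBefore i j k then G.w i k + G.w j k
  else if T.MergedBefore i k j then G.w i j + G.w j k
  else if T.MergedBefore j k i then G.w i j + G.w i k
  else G.w i j + G.w j k + G.w i k

/-- The total cost: the sum of the costs over all (unordered) triplets. -/
noncomputable def totalCost (G : SimGraph n) (T : Tree (Fin n)) : ℝ :=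
  ∑ i, ∑ j ∈ Finset.Ioi i, ∑ k ∈ Finset.Ioi j, tripleCost G T i j k

noncomputable def minTripleCost (G : SimGraph n) (i j k : Fin n) : ℝ :=
  min (G.w i j + G.w i k) (min (G.w i j + G.w j k) (G.w i k + G.w j k))

noncomputable def baseCost (G : SimGraph n) : ℝ :=
  ∑ i, ∑ j ∈ Finset.Ioi i, ∑ k ∈ Finset.Ioi j, minTripleCost G i j k

open Classical in
/-- The ratio cost `totalCost / baseCost`, where `0 / 0 = 1` and `x / 0 = ∞` for `x > 0`. -/
noncomputable def ratioCost (G : SimGraph n) (T : Tree (Fin n)) : ℝ≥0∞ :=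
  if baseCost G = 0 then (if totalCost G T = 0 then 1 else ⊤)
  else ENNReal.ofReal (totalCost G T / baseCost G)

/-- `T` is an HC-tree of minimal ratio cost. -/
def IsOptimalTree (G : SimGraph n) (T : Tree (Fin n)) : Prop :=
  T.IsHCTree ∧ ∀ T' : Tree (Fin n), T'.IsHCTree → ratioCost G T ≤ ratioCost G T'

/-- The optimal ratio cost, i.e. the minimum of the ratio costs of all HC-trees, equals `1`. -/
def PerfectHC (G : SimGraph n) : Prop :=
  IsLeast {r | ∃ T : Tree (Fin n), T.IsHCTree ∧ ratioCost G T = r} 1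

end Costs

/-! ### The algorithm

The subgraph of `G` spanned by a set `S` of vertices is represented by `S`. -/

section Algorithm

variable {n : ℕ}

/-- The triplet `{i, j, k}` has `w i j` as its strictly largest weight. -/
def TypeOne (G : SimGraph n) (i j k : Fin n) : Prop :=
  i ≠ j ∧ i ≠ k ∧ j ≠ k ∧ G.w i k < G.w i j ∧ G.w j k < G.w i j

/-- The triplet `{i, j, k}` has exactly the two largest weights `w i j = w i k`. -/
def TypeTwo (G : SimGraph n) (i j k : Fin n) : Prop :=
  i ≠ j ∧ i ≠ k ∧ j ≠ k ∧ G.w i j = G.w i k ∧ G.w j k < G.w i j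

/-- Valid partitions of the subgraph spanned by `S`. -/
def ValidPartition (G : SimGraph n) {S : Finset (Fin n)} (P : Finpartition S) : Prop :=
  1 < P.parts.card ∧
  (∀ i ∈ S, ∀ j ∈ S, ∀ k ∈ S, TypeOne G i j k →
    (∃ C ∈ P.parts, i ∈ C ∧ j ∈ C ∧ k ∈ C) ∨
    (∃ C ∈ P.parts, ∃ D ∈ P.parts, C ≠ D ∧ i ∈ C ∧ j ∈ C ∧ k ∈ D)) ∧
  (∀ i ∈ S, ∀ j ∈ S, ∀ k ∈ S, TypeTwo G i j k →
    ¬ ∃ C ∈ P.parts, ∃ D ∈ P.parts, C ≠ D ∧ j ∈ C ∧ k ∈ C ∧ i ∈ D)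

/-- `(A, B)` is a valid bi-partition of the subgraph spanned by `S`. -/
def ValidBipartition (G : SimGraph n) (S A B : Finset (Fin n)) : Prop :=
  ∃ P : Finpartition S, P.parts = {A, B} ∧ ValidPartition G P

/-- The valid partition that refines every valid partition. -/
def MinimalValidPartition (G : SimGraph n) {S : Finset (Fin n)} (P : Finpartition S) : Prop :=
  ValidPartition G P ∧ ∀ Q : Finpartition S, ValidPartition G Q → P ≤ Q

/-- The points lie in `S`, and in pairwise different clusters of `P`. -/
def Crossing {S : Finset (Fin n)} (P : Finpartition S) (l : List (Fin n)) : Prop :=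
  (∀ x ∈ l, x ∈ S) ∧ l.Pairwise fun x y => P.part x ≠ P.part y

/-- `{y | a, b, c}` is a claw with respect to `P`. -/
def IsClaw (G : SimGraph n) {S : Finset (Fin n)} (P : Finpartition S) (y a b c : Fin n) : Prop :=
  Crossing P [y, a, b, c] ∧ G.w y a = G.w y b ∧ G.w y b = G.w y c ∧
    max (G.w a b) (max (G.w a c) (G.w b c)) < G.w y a

/-- `Y` consists of one representative of each cluster of `P`. -/
def IsTransversal {S : Finset (Fin n)} (P : Finpartition S) (Y : Finset (Fin n)) : Prop :=
  Y ⊆ S ∧ ∀ C ∈ P.parts, ∃! x, x ∈ Y ∧ x ∈ C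

/-- The graph of the light edges (those of weight less than `r`) between vertices of `Y`. -/
def lightGraph (G : SimGraph n) (Y : Finset (Fin n)) (r : ℝ) : SimpleGraph (Fin n) where
  Adj x y := x ≠ y ∧ x ∈ Y ∧ y ∈ Y ∧ G.w x y < r
  symm := ⟨fun x y h => ⟨h.1.symm, h.2.2.1, h.2.1, G.symm x y ▸ h.2.2.2⟩⟩
  loopless := ⟨fun _ h => h.1 rfl⟩

/-- `K` is a maximum clique, among those that contain `a, b, c`, of the light-edge graph on the
representatives `Y`. -/
def IsMaxLightClique (G : SimGraph n) (Y : Finset (Fin n)) (r : ℝ) (a b c : Fin n)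
    (K : Finset (Fin n)) : Prop :=
  (K ⊆ Y ∧ {a, b, c} ⊆ K ∧ (lightGraph G Y r).IsClique K) ∧
    ∀ K' : Finset (Fin n), K' ⊆ Y → {a, b, c} ⊆ K' → (lightGraph G Y r).IsClique K' →
      K'.card ≤ K.card

/-- The choices made in the case of a claw: a claw `{y | a, b, c}`, representatives `Y` of
the clusters which include its four points, and the maximum light clique `K`. -/
def ClawChoice (G : SimGraph n) {S : Finset (Fin n)} (P : Finpartition S)
    (K : Finset (Fin n)) : Prop :=
  ∃ (y a b c : Fin n) (Y : Finset (Fin n)), IsClaw G P y a b c ∧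
    IsTransversal P Y ∧ {y, a, b, c} ⊆ Y ∧ IsMaxLightClique G Y (G.w y a) a b c K

/-- The union of the clusters to which `z` assigns the value `b`. -/
def side {S : Finset (Fin n)} (P : Finpartition S) (z : Finset (Fin n) → Bool) (b : Bool) :
    Finset (Fin n) :=
  S.filter fun x => z (P.part x) = b

/-- The Boolean assignment `z` to the clusters yields two non-empty sides and satisfies all
constraints `z_j ≠ z_k` which come from the crossing triplets with `w i j = w i k > w j k`. -/
def GoodAssignment (G : SimGraph n) {S : Finset (Fin n)} (P : Finpartition S)
    (z : Finset (Fin n) → Bool) : Prop :=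
  (side P z true).Nonempty ∧ (side P z false).Nonempty ∧
    ∀ i j k, Crossing P [i, j, k] → TypeTwo G i j k → z (P.part j) ≠ z (P.part k)

/-- `ValidBisect G S A B`: the procedure that looks for a valid bi-partition of the subgraph spanned
by `S` can return `(A, B)`, for some resolution of its arbitrary choices; failure is
`(∅, ∅)`. It first computes the minimal valid partition `P` (and fails if there is none). If
there is a claw, it tries to split off one cluster that meets the light clique; if there is none,
it solves the constraints on the Boolean variables of the clusters. -/
inductive ValidBisect (G : SimGraph n) (S : Finset (Fin n)) :
    Finset (Fin n) → Finset (Fin n) → Prop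
  | noPartition (h : ¬ ∃ P : Finpartition S, ValidPartition G P) : ValidBisect G S ∅ ∅
  | claw (P : Finpartition S) (hP : MinimalValidPartition G P) (K : Finset (Fin n))
      (hK : ClawChoice G P K) (y : Fin n) (hy : y ∈ K)
      (hv : ValidBipartition G S (P.part y) (S \ P.part y)) :
      ValidBisect G S (P.part y) (S \ P.part y)
  | clawFail (P : Finpartition S) (hP : MinimalValidPartition G P) (K : Finset (Fin n))
      (hK : ClawChoice G P K)
      (hv : ∀ y ∈ K, ¬ ValidBipartition G S (P.part y) (S \ P.part y)) : ValidBisect G S ∅ ∅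
  | noClaw (P : Finpartition S) (hP : MinimalValidPartition G P)
      (hc : ¬ ∃ y a b c, IsClaw G P y a b c) (z : Finset (Fin n) → Bool)
      (hz : GoodAssignment G P z) : ValidBisect G S (side P z true) (side P z false)
  | noClawFail (P : Finpartition S) (hP : MinimalValidPartition G P)
      (hc : ¬ ∃ y a b c, IsClaw G P y a b c) (hz : ¬ ∃ z, GoodAssignment G P z) :
      ValidBisect G S ∅ ∅

/-- `BiPartition G S T`: the recursive algorithm, run on the subgraph spanned by `S`, can return the
tree `T` (for some resolution of its arbitrary choices). On a single vertex it returns a leaf. -/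
inductive BiPartition (G : SimGraph n) : Finset (Fin n) → Tree (Fin n) → Prop
  | single (v : Fin n) : BiPartition G {v} (Tree.leaf v)
  | fail (S A B : Finset (Fin n)) (hS : S.card ≠ 1) (h : ValidBisect G S A B)
      (hAB : A = ∅ ∨ B = ∅) : BiPartition G S Tree.empty
  | split (S A B : Finset (Fin n)) (hS : S.card ≠ 1) (h : ValidBisect G S A B)
      (hA : A ≠ ∅) (hB : B ≠ ∅) (TA TB : Tree (Fin n))
      (hTA : BiPartition G A TA) (hTB : BiPartition G B TB) :
      BiPartition G S (Tree.node 2 ![TA, TB])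

end Algorithm

/-! ### The machine

A comparison-based random access machine, programmed in a structured language. It has registers and
finitely many (per program) arrays that hold natural numbers. The numbers can be incremented,
decremented, compared and used as array indices; each operation has unit cost. The weights of the
input can be accessed only by comparing two of them. As there is no other arithmetic, no number
exceeds the larger of `n` and the constants of the program by more than the running time. -/

namespace Machine

structure State where
  reg : ℕ → ℕ
  arr : ℕ → ℕ → ℕ

/-- Constants, registers, array cells, and increment and (truncated) decrement. -/
inductive Expr : Type
  | lit (c : ℕ) : Expr
  | reg (x : ℕ) : Expr
  | load (a : ℕ) (i : Expr) : Expr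
  | succ (e : Expr) : Expr
  | pred (e : Expr) : Expr

namespace Expr

def eval (s : State) : Expr → ℕ
  | lit c => c
  | reg x => s.reg x
  | load a i => s.arr a (i.eval s)
  | succ e => e.eval s + 1
  | pred e => e.eval s - 1

def cost : Expr → ℕ
  | lit _ => 1
  | reg _ => 1
  | load _ i => i.cost + 1
  | succ e => e.cost + 1
  | pred e => e.cost + 1

end Expr

/-- Tests: `e < f` for numbers, `w_{ij} < w_{kl}` for input weights, negation and conjunction. -/
inductive Test : Type
  | lt (e f : Expr) : Test
  | wlt (i j k l : Expr) : Test
  | not (t : Test) : Test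
  | and (t u : Test) : Test

/-- The weight matrix with indices in `ℕ`, continued by `0`. -/
noncomputable def weight {n : ℕ} (G : SimGraph n) (i j : ℕ) : ℝ :=
  if h : i < n ∧ j < n then G.w ⟨i, h.1⟩ ⟨j, h.2⟩ else 0

namespace Test

def Holds {n : ℕ} (G : SimGraph n) (s : State) : Test → Prop
  | lt e f => e.eval s < f.eval s
  | wlt i j k l => weight G (i.eval s) (j.eval s) < weight G (k.eval s) (l.eval s)
  | not t => ¬ t.Holds G s
  | and t u => t.Holds G s ∧ u.Holds G s

def cost : Test → ℕ
  | lt e f => e.cost + f.cost + 1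
  | wlt i j k l => i.cost + j.cost + k.cost + l.cost + 1
  | not t => t.cost + 1
  | and t u => t.cost + u.cost + 1

end Test

/-- Programs. `assign x e` writes to a register, `store a i e` to the cell `i` of the array `a`. -/
inductive Prog : Type
  | skip : Prog
  | assign (x : ℕ) (e : Expr) : Prog
  | store (a : ℕ) (i e : Expr) : Prog
  | seq (p q : Prog) : Prog
  | cond (t : Test) (p q : Prog) : Prog
  | loop (t : Test) (p : Prog) : Prog

/-- `Exec G p s t s'`: with the weights of `G` as input, the program `p` started in the state `s`
halts after exactly `t` steps in the state `s'`. -/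
inductive Exec {n : ℕ} (G : SimGraph n) : Prog → State → ℕ → State → Prop
  | skip (s : State) : Exec G Prog.skip s 1 s
  | assign (s : State) (x : ℕ) (e : Expr) :
      Exec G (Prog.assign x e) s (e.cost + 1)
        ⟨Function.update s.reg x (e.eval s), s.arr⟩
  | store (s : State) (a : ℕ) (i e : Expr) :
      Exec G (Prog.store a i e) s (i.cost + e.cost + 1)
        ⟨s.reg, Function.update s.arr a (Function.update (s.arr a) (i.eval s) (e.eval s))⟩
  | seq {p q : Prog} {s s' s'' : State} {t t' : ℕ} (hp : Exec G p s t s')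
      (hq : Exec G q s' t' s'') : Exec G (Prog.seq p q) s (t + t') s''
  | condTrue {b : Test} {p q : Prog} {s s' : State} {t : ℕ} (hb : b.Holds G s)
      (hp : Exec G p s t s') : Exec G (Prog.cond b p q) s (b.cost + t) s'
  | condFalse {b : Test} {p q : Prog} {s s' : State} {t : ℕ} (hb : ¬ b.Holds G s)
      (hq : Exec G q s t s') : Exec G (Prog.cond b p q) s (b.cost + t) s'
  | loopTrue {b : Test} {p : Prog} {s s' s'' : State} {t t' : ℕ} (hb : b.Holds G s)
      (hp : Exec G p s t s') (hl : Exec G (Prog.loop b p) s' t' s'') :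
      Exec G (Prog.loop b p) s (b.cost + t + t') s''
  | loopFalse {b : Test} {p : Prog} {s : State} (hb : ¬ b.Holds G s) :
      Exec G (Prog.loop b p) s b.cost s

/-- Initially register `0` holds the number of vertices, and everything else is `0`. -/
def init (n : ℕ) : State where
  reg := Function.update (fun _ => 0) 0 n
  arr := fun _ _ => 0

/-- Prefix code of trees: `0` for the empty tree, `1, v` for a leaf, and `2, k` followed by
the codes of the children for a node with `k` children. -/
def code {n : ℕ} : Tree (Fin n) → List ℕ
  | Tree.empty => [0]
  | Tree.leaf v => [1, v]
  | Tree.node k c => 2 :: k :: (List.ofFn fun i => code (c i)).flatten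

/-- The tree written by the machine: array `0` starts with the code of `T`. -/
def OutputTree {n : ℕ} (s : State) (T : Tree (Fin n)) : Prop :=
  ∀ (m : ℕ) (h : m < (code T).length), s.arr 0 m = (code T)[m]

/-- The yes/no answer of the machine is given in register `1`. -/
def answer (s : State) : ℕ := s.reg 1

end Machine

end HC

/-! ### Valid partitions and the correctness of a single bisection -/

namespace HC

variable {n : ℕ} {G : SimGraph n} {S : Finset (Fin n)}

/-! ### Valid partitions -/

/-! One bisection. Between different clusters of a valid partition no triplet has a unique heaviest
pair, so the weights, read as distances, are ultrametric there (`ValidPartition.weight_le_max`). A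
valid bi-partition never cuts a cluster of the least valid partition, and its only further
constraints come from triplets i, j, k across clusters with w_ij = w_ik > w_jk: if j and k share a
side, then i is on it too. Without a claw this forces j and k apart (`separates_of_no_claw`), so the
valid bi-partitions are exactly the two-colourings of the clusters. With a claw, the pigeonhole
principle on a, b, c and the maximality of K show that one side is a single cluster meeting K
(`exists_mem_clique_of_claw`). Hence, whatever choices are made, a bisection succeeds if and only if
some valid bi-partition exists.

Trees. Each triplet costs at least its two smaller weights, so the ratio is 1 exactly when every
triplet attains this minimum: a heaviest pair is merged before the third point, or all three weights
vanish. Cutting such a tree at a child of a suitable node over S yields a valid bi-partition of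
every set S of at least two vertices (`exists_validBipartition_of_totalCost_eq`), so no earlier
choice can spoil a later one. Conversely, two points that a valid bi-partition separates from a
third have the largest weight (`ValidBipartition.weight_le`), so a tree built without failure
attains the base cost.

The program. It searches neither for claws nor for cliques. It computes the least valid partition by
closure and splits off a single cluster if that is valid, which is a legal result with or without a
claw (`part_union_sdiff_validBisect`). Otherwise it two-colours the clusters. Success excludes claws
(`IsClaw.not_goodAssignment`). On failure both branches of the procedure fail, the claw branch
because no cluster can be split off. Merging classes of sizes C and D costs O(nCD) and ends the
separation of CD pairs, so the closure takes O(n³) steps. There are at most 2n - 1 recursive calls,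
hence O(n⁴) steps in all. -/

theorem TypeTwo.swap {i j k : Fin n} (h : TypeTwo G i j k) : TypeTwo G i k j := by
  obtain ⟨h1, h2, h3, h4, h5⟩ := h
  exact ⟨h2, h1, h3.symm, h4.symm, by rw [← h4, G.symm k j]; exact h5⟩

theorem ValidPartition.part_eq_of_typeOne {P : Finpartition S} (h : ValidPartition G P)
    {i j k : Fin n} (hi : i ∈ S) (hj : j ∈ S) (hk : k ∈ S) (t : TypeOne G i j k) :
    P.part i = P.part j := by
  rcases h.2.1 i hi j hj k hk t with ⟨C, hC, h1, h2, -⟩ | ⟨C, hC, D, hD, -, h1, h2, -⟩ <;>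
  rw [P.part_eq_of_mem hC h1, P.part_eq_of_mem hC h2]

theorem ValidPartition.part_eq_of_typeTwo {P : Finpartition S} (h : ValidPartition G P)
    {i j k : Fin n} (hi : i ∈ S) (hj : j ∈ S) (hk : k ∈ S) (t : TypeTwo G i j k)
    (hjk : P.part j = P.part k) : P.part i = P.part j := by
  by_contra hne
  refine h.2.2 i hi j hj k hk t ⟨P.part j, P.part_mem.2 hj, P.part i, P.part_mem.2 hi,
    fun e => hne e.symm, P.mem_part hj, ?_, P.mem_part hi⟩
  rw [hjk]
  exact P.mem_part hk

/-- Apart from the number of clusters, validity is a set of Horn clauses for the relation of sharing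
a cluster. This is why a least valid partition can be computed by merging clusters. -/
theorem validPartition_iff {P : Finpartition S} : ValidPartition G P ↔
    1 < P.parts.card ∧
    (∀ i ∈ S, ∀ j ∈ S, ∀ k ∈ S, TypeOne G i j k → P.part i = P.part j) ∧
    (∀ i ∈ S, ∀ j ∈ S, ∀ k ∈ S, TypeTwo G i j k → P.part j = P.part k →
      P.part i = P.part j) := by
  refine ⟨fun h => ⟨h.1, fun i hi j hj k hk t => h.part_eq_of_typeOne hi hj hk t,
    fun i hi j hj k hk t e => h.part_eq_of_typeTwo hi hj hk t e⟩, fun ⟨h0, h1, h2⟩ => ⟨h0, ?_, ?_⟩⟩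
  · intro i hi j hj k hk t
    have e := h1 i hi j hj k hk t
    have hj' : j ∈ P.part i := e ▸ P.mem_part hj
    by_cases hk' : k ∈ P.part i
    · exact Or.inl ⟨P.part i, P.part_mem.2 hi, P.mem_part hi, hj', hk'⟩
    · refine Or.inr ⟨P.part i, P.part_mem.2 hi, P.part k, P.part_mem.2 hk, ?_, P.mem_part hi, hj',
        P.mem_part hk⟩
      intro e'
      exact hk' (e' ▸ P.mem_part hk)
  · rintro i hi j hj k hk t ⟨C, hC, D, hD, hne, hjC, hkC, hiD⟩
    have := h2 i hi j hj k hk t (by rw [P.part_eq_of_mem hC hjC, P.part_eq_of_mem hC hkC])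
    rw [P.part_eq_of_mem hC hjC, P.part_eq_of_mem hD hiD] at this
    exact hne this.symm

/-- The partition of `S` into the fibres of `f`. -/
noncomputable def fibrePartition (S : Finset (Fin n)) {β : Type*} (f : Fin n → β) :
    Finpartition S :=
  letI : DecidableRel (Setoid.ker f).r := Classical.decRel _
  Finpartition.ofSetSetoid (Setoid.ker f) S

theorem part_fibrePartition_eq_iff {β : Type*} (f : Fin n → β) {x y : Fin n} (hx : x ∈ S)
    (hy : y ∈ S) : (fibrePartition S f).part x = (fibrePartition S f).part y ↔ f x = f y := by
  rw [← Finpartition.mem_part_iff_part_eq_part _ hx hy, fibrePartition,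
    Finpartition.mem_part_ofSetSetoid_iff_rel]
  simp only [hx, hy, true_and, Setoid.ker_def]
  exact eq_comm

theorem one_lt_card_parts_iff (P : Finpartition S) :
    1 < P.parts.card ↔ ∃ x ∈ S, ∃ y ∈ S, P.part x ≠ P.part y := by
  rw [Finset.one_lt_card]
  constructor
  · rintro ⟨C, hC, D, hD, hne⟩
    obtain ⟨x, hx⟩ := P.nonempty_of_mem_parts hC
    obtain ⟨y, hy⟩ := P.nonempty_of_mem_parts hD
    exact ⟨x, P.le hC hx, y, P.le hD hy,
      by rwa [P.part_eq_of_mem hC hx, P.part_eq_of_mem hD hy]⟩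
  · rintro ⟨x, hx, y, hy, h⟩
    exact ⟨_, P.part_mem.2 hx, _, P.part_mem.2 hy, h⟩

theorem finpartition_le_iff (P Q : Finpartition S) :
    P ≤ Q ↔ ∀ x ∈ S, ∀ y ∈ S, P.part x = P.part y → Q.part x = Q.part y := by
  constructor
  · intro h x hx y hy e
    obtain ⟨C, hC, hle⟩ := h (P.part_mem.2 hx)
    rw [Q.part_eq_of_mem hC (hle (P.mem_part hx)),
      Q.part_eq_of_mem hC (hle (e ▸ P.mem_part hy))]
  · intro h C hC
    obtain ⟨x, hx⟩ := P.nonempty_of_mem_parts hC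
    have hxS := P.le hC hx
    refine ⟨Q.part x, Q.part_mem.2 hxS, fun y hy => ?_⟩
    have hyS := P.le hC hy
    rw [Q.mem_part_iff_part_eq_part hyS hxS]
    exact h y hyS x hxS (by rw [P.part_eq_of_mem hC hx, P.part_eq_of_mem hC hy])

theorem part_eq_filter (P : Finpartition S) {x : Fin n} (hx : x ∈ S) :
    P.part x = S.filter fun v => P.part v = P.part x := by
  ext v
  rw [Finset.mem_filter]
  constructor
  · intro hv
    have hvS := P.part_subset x hv
    exact ⟨hvS, (P.mem_part_iff_part_eq_part hvS hx).1 hv⟩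
  · rintro ⟨hvS, hv⟩
    exact (P.mem_part_iff_part_eq_part hvS hx).2 hv

/-! ### Valid bi-partitions -/

theorem validBipartition_iff {A B : Finset (Fin n)} : ValidBipartition G S A B ↔
    A ⊆ S ∧ B = S \ A ∧ A.Nonempty ∧ B.Nonempty ∧
    (∀ i ∈ S, ∀ j ∈ S, ∀ k ∈ S, TypeOne G i j k → (i ∈ A ↔ j ∈ A)) ∧
    (∀ i ∈ S, ∀ j ∈ S, ∀ k ∈ S, TypeTwo G i j k → (j ∈ A ↔ k ∈ A) → (i ∈ A ↔ j ∈ A)) := by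
  constructor
  · rintro ⟨P, hP, hv⟩
    have hA : A ∈ P.parts := by simp [hP]
    have hB : B ∈ P.parts := by simp [hP]
    have hne : A ≠ B := by
      rintro rfl
      have := hv.1
      simp [hP] at this
    have hS : S = A ∪ B := by
      rw [← P.biUnion_parts, hP]
      simp
    have hd : Disjoint A B := P.disjoint hA hB hne
    have hpart : ∀ i ∈ S, ∀ j ∈ S, (P.part i = P.part j ↔ (i ∈ A ↔ j ∈ A)) := by
      have key : ∀ i ∈ S, (P.part i = A ∧ i ∈ A) ∨ (P.part i = B ∧ i ∉ A) := by
        intro i hi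
        rw [hS, Finset.mem_union] at hi
        rcases hi with hi | hi
        · exact Or.inl ⟨P.part_eq_of_mem hA hi, hi⟩
        · exact Or.inr ⟨P.part_eq_of_mem hB hi, fun h => Finset.disjoint_left.1 hd h hi⟩
      intro i hi j hj
      rcases key i hi with ⟨h1, h2⟩ | ⟨h1, h2⟩ <;> rcases key j hj with ⟨h3, h4⟩ | ⟨h3, h4⟩ <;>
        simp [h1, h2, h3, h4, hne, hne.symm]
    refine ⟨P.le hA, ?_, P.nonempty_of_mem_parts hA, P.nonempty_of_mem_parts hB, ?_, ?_⟩
    · rw [hS, Finset.union_sdiff_cancel_left hd]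
    · intro i hi j hj k hk t
      exact (hpart i hi j hj).1 (hv.part_eq_of_typeOne hi hj hk t)
    · intro i hi j hj k hk t e
      exact (hpart i hi j hj).1
        (hv.part_eq_of_typeTwo hi hj hk t ((hpart j hj k hk).2 e))
  · rintro ⟨hAS, rfl, hA, hB, h1, h2⟩
    have hne : A ≠ S \ A := by
      obtain ⟨x, hx⟩ := hA
      intro e
      rw [e] at hx
      have := (Finset.mem_sdiff.1 hx).2
      rw [← e] at hx
      exact this hx
    have hd : Disjoint A (S \ A) := Finset.disjoint_sdiff
    let P : Finpartition S :=
      { parts := {A, S \ A}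
        supIndep := by
          rw [Finset.supIndep_iff_pairwiseDisjoint]
          intro C hC D hD hCD
          simp only [Finset.coe_insert, Finset.coe_singleton, Set.mem_insert_iff,
            Set.mem_singleton_iff] at hC hD
          rcases hC with rfl | rfl <;> rcases hD with rfl | rfl
          · exact absurd rfl hCD
          · exact hd
          · exact hd.symm
          · exact absurd rfl hCD
        sup_parts := by
          simpa using hAS
        bot_notMem := by
          simp only [Finset.bot_eq_empty, Finset.mem_insert, Finset.mem_singleton, not_or]
          exact ⟨hA.ne_empty.symm, hB.ne_empty.symm⟩ }
    have hAP : A ∈ P.parts := by simp [P]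
    have hBP : S \ A ∈ P.parts := by simp [P]
    have hpart : ∀ i ∈ S, ∀ j ∈ S, (P.part i = P.part j ↔ (i ∈ A ↔ j ∈ A)) := by
      have key : ∀ i ∈ S, (P.part i = A ∧ i ∈ A) ∨ (P.part i = S \ A ∧ i ∉ A) := by
        intro i hi
        by_cases h : i ∈ A
        · exact Or.inl ⟨P.part_eq_of_mem hAP h, h⟩
        · exact Or.inr ⟨P.part_eq_of_mem hBP (by simp [hi, h]), h⟩
      intro i hi j hj
      rcases key i hi with ⟨h1, h2⟩ | ⟨h1, h2⟩ <;> rcases key j hj with ⟨h3, h4⟩ | ⟨h3, h4⟩ <;>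
        simp only [h1, h2, h3, h4, hne, hne.symm, iff_true, iff_false, not_true]
    refine ⟨P, rfl, validPartition_iff.2 ⟨?_, ?_, ?_⟩⟩
    · exact Finset.one_lt_card.2 ⟨A, hAP, _, hBP, hne⟩
    · intro i hi j hj k hk t
      exact (hpart i hi j hj).2 (h1 i hi j hj k hk t)
    · intro i hi j hj k hk t e
      exact (hpart i hi j hj).2 (h2 i hi j hj k hk t ((hpart j hj k hk).1 e))

theorem ValidBipartition.symm {A B : Finset (Fin n)} (h : ValidBipartition G S A B) :
    ValidBipartition G S B A := by
  obtain ⟨P, hP, hv⟩ := h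
  exact ⟨P, by rw [hP, Finset.pair_comm], hv⟩

/-- The least valid partition refines the bi-partition, so every cluster lies on one side. -/
theorem MinimalValidPartition.mem_iff_mem {P : Finpartition S} (hP : MinimalValidPartition G P)
    {A B : Finset (Fin n)} (h : ValidBipartition G S A B) {x y : Fin n} (hx : x ∈ S) (hy : y ∈ S)
    (e : P.part x = P.part y) : x ∈ A ↔ y ∈ A := by
  obtain ⟨Q, hQ, hv⟩ := h
  have hA : A ∈ Q.parts := by simp [hQ]
  have := (finpartition_le_iff P Q).1 (hP.2 Q hv) x hx y hy e
  rw [← Q.part_eq_iff_mem hA, ← Q.part_eq_iff_mem hA, this]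

/-! ### Weights between different clusters -/

/-- Across the clusters of a valid partition the weights satisfy the ultrametric inequality. -/
theorem ValidPartition.weight_le_max {P : Finpartition S} (h : ValidPartition G P)
    {i j k : Fin n} (hi : i ∈ S) (hj : j ∈ S) (hk : k ∈ S) (hij : P.part i ≠ P.part j)
    (hik : P.part i ≠ P.part k) (hjk : P.part j ≠ P.part k) :
    G.w i j ≤ max (G.w i k) (G.w j k) := by
  by_contra hlt
  rw [not_le, max_lt_iff] at hlt
  exact hij (h.part_eq_of_typeOne hi hj hk ⟨fun e => hij (e ▸ rfl), fun e => hik (e ▸ rfl),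
    fun e => hjk (e ▸ rfl), hlt.1, hlt.2⟩)

/-- Transitivity, across clusters, of being lighter than `r`. -/
theorem ValidPartition.weight_lt {P : Finpartition S} (h : ValidPartition G P)
    {i j k : Fin n} {r : ℝ} (hi : i ∈ S) (hj : j ∈ S) (hk : k ∈ S) (hij : P.part i ≠ P.part j)
    (hik : P.part i ≠ P.part k) (hjk : P.part j ≠ P.part k)
    (h1 : G.w i k < r) (h2 : G.w j k < r) : G.w i j < r :=
  (h.weight_le_max hi hj hk hij hik hjk).trans_lt (max_lt h1 h2)

/-- An outer point at distance at least `r` from two close points is equally far from them. -/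
theorem ValidPartition.typeTwo_of_far {P : Finpartition S} (h : ValidPartition G P)
    {u j k : Fin n} {r : ℝ} (hu : u ∈ S) (hj : j ∈ S) (hk : k ∈ S) (huj : P.part u ≠ P.part j)
    (huk : P.part u ≠ P.part k) (hjk : P.part j ≠ P.part k)
    (hr : G.w j k < r) (hfar : r ≤ G.w u j) : TypeTwo G u j k := by
  have h1 : G.w u j ≤ G.w u k := by
    rcases le_max_iff.1 (h.weight_le_max hu hj hk huj huk hjk) with h1 | h1
    · exact h1
    · linarith
  have h2 : G.w u k ≤ G.w u j := by
    rcases le_max_iff.1 (h.weight_le_max hu hk hj huk huj hjk.symm) with h2 | h2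
    · exact h2
    · rw [G.symm k j] at h2
      linarith
  exact ⟨fun e => huj (e ▸ rfl), fun e => huk (e ▸ rfl), fun e => hjk (e ▸ rfl),
    le_antisymm h1 h2, by linarith⟩

/-! ### Splitting with and without a claw -/

theorem crossing_triple {P : Finpartition S} {i j k : Fin n} : Crossing P [i, j, k] ↔
    (i ∈ S ∧ j ∈ S ∧ k ∈ S) ∧ P.part i ≠ P.part j ∧ P.part i ≠ P.part k ∧
      P.part j ≠ P.part k := by
  simp [Crossing]
  tauto

theorem crossing_quadruple {P : Finpartition S} {y a b c : Fin n} : Crossing P [y, a, b, c] ↔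
    (y ∈ S ∧ a ∈ S ∧ b ∈ S ∧ c ∈ S) ∧ P.part y ≠ P.part a ∧ P.part y ≠ P.part b ∧
      P.part y ≠ P.part c ∧ P.part a ≠ P.part b ∧ P.part a ≠ P.part c ∧ P.part b ≠ P.part c := by
  simp [Crossing]
  tauto

/-- In the absence of claws a valid bi-partition separates every crossing triplet of type two. -/
theorem separates_of_no_claw {P : Finpartition S} (hP : MinimalValidPartition G P)
    (hc : ¬ ∃ y a b c, IsClaw G P y a b c) {A B : Finset (Fin n)}
    (h : ValidBipartition G S A B) {i j k : Fin n} (hcr : Crossing P [i, j, k])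
    (t : TypeTwo G i j k) : ¬ (j ∈ A ↔ k ∈ A) := by
  intro hjk
  obtain ⟨⟨hi, hj, hk⟩, pij, pik, pjk⟩ := crossing_triple.1 hcr
  obtain ⟨hAS, hB, hAne, hBne, -, h2⟩ := validBipartition_iff.1 h
  have hij := h2 i hi j hj k hk t hjk
  -- If `j` and `k` shared a side, `i` would be there too. A point `u` of the other side then lies
  -- in a fourth cluster.
  obtain ⟨u, hu, huj⟩ : ∃ u ∈ S, ¬ (u ∈ A ↔ j ∈ A) := by
    by_cases hjA : j ∈ A
    · obtain ⟨u, hu⟩ := hBne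
      rw [hB, Finset.mem_sdiff] at hu
      exact ⟨u, hu.1, by tauto⟩
    · obtain ⟨u, hu⟩ := hAne
      exact ⟨u, hAS hu, by tauto⟩
  have puj : P.part u ≠ P.part j := fun e => huj (hP.mem_iff_mem h hu hj e)
  have puk : P.part u ≠ P.part k := fun e => huj ((hP.mem_iff_mem h hu hk e).trans hjk.symm)
  have pui : P.part u ≠ P.part i := fun e => huj ((hP.mem_iff_mem h hu hi e).trans hij)
  obtain ⟨-, -, -, e, hlt⟩ := t
  -- If `u` is light to `j`, then `j, k, u` are pairwise light and equally far from `i`, which is a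
  -- claw. Otherwise `u` is itself an apex over `j, k` and has to be on their side.
  by_cases hlight : G.w u j < G.w i j
  · have huk : G.w u k < G.w i j :=
      hP.1.weight_lt hu hk hj puk puj pjk.symm hlight (G.symm k j ▸ hlt)
    have hge : G.w i j ≤ G.w i u := by
      rcases le_max_iff.1 (hP.1.weight_le_max hi hj hu pij pui.symm puj.symm) with h' | h'
      · exact h'
      · rw [G.symm j u] at h'
        linarith
    have hle : G.w i u ≤ G.w i j := by
      rcases le_max_iff.1 (hP.1.weight_le_max hi hu hj pui.symm pij puj) with h' | h'
      · exact h'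
      · linarith
    refine hc ⟨i, j, k, u, crossing_quadruple.2 ⟨⟨hi, hj, hk, hu⟩, pij, pik, pui.symm, pjk,
      puj.symm, puk.symm⟩, e, by linarith, ?_⟩
    rw [G.symm j u, G.symm k u]
    exact max_lt hlt (max_lt hlight huk)
  · exact huj (h2 u hu j hj k hk
      (hP.1.typeTwo_of_far hu hj hk puj puk pjk hlt (not_lt.1 hlight)) hjk)

theorem mem_side {P : Finpartition S} {z : Finset (Fin n) → Bool} {b : Bool} {x : Fin n} :
    x ∈ side P z b ↔ x ∈ S ∧ z (P.part x) = b := by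
  simp [side]

/-- Crossing triplets are the only ones that need a constraint: if two of the points share a
cluster, the validity of `P` settles the conditions. -/
theorem GoodAssignment.validBipartition {P : Finpartition S} (hP : ValidPartition G P)
    {z : Finset (Fin n) → Bool} (hz : GoodAssignment G P z) :
    ValidBipartition G S (side P z true) (side P z false) := by
  refine validBipartition_iff.2 ⟨fun x hx => (mem_side.1 hx).1, ?_, hz.1, hz.2.1, ?_, ?_⟩
  · ext x
    simp only [Finset.mem_sdiff, mem_side]
    cases z (P.part x) <;> simp
  · intro i hi j hj k hk t
    simp only [mem_side, hi, hj, true_and, hP.part_eq_of_typeOne hi hj hk t]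
  · intro i hi j hj k hk t e
    simp only [mem_side, hi, hj, hk, true_and] at e ⊢
    have hz' : z (P.part j) = z (P.part k) := by
      revert e
      cases z (P.part j) <;> cases z (P.part k) <;> simp
    by_cases pjk : P.part j = P.part k
    · rw [hP.part_eq_of_typeTwo hi hj hk t pjk]
    by_cases pij : P.part i = P.part j
    · rw [pij]
    by_cases pik : P.part i = P.part k
    · rw [pik, hz']
    exact absurd hz' (hz.2.2 i j k (crossing_triple.2 ⟨⟨hi, hj, hk⟩, pij, pik, pjk⟩) t)

theorem goodAssignment_of_no_claw {P : Finpartition S} (hP : MinimalValidPartition G P)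
    (hc : ¬ ∃ y a b c, IsClaw G P y a b c) {A B : Finset (Fin n)}
    (h : ValidBipartition G S A B) :
    ∃ z, GoodAssignment G P z ∧ side P z true = A ∧ side P z false = B := by
  classical
  obtain ⟨hAS, hB, hAne, hBne, -, -⟩ := validBipartition_iff.1 h
  -- No cluster is cut, so a cluster that meets `A` is contained in `A`.
  let z : Finset (Fin n) → Bool := fun C => decide (∃ x ∈ C, x ∈ A)
  have hz : ∀ x ∈ S, (z (P.part x) = true ↔ x ∈ A) := by
    intro x hx
    simp only [z, decide_eq_true_eq]
    constructor
    · rintro ⟨y, hy, hyA⟩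
      have hyS := P.part_subset x hy
      exact (hP.mem_iff_mem h hyS hx ((P.mem_part_iff_part_eq_part hyS hx).1 hy)).1 hyA
    · intro hxA
      exact ⟨x, P.mem_part hx, hxA⟩
  have h1 : side P z true = A := by
    ext x
    rw [mem_side]
    exact ⟨fun hx => (hz x hx.1).1 hx.2, fun hx => ⟨hAS hx, (hz x (hAS hx)).2 hx⟩⟩
  have h2 : side P z false = B := by
    ext x
    rw [mem_side, hB, Finset.mem_sdiff]
    refine and_congr_right fun hx => ?_
    rw [← hz x hx, Bool.not_eq_true]
  refine ⟨z, ⟨h1 ▸ hAne, h2 ▸ hBne, ?_⟩, h1, h2⟩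
  intro i j k hcr t e
  have hm := crossing_triple.1 hcr
  refine separates_of_no_claw hP hc h hcr t ?_
  rw [← hz j hm.1.2.1, ← hz k hm.1.2.2, e]

/-- There are no three pairwise different bits. Thus a good assignment certifies the absence of
claws, and an implementation need not look for one. -/
theorem IsClaw.not_goodAssignment {P : Finpartition S} {y a b c : Fin n}
    (hc : IsClaw G P y a b c) (z : Finset (Fin n) → Bool) : ¬ GoodAssignment G P z := by
  intro hz
  obtain ⟨hcr, e1, e2, hm⟩ := hc
  obtain ⟨⟨hy, ha, hb, hc⟩, pya, pyb, pyc, pab, pac, pbc⟩ := crossing_quadruple.1 hcr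
  have hne : ∀ {u v : Fin n}, P.part u ≠ P.part v → u ≠ v := fun h e => h (e ▸ rfl)
  simp only [max_lt_iff] at hm
  have h1 := hz.2.2 y a b (crossing_triple.2 ⟨⟨hy, ha, hb⟩, pya, pyb, pab⟩)
    ⟨hne pya, hne pyb, hne pab, e1, hm.1⟩
  have h2 := hz.2.2 y a c (crossing_triple.2 ⟨⟨hy, ha, hc⟩, pya, pyc, pac⟩)
    ⟨hne pya, hne pyc, hne pac, e1.trans e2, hm.2.1⟩
  have h3 := hz.2.2 y b c (crossing_triple.2 ⟨⟨hy, hb, hc⟩, pyb, pyc, pbc⟩)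
    ⟨hne pyb, hne pyc, hne pbc, e2, e1 ▸ hm.2.2⟩
  revert h1 h2 h3
  cases z (P.part a) <;> cases z (P.part b) <;> cases z (P.part c) <;> simp

theorem IsTransversal.part_ne {P : Finpartition S} {Y : Finset (Fin n)} (hY : IsTransversal P Y)
    {x x' : Fin n} (hx : x ∈ Y) (hx' : x' ∈ Y) (hne : x ≠ x') : P.part x ≠ P.part x' := by
  intro e
  have hxS := hY.1 hx
  have hxS' := hY.1 hx'
  exact hne ((hY.2 _ (P.part_mem.2 hxS)).unique ⟨hx, P.mem_part hxS⟩
    ⟨hx', e ▸ P.mem_part hxS'⟩)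

/-- If there is a claw, then each valid bi-partition splits off a single cluster, and this cluster
meets the light clique. -/
theorem exists_mem_clique_of_claw {P : Finpartition S} (hP : MinimalValidPartition G P)
    {K : Finset (Fin n)} (hK : ClawChoice G P K) {A B : Finset (Fin n)}
    (h : ValidBipartition G S A B) :
    ∃ x ∈ K, x ∈ S ∧ (∃ y ∈ S, ∃ z ∈ S, P.part y ≠ P.part z ∧ P.part y ≠ P.part x ∧
      P.part z ≠ P.part x) ∧ ((∀ v ∈ S, (v ∈ A ↔ P.part v = P.part x)) ∨
      (∀ v ∈ S, (v ∉ A ↔ P.part v = P.part x))) := by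
  classical
  obtain ⟨y, a, b, c, Y, hclaw, hY, hsub, ⟨hKY, habc, hclique⟩, hmax⟩ := hK
  obtain ⟨hcr, e1, e2, hm⟩ := hclaw
  obtain ⟨⟨hy, ha, hb, hc⟩, pya, pyb, pyc, pab, pac, pbc⟩ := crossing_quadruple.1 hcr
  obtain ⟨hAS, hB, hAne, hBne, -, h2⟩ := validBipartition_iff.1 h
  have hyY : y ∈ Y := hsub (by simp)
  have haK : a ∈ K := habc (by simp)
  have hbK : b ∈ K := habc (by simp)
  have hcK : c ∈ K := habc (by simp)
  have hne : ∀ {u v : Fin n}, P.part u ≠ P.part v → u ≠ v := fun h e => h (e ▸ rfl)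
  have hlight : ∀ x ∈ K, ∀ x' ∈ K, x ≠ x' → G.w x x' < G.w y a := fun x hx x' hx' hxx =>
    (hclique hx hx' hxx).2.2.2
  have hyK : y ∉ K := fun hyK => lt_irrefl _ (hlight y hyK a haK (hne pya))
  -- A representative light to one member of `K` is light to all of them by transitivity, and could
  -- be added to `K`, against its maximality.
  have hfar : ∀ u ∈ Y, u ∉ K → ∀ x ∈ K, G.w y a ≤ G.w u x := by
    intro u hu huK x hx
    by_contra hlt
    rw [not_le] at hlt
    have hall : ∀ x' ∈ K, G.w u x' < G.w y a := by
      intro x' hx'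
      have hux : u ≠ x := fun e => huK (e ▸ hx)
      have hux' : u ≠ x' := fun e => huK (e ▸ hx')
      by_cases hxx : x' = x
      · exact hxx ▸ hlt
      · exact hP.1.weight_lt (hY.1 hu) (hY.1 (hKY hx')) (hY.1 (hKY hx))
          (hY.part_ne hu (hKY hx') hux') (hY.part_ne hu (hKY hx) hux)
          (hY.part_ne (hKY hx') (hKY hx) hxx) hlt (hlight x' hx' x hx hxx)
    have hcl : (lightGraph G Y (G.w y a)).IsClique (insert u K : Finset (Fin n)) := by
      rw [Finset.coe_insert, SimpleGraph.isClique_insert]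
      refine ⟨hclique, fun x' hx' hux' => ⟨hux', hu, hKY hx', hall x' hx'⟩⟩
    have := hmax (insert u K) (Finset.insert_subset hu hKY)
      (habc.trans (Finset.subset_insert u K)) hcl
    rw [Finset.card_insert_of_notMem huK] at this
    omega
  have htwo : ∀ u ∈ Y, u ∉ K → ∀ x ∈ K, ∀ x' ∈ K, x ≠ x' → (x ∈ A ↔ x' ∈ A) →
      (u ∈ A ↔ x ∈ A) := by
    intro u hu huK x hx x' hx' hxx
    have hux : u ≠ x := fun e => huK (e ▸ hx)
    have hux' : u ≠ x' := fun e => huK (e ▸ hx')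
    exact h2 u (hY.1 hu) x (hY.1 (hKY hx)) x' (hY.1 (hKY hx'))
      (hP.1.typeTwo_of_far (hY.1 hu) (hY.1 (hKY hx)) (hY.1 (hKY hx'))
        (hY.part_ne hu (hKY hx) hux) (hY.part_ne hu (hKY hx') hux')
        (hY.part_ne (hKY hx) (hKY hx') hxx) (hlight x hx x' hx' hxx) (hfar u hu huK x hx))
  have hrep : ∀ v ∈ S, ∃ v' ∈ Y, P.part v = P.part v' ∧ (v ∈ A ↔ v' ∈ A) := by
    intro v hv
    obtain ⟨v', ⟨hv'Y, hv'⟩, -⟩ := hY.2 _ (P.part_mem.2 hv)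
    have hv'S := hY.1 hv'Y
    have e := (P.mem_part_iff_part_eq_part hv'S hv).1 hv'
    exact ⟨v', hv'Y, e.symm, hP.mem_iff_mem h hv hv'S e.symm⟩
  -- Pigeonhole: two of `a, b, c` are on the same side. Every representative outside `K` is an apex
  -- over these two and follows them.
  obtain ⟨p, hp, q, hq, hpq, hpqA⟩ : ∃ p ∈ K, ∃ q ∈ K, p ≠ q ∧ (p ∈ A ↔ q ∈ A) := by
    by_cases h1 : (a ∈ A ↔ b ∈ A)
    · exact ⟨a, haK, b, hbK, hne pab, h1⟩
    by_cases h2 : (a ∈ A ↔ c ∈ A)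
    · exact ⟨a, haK, c, hcK, hne pac, h2⟩
    · exact ⟨b, hbK, c, hcK, hne pbc, by tauto⟩
  have hout : ∀ u ∈ Y, u ∉ K → (u ∈ A ↔ p ∈ A) := fun u hu huK =>
    htwo u hu huK p hp q hq hpq hpqA
  obtain ⟨x, hx, hxp⟩ : ∃ x ∈ K, ¬ (x ∈ A ↔ p ∈ A) := by
    by_contra hall
    push Not at hall
    have hS : ∀ v ∈ S, (v ∈ A ↔ p ∈ A) := by
      intro v hv
      obtain ⟨v', hv', -, e⟩ := hrep v hv
      rw [e]
      by_cases hvK : v' ∈ K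
      · exact hall v' hvK
      · exact hout v' hv' hvK
    obtain ⟨s, hs⟩ := hAne
    obtain ⟨s', hs'⟩ := hBne
    rw [hB, Finset.mem_sdiff] at hs'
    exact hs'.2 ((hS s' hs'.1).2 ((hS s (hAS hs)).1 hs))
  -- A second member of `K` on the side of `x` would, together with `x`, pull `y` over to that side,
  -- but `y` is on the side of `p`.
  have honly : ∀ x' ∈ Y, x' ≠ x → (x' ∈ A ↔ p ∈ A) := by
    intro x' hx' hxx
    by_cases hxK : x' ∈ K
    · by_contra hcon
      have := htwo y hyY hyK x hx x' hxK hxx.symm (by tauto)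
      have := hout y hyY hyK
      tauto
    · exact hout x' hx' hxK
  have hxS := hY.1 (hKY hx)
  have hiff : ∀ v ∈ S, (¬ (v ∈ A ↔ p ∈ A) ↔ P.part v = P.part x) := by
    intro v hv
    obtain ⟨v', hv', e, e'⟩ := hrep v hv
    rw [e, e']
    by_cases hv'x : v' = x
    · subst hv'x
      simp [hxp]
    · have h1 := honly v' hv' hv'x
      have h2 := hY.part_ne hv' (hKY hx) hv'x
      tauto
  have hyx : P.part y ≠ P.part x := hY.part_ne hyY (hKY hx) (fun e => hyK (e ▸ hx))
  have hpx : P.part p ≠ P.part x := hY.part_ne (hKY hp) (hKY hx) (fun e => hxp (e ▸ Iff.rfl))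
  have hyp : P.part y ≠ P.part p := hY.part_ne hyY (hKY hp) (fun e => hyK (e ▸ hp))
  -- The points `y` and `p` witness two further clusters. This is what later distinguishes the split
  -- cluster from its complement.
  refine ⟨x, hx, hxS, ⟨y, hy, p, hY.1 (hKY hp), hyp, hyx, hpx⟩, ?_⟩
  by_cases hpA : p ∈ A
  · right
    intro v hv
    rw [← hiff v hv]
    tauto
  · left
    intro v hv
    rw [← hiff v hv]
    tauto

theorem exists_isTransversal (P : Finpartition S) (Z : Finset (Fin n)) (hZ : Z ⊆ S)
    (hd : ∀ x ∈ Z, ∀ y ∈ Z, P.part x = P.part y → x = y) :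
    ∃ Y, IsTransversal P Y ∧ Z ⊆ Y := by
  classical
  have hex : ∀ C ∈ P.parts, ∃ x ∈ C, (∃ z ∈ Z, z ∈ C) → x ∈ Z := by
    intro C hC
    by_cases h : ∃ z ∈ Z, z ∈ C
    · obtain ⟨z, hz, hzC⟩ := h
      exact ⟨z, hzC, fun _ => hz⟩
    · obtain ⟨x, hx⟩ := P.nonempty_of_mem_parts hC
      exact ⟨x, hx, fun h' => absurd h' h⟩
  choose g hg1 hg2 using hex
  refine ⟨P.parts.attach.image fun C => g C.1 C.2, ⟨?_, ?_⟩, ?_⟩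
  · intro x hx
    obtain ⟨C, -, rfl⟩ := Finset.mem_image.1 hx
    exact P.le C.2 (hg1 C.1 C.2)
  · intro C hC
    refine ⟨g C hC, ⟨Finset.mem_image.2 ⟨⟨C, hC⟩, Finset.mem_attach _ _, rfl⟩, hg1 C hC⟩, ?_⟩
    rintro x ⟨hx, hxC⟩
    obtain ⟨⟨D, hD⟩, -, rfl⟩ := Finset.mem_image.1 hx
    obtain rfl := P.eq_of_mem_parts hC hD hxC (hg1 D hD)
    rfl
  · intro z hz
    have hzS := hZ hz
    have hC := P.part_mem.2 hzS
    have h1 := hg2 _ hC ⟨z, hz, P.mem_part hzS⟩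
    have h2 := hg1 _ hC
    have : g (P.part z) hC = z := hd _ h1 _ hz
      ((P.mem_part_iff_part_eq_part (hZ h1) hzS).1 h2)
    exact Finset.mem_image.2 ⟨⟨_, hC⟩, Finset.mem_attach _ _, this⟩

/-- The claw branch can always be carried out: `{a, b, c}` is itself a light clique, so a maximum
one containing it exists. -/
theorem IsClaw.exists_clawChoice {P : Finpartition S} {y a b c : Fin n}
    (h : IsClaw G P y a b c) : ∃ K, ClawChoice G P K := by
  classical
  obtain ⟨hcr, e1, e2, hm⟩ := id h
  obtain ⟨⟨hy, ha, hb, hc⟩, pya, pyb, pyc, pab, pac, pbc⟩ := crossing_quadruple.1 hcr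
  have hne : ∀ {u v : Fin n}, P.part u ≠ P.part v → u ≠ v := fun h e => h (e ▸ rfl)
  obtain ⟨Y, hY, hZY⟩ := exists_isTransversal P {y, a, b, c}
    (by simp [Finset.insert_subset_iff, hy, ha, hb, hc])
    (by
      simp only [Finset.mem_insert, Finset.mem_singleton]
      rintro x (rfl | rfl | rfl | rfl) x' (rfl | rfl | rfl | rfl) e <;>
        first
        | rfl
        | exact absurd e (by assumption)
        | exact absurd e.symm (by assumption))
  have haY : a ∈ Y := hZY (by simp)
  have hbY : b ∈ Y := hZY (by simp)
  have hcY : c ∈ Y := hZY (by simp)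
  let F := Y.powerset.filter fun K : Finset (Fin n) => {a, b, c} ⊆ K ∧ (lightGraph G Y (G.w y a)).IsClique K
  simp only [max_lt_iff] at hm
  have hF : F.Nonempty := by
    refine ⟨{a, b, c}, ?_⟩
    simp only [F, Finset.mem_filter, Finset.mem_powerset, subset_refl, true_and]
    refine ⟨by simp [Finset.insert_subset_iff, haY, hbY, hcY], ?_⟩
    simp only [Finset.coe_insert, Finset.coe_singleton, SimpleGraph.isClique_insert,
      SimpleGraph.isClique_singleton, Set.mem_insert_iff, Set.mem_singleton_iff, true_and]
    refine ⟨?_, ?_⟩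
    · rintro x rfl -
      exact ⟨hne pbc, hbY, hcY, hm.2.2⟩
    · rintro x (rfl | rfl) -
      · exact ⟨hne pab, haY, hbY, hm.1⟩
      · exact ⟨hne pac, haY, hcY, hm.2.1⟩
  obtain ⟨K, hK, hmax⟩ := F.exists_max_image Finset.card hF
  simp only [F, Finset.mem_filter, Finset.mem_powerset] at hK hmax
  exact ⟨K, y, a, b, c, Y, h, hY, hZY, hK, fun K' h1 h2 h3 => hmax K' ⟨h1, h2, h3⟩⟩

/-- Splitting off one cluster is a legal outcome in both branches, so it can be tried without
knowing whether there is a claw. With a claw, the bi-partition splits off the cluster of some clique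
point `x'`. This is the cluster of `x`: were it the complement instead, then all other clusters, of
which there are at least two, would lie inside the single cluster of `x`. -/
theorem part_union_sdiff_validBisect {P : Finpartition S} (hP : MinimalValidPartition G P)
    {x : Fin n} (hx : x ∈ S) (h : ValidBipartition G S (P.part x) (S \ P.part x)) :
    ValidBisect G S (P.part x) (S \ P.part x) := by
  by_cases hc : ∃ y a b c, IsClaw G P y a b c
  · obtain ⟨y, a, b, c, hc⟩ := hc
    obtain ⟨K, hK⟩ := hc.exists_clawChoice
    obtain ⟨x', hx', hxS', ⟨u, hu, v, hv, huv, hux, hvx⟩, h1 | h1⟩ :=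
      exists_mem_clique_of_claw hP hK h
    · have e : P.part x = P.part x' := (h1 x hx).1 (P.mem_part hx)
      rw [e] at h ⊢
      exact ValidBisect.claw P hP K hK x' hx' h
    · have h2 : ∀ w ∈ S, P.part w ≠ P.part x' → P.part w = P.part x := by
        intro w hw hne
        have : w ∈ P.part x := by
          by_contra hcon
          exact hne ((h1 w hw).1 hcon)
        exact (P.mem_part_iff_part_eq_part hw hx).1 this
      exact absurd ((h2 u hu hux).trans (h2 v hv hvx).symm) huv
  · obtain ⟨z, hz, h1, h2⟩ := goodAssignment_of_no_claw hP hc h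
    have := ValidBisect.noClaw P hP hc z hz
    rwa [h1, h2] at this

theorem ValidBisect.validBipartition {A B : Finset (Fin n)} (h : ValidBisect G S A B)
    (hA : A ≠ ∅) : ValidBipartition G S A B := by
  cases h with
  | noPartition h => exact absurd rfl hA
  | claw P hP K hK y hy hv => exact hv
  | clawFail P hP K hK hv => exact absurd rfl hA
  | noClaw P hP hc z hz => exact hz.validBipartition hP.1
  | noClawFail P hP hc hz => exact absurd rfl hA

/-- Completeness of a bisection: in each branch the valid bi-partitions have the form that the
branch looks for, so an existing one rules out failure. -/
theorem ValidBisect.nonempty_of_exists {A B A' B' : Finset (Fin n)} (h : ValidBisect G S A B)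
    (h' : ValidBipartition G S A' B') : A ≠ ∅ ∧ B ≠ ∅ := by
  cases h with
  | noPartition h =>
    obtain ⟨P, -, hP⟩ := h'
    exact absurd ⟨P, hP⟩ h
  | claw P hP K hK y hy hv =>
    have := validBipartition_iff.1 hv
    exact ⟨this.2.2.1.ne_empty, this.2.2.2.1.ne_empty⟩
  | clawFail P hP K hK hv =>
    exfalso
    obtain ⟨x, hx, hxS, -, h1⟩ := exists_mem_clique_of_claw hP hK h'
    obtain ⟨hAS, hB, -⟩ := validBipartition_iff.1 h'
    have key : ∀ C D : Finset (Fin n), ValidBipartition G S C D →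
        (∀ v ∈ S, (v ∈ C ↔ P.part v = P.part x)) → False := by
      intro C D hCD hC
      obtain ⟨hCS, hD, -⟩ := validBipartition_iff.1 hCD
      have e : C = P.part x := by
        rw [part_eq_filter P hxS]
        ext v
        rw [Finset.mem_filter]
        exact ⟨fun hv => ⟨hCS hv, (hC v (hCS hv)).1 hv⟩, fun hv => (hC v hv.1).2 hv.2⟩
      rw [hD, e] at hCD
      exact hv x hx hCD
    rcases h1 with h1 | h1
    · exact key A' B' h' h1
    · refine key B' A' h'.symm fun v hv => ?_
      rw [hB, Finset.mem_sdiff, ← h1 v hv]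
      simp [hv]
  | noClaw P hP hc z hz => exact ⟨hz.1.ne_empty, hz.2.1.ne_empty⟩
  | noClawFail P hP hc hz =>
    obtain ⟨z, hz', -⟩ := goodAssignment_of_no_claw hP hc h'
    exact absurd ⟨z, hz'⟩ hz

end HC

/-! ### Trees of base cost and valid bi-partitions of all vertex sets -/

namespace HC

/-! ### Lowest common ancestors -/

namespace Tree

variable {V : Type}

theorem mem_leaves_node {k : ℕ} {c : Fin k → Tree V} {v : V} :
    v ∈ (node k c).leaves ↔ ∃ i, v ∈ (c i).leaves := by
  simp [leaves, Multiset.mem_sum]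

theorem Sub.mem_leaves {u T : Tree V} (h : u.Sub T) {v : V} (hv : v ∈ u.leaves) :
    v ∈ T.leaves := by
  induction h with
  | refl => exact hv
  | child i h ih => exact mem_leaves_node.2 ⟨i, ih⟩

/-- The number of nodes. -/
def size : Tree V → ℕ
  | empty => 1
  | leaf _ => 1
  | node _ c => 1 + ∑ i, (c i).size

theorem Sub.eq_or_size_lt {u T : Tree V} (h : u.Sub T) : u = T ∨ u.size < T.size := by
  induction h with
  | refl => exact Or.inl rfl
  | @child k c i h ih =>
    right
    have h1 : (c i).size ≤ ∑ j, (c j).size :=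
      Finset.single_le_sum (f := fun j => (c j).size) (fun _ _ => Nat.zero_le _)
        (Finset.mem_univ i)
    have h2 : u.size ≤ (c i).size := by
      rcases ih with rfl | ih
      · exact le_rfl
      · exact ih.le
    simp only [size]
    omega

theorem Sub.antisymm {u u' : Tree V} (h : u.Sub u') (h' : u'.Sub u) : u = u' := by
  rcases h.eq_or_size_lt with e | h1
  · exact e
  · rcases h'.eq_or_size_lt with e | h2
    · exact e.symm
    · omega

theorem nodup_child {k : ℕ} {c : Fin k → Tree V} (h : (node k c).leaves.Nodup) (i : Fin k) :
    (c i).leaves.Nodup := by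
  simp only [leaves] at h
  exact Multiset.nodup_of_le (Finset.single_le_sum (f := fun j => (c j).leaves)
    (fun _ _ => Multiset.zero_le _) (Finset.mem_univ i)) h

theorem child_eq_of_mem {k : ℕ} {c : Fin k → Tree V} (h : (node k c).leaves.Nodup) {i j : Fin k}
    {v : V} (hi : v ∈ (c i).leaves) (hj : v ∈ (c j).leaves) : i = j := by
  classical
  by_contra hne
  have h1 := Multiset.nodup_iff_count_le_one.1 h v
  simp only [leaves, Multiset.count_sum'] at h1
  have h2 : ∑ l ∈ ({i, j} : Finset (Fin k)), Multiset.count v (c l).leaves ≤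
      ∑ l, Multiset.count v (c l).leaves :=
    Finset.sum_le_sum_of_subset (Finset.subset_univ _)
  rw [Finset.sum_pair hne] at h2
  have h3 := Multiset.one_le_count_iff_mem.2 hi
  have h4 := Multiset.one_le_count_iff_mem.2 hj
  omega

theorem exists_isLCA (T : Tree V) (hT : T.leaves.Nodup) {s : Set V} (hs : s.Nonempty)
    (hsT : ∀ v ∈ s, v ∈ T.leaves) : ∃ u, T.IsLCA s u := by
  induction T with
  | empty =>
    obtain ⟨v, hv⟩ := hs
    exact absurd (hsT v hv) (by simp [leaves])
  | leaf v =>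
    refine ⟨leaf v, ⟨Sub.refl _, hsT⟩, fun u' h _ => ?_⟩
    cases h
    exact Sub.refl _
  | node k c ih =>
    by_cases h : ∃ i, ∀ v ∈ s, v ∈ (c i).leaves
    · obtain ⟨i, hi⟩ := h
      obtain ⟨u, ⟨hu1, hu2⟩, hu3⟩ := ih i (nodup_child hT i) hi
      refine ⟨u, ⟨Sub.child i hu1, hu2⟩, fun u' h hu' => ?_⟩
      cases h with
      | refl => exact Sub.child i hu1
      | child j h =>
        obtain ⟨v, hv⟩ := hs
        obtain rfl := child_eq_of_mem hT (hi v hv) (h.mem_leaves (hu' v hv))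
        exact hu3 u' h hu'
    · refine ⟨node k c, ⟨Sub.refl _, hsT⟩, fun u' h' hu' => ?_⟩
      cases h' with
      | refl => exact Sub.refl _
      | child j h' => exact absurd ⟨j, fun v hv => h'.mem_leaves (hu' v hv)⟩ h

/-- The lowest common ancestor of `i, j` lies below every node over both, so it misses `k` as soon
as one such node does. This replaces lowest common ancestors by arbitrary nodes. -/
theorem mergedBefore_iff {T : Tree V} (hT : T.leaves.Nodup) {i j k : V} (hi : i ∈ T.leaves)
    (hj : j ∈ T.leaves) (hk : k ∈ T.leaves) : T.MergedBefore i j k ↔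
      ∃ u : Tree V, u.Sub T ∧ i ∈ u.leaves ∧ j ∈ u.leaves ∧ k ∉ u.leaves := by
  constructor
  · rintro ⟨u, u', ⟨⟨h1, h2⟩, -⟩, ⟨-, h4⟩, h5, h6⟩
    have hiu : i ∈ u.leaves := h2 i (by simp)
    have hju : j ∈ u.leaves := h2 j (by simp)
    refine ⟨u, h1, hiu, hju, fun hku => h6 (h5.antisymm (h4 u h1 ?_))⟩
    rintro v (rfl | rfl | rfl) <;> assumption
  · rintro ⟨u, h1, hiu, hju, hku⟩
    obtain ⟨a, ha1, ha2⟩ := T.exists_isLCA hT (s := {i, j}) ⟨i, by simp⟩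
      (by rintro v (rfl | rfl) <;> assumption)
    obtain ⟨b, hb1, hb2⟩ := T.exists_isLCA hT (s := {i, j, k}) ⟨i, by simp⟩
      (by rintro v (rfl | rfl | rfl) <;> assumption)
    have hau : a.Sub u := ha2 u h1 (by rintro v (rfl | rfl) <;> assumption)
    refine ⟨a, b, ⟨ha1, ha2⟩, ⟨hb1, hb2⟩, ha2 b hb1.1 ?_, ?_⟩
    · rintro v (rfl | rfl)
      · exact hb1.2 _ (by simp)
      · exact hb1.2 _ (by simp)
    · rintro rfl
      exact hku (hau.mem_leaves (hb1.2 k (by simp)))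

theorem MergedBefore.swap {T : Tree V} {i j k : V} (h : T.MergedBefore i j k) :
    T.MergedBefore j i k := by
  obtain ⟨u, u', h1, h2, h3, h4⟩ := h
  refine ⟨u, u', ?_, ?_, h3, h4⟩
  · rwa [Set.pair_comm]
  · rwa [Set.insert_comm]

/-- The lowest node whose leaves contain at least two given ones has children that separate
them. -/
theorem exists_separating_node (T : Tree V) {s : Set V}
    (hs : s.Nontrivial) (hsT : ∀ v ∈ s, v ∈ T.leaves) :
    ∃ (k : ℕ) (c : Fin k → Tree V) (i : Fin k), (node k c).Sub T ∧
      (∀ v ∈ s, v ∈ (node k c).leaves) ∧ (∃ v ∈ s, v ∈ (c i).leaves) ∧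
      ∃ v ∈ s, v ∉ (c i).leaves := by
  induction T with
  | empty =>
    obtain ⟨v, hv⟩ := hs.nonempty
    exact absurd (hsT v hv) (by simp [leaves])
  | leaf x =>
    obtain ⟨v, hv, w, hw, hne⟩ := hs
    have h1 := hsT v hv
    have h2 := hsT w hw
    simp only [leaves, Multiset.mem_singleton] at h1 h2
    exact absurd (h1.trans h2.symm) hne
  | node k c ih =>
    obtain ⟨v, hv⟩ := hs.nonempty
    obtain ⟨i, hi⟩ := mem_leaves_node.1 (hsT v hv)
    by_cases h : ∀ w ∈ s, w ∈ (c i).leaves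
    · obtain ⟨k', c', i', h1, h2⟩ := ih i h
      exact ⟨k', c', i', Sub.child i h1, h2⟩
    · push Not at h
      exact ⟨k, c, i, Sub.refl _, hsT, ⟨v, hv, hi⟩, h⟩

theorem Sub.trans {u v w : Tree V} (h : u.Sub v) (h' : v.Sub w) : u.Sub w := by
  induction h' with
  | refl => exact h
  | child i _ ih => exact Sub.child i ih

theorem Sub.nodup {u T : Tree V} (h : u.Sub T) (hT : T.leaves.Nodup) : u.leaves.Nodup := by
  induction h with
  | refl => exact hT
  | child i _ ih => exact ih (nodup_child hT i)

/-- Leaf sets of nodes form a laminar family: nodes sharing a leaf are on one path from the root. -/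
theorem Sub.comparable {u v T : Tree V} (hT : T.leaves.Nodup) (hu : u.Sub T) (hv : v.Sub T)
    {x : V} (hxu : x ∈ u.leaves) (hxv : x ∈ v.leaves) : u.Sub v ∨ v.Sub u := by
  induction T with
  | empty => cases hu; exact Or.inr hv
  | leaf y => cases hu; exact Or.inr hv
  | node k c ih =>
    cases hu with
    | refl => exact Or.inr hv
    | child i hu =>
      cases hv with
      | refl => exact Or.inl (Sub.child i hu)
      | child j hv =>
        obtain rfl := child_eq_of_mem hT (hu.mem_leaves hxu) (hv.mem_leaves hxv)
        exact ih i (nodup_child hT i) hu hv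

end Tree

/-! ### Trees of minimal cost -/

section Costs

variable {n : ℕ} {G : SimGraph n}

theorem minTripleCost_le_tripleCost (G : SimGraph n) (T : Tree (Fin n)) (i j k : Fin n) :
    minTripleCost G i j k ≤ tripleCost G T i j k := by
  have h1 := G.nonneg i j
  have h2 := G.nonneg i k
  have h3 := G.nonneg j k
  unfold minTripleCost tripleCost
  split_ifs
  · exact (min_le_right _ _).trans (min_le_right _ _)
  · exact (min_le_right _ _).trans (min_le_left _ _)
  · exact min_le_left _ _
  · exact (min_le_left _ _).trans (by linarith)

theorem minTripleCost_nonneg (G : SimGraph n) (i j k : Fin n) : 0 ≤ minTripleCost G i j k := by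
  have h1 := G.nonneg i j
  have h2 := G.nonneg i k
  have h3 := G.nonneg j k
  exact le_min (by linarith) (le_min (by linarith) (by linarith))

theorem baseCost_nonneg (G : SimGraph n) : 0 ≤ baseCost G :=
  Finset.sum_nonneg fun _ _ => Finset.sum_nonneg fun _ _ => Finset.sum_nonneg fun _ _ =>
    minTripleCost_nonneg G _ _ _

theorem baseCost_le_totalCost (G : SimGraph n) (T : Tree (Fin n)) :
    baseCost G ≤ totalCost G T :=
  Finset.sum_le_sum fun _ _ => Finset.sum_le_sum fun _ _ => Finset.sum_le_sum fun _ _ =>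
    minTripleCost_le_tripleCost G T _ _ _

theorem one_le_ratioCost (G : SimGraph n) (T : Tree (Fin n)) : 1 ≤ ratioCost G T := by
  unfold ratioCost
  split_ifs with h1 h2
  · exact le_rfl
  · exact le_top
  · have h0 : 0 < baseCost G := lt_of_le_of_ne (baseCost_nonneg G) (Ne.symm h1)
    rw [ENNReal.one_le_ofReal, one_le_div h0]
    exact baseCost_le_totalCost G T

/-- The conventions for a zero denominator agree with this: 0/0 = 1, and x/0 = ∞ differs from 1. -/
theorem ratioCost_eq_one_iff (G : SimGraph n) (T : Tree (Fin n)) :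
    ratioCost G T = 1 ↔ totalCost G T = baseCost G := by
  unfold ratioCost
  split_ifs with h1 h2
  · simp [h1, h2]
  · simp [h1, h2]
  · rw [ENNReal.ofReal_eq_one, div_eq_one_iff_eq h1]

theorem totalCost_eq_baseCost_iff (G : SimGraph n) (T : Tree (Fin n)) :
    totalCost G T = baseCost G ↔
      ∀ i j k : Fin n, i < j → j < k → tripleCost G T i j k = minTripleCost G i j k := by
  have hle := minTripleCost_le_tripleCost G T
  constructor
  · intro h i j k hij hjk
    have h1 := (Finset.sum_eq_sum_iff_of_le fun i _ => Finset.sum_le_sum fun j _ =>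
      Finset.sum_le_sum fun k _ => hle i j k).1 h.symm i (Finset.mem_univ i)
    have h2 := (Finset.sum_eq_sum_iff_of_le fun j _ =>
      Finset.sum_le_sum fun k _ => hle i j k).1 h1 j (Finset.mem_Ioi.2 hij)
    exact ((Finset.sum_eq_sum_iff_of_le fun k _ => hle i j k).1 h2 k
      (Finset.mem_Ioi.2 hjk)).symm
  · intro h
    exact Finset.sum_congr rfl fun i _ => Finset.sum_congr rfl fun j hj =>
      Finset.sum_congr rfl fun k hk => h i j k (Finset.mem_Ioi.1 hj) (Finset.mem_Ioi.1 hk)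

theorem perfectHC_iff (G : SimGraph n) : PerfectHC G ↔
    ∃ T : Tree (Fin n), T.IsHCTree ∧ totalCost G T = baseCost G := by
  constructor
  · rintro ⟨⟨T, hT, h⟩, -⟩
    exact ⟨T, hT, (ratioCost_eq_one_iff G T).1 h⟩
  · rintro ⟨T, hT, h⟩
    refine ⟨⟨T, hT, (ratioCost_eq_one_iff G T).2 h⟩, ?_⟩
    rintro r ⟨T', -, rfl⟩
    exact one_le_ratioCost G T'

theorem isOptimalTree_of_totalCost_eq {T : Tree (Fin n)} (hT : T.IsHCTree)
    (h : totalCost G T = baseCost G) : IsOptimalTree G T :=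
  ⟨hT, fun T' _ => ((ratioCost_eq_one_iff G T).2 h).le.trans (one_le_ratioCost G T')⟩

/-- The triplet `{i, j, k}` is resolved by `T` in accordance with its largest weight, or all of its
weights vanish. -/
def Resolved (G : SimGraph n) (T : Tree (Fin n)) (i j k : Fin n) : Prop :=
  (T.MergedBefore i j k ∧ G.w i k ≤ G.w i j ∧ G.w j k ≤ G.w i j) ∨
  (T.MergedBefore i k j ∧ G.w i j ≤ G.w i k ∧ G.w j k ≤ G.w i k) ∨
  (T.MergedBefore j k i ∧ G.w i j ≤ G.w j k ∧ G.w i k ≤ G.w j k) ∨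
  (G.w i j = 0 ∧ G.w i k = 0 ∧ G.w j k = 0)

/-- The cost omits the weight of the pair merged before the third point, which must then be a
largest one. If nothing is omitted, the sum of all three weights is at most the sum of any two, so
each weight is 0. -/
theorem resolved_of_tripleCost_eq {T : Tree (Fin n)} {i j k : Fin n}
    (h : tripleCost G T i j k = minTripleCost G i j k) : Resolved G T i j k := by
  have h1 := G.nonneg i j
  have h2 := G.nonneg i k
  have h3 := G.nonneg j k
  have m1 : minTripleCost G i j k ≤ G.w i j + G.w i k := min_le_left _ _
  have m2 : minTripleCost G i j k ≤ G.w i j + G.w j k :=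
    (min_le_right _ _).trans (min_le_left _ _)
  have m3 : minTripleCost G i j k ≤ G.w i k + G.w j k :=
    (min_le_right _ _).trans (min_le_right _ _)
  unfold Resolved
  unfold tripleCost at h
  split_ifs at h with c1 c2 c3
  · exact Or.inl ⟨c1, by linarith, by linarith⟩
  · exact Or.inr (Or.inl ⟨c2, by linarith, by linarith⟩)
  · exact Or.inr (Or.inr (Or.inl ⟨c3, by linarith, by linarith⟩))
  · exact Or.inr (Or.inr (Or.inr ⟨by linarith, by linarith, by linarith⟩))

theorem Resolved.swap_left {T : Tree (Fin n)} {i j k : Fin n} (h : Resolved G T i j k) :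
    Resolved G T j i k := by
  unfold Resolved at *
  rw [G.symm j i]
  rcases h with ⟨a, b, c⟩ | ⟨a, b, c⟩ | ⟨a, b, c⟩ | ⟨a, b, c⟩
  · exact Or.inl ⟨a.swap, c, b⟩
  · exact Or.inr (Or.inr (Or.inl ⟨a, b, c⟩))
  · exact Or.inr (Or.inl ⟨a, b, c⟩)
  · exact Or.inr (Or.inr (Or.inr ⟨a, c, b⟩))

theorem Resolved.swap_right {T : Tree (Fin n)} {i j k : Fin n} (h : Resolved G T i j k) :
    Resolved G T i k j := by
  unfold Resolved at *
  rw [G.symm k j]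
  rcases h with ⟨a, b, c⟩ | ⟨a, b, c⟩ | ⟨a, b, c⟩ | ⟨a, b, c⟩
  · exact Or.inr (Or.inl ⟨a, b, c⟩)
  · exact Or.inl ⟨a, b, c⟩
  · exact Or.inr (Or.inr (Or.inl ⟨a.swap, c, b⟩))
  · exact Or.inr (Or.inr (Or.inr ⟨b, a, c⟩))

theorem resolved_of_totalCost_eq {T : Tree (Fin n)} (h : totalCost G T = baseCost G)
    {i j k : Fin n} (hij : i ≠ j) (hik : i ≠ k) (hjk : j ≠ k) : Resolved G T i j k := by
  have key : ∀ a b c : Fin n, a < b → b < c → Resolved G T a b c := fun a b c h1 h2 =>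
    resolved_of_tripleCost_eq ((totalCost_eq_baseCost_iff G T).1 h a b c h1 h2)
  -- The costs are summed over increasing triples only; the other orders follow by transpositions.
  rcases lt_or_gt_of_ne hij with h1 | h1 <;> rcases lt_or_gt_of_ne hjk with h2 | h2 <;>
    rcases lt_or_gt_of_ne hik with h3 | h3
  · exact key _ _ _ h1 h2
  · exact absurd (h1.trans h2) (asymm h3)
  · exact (key _ _ _ h3 h2).swap_right
  · exact (key _ _ _ h3 h1).swap_left.swap_right
  · exact (key _ _ _ h1 h3).swap_left
  · exact (key _ _ _ h2 h3).swap_right.swap_left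
  · exact absurd (h2.trans h1) (asymm h3)
  · exact (key _ _ _ h2 h1).swap_left.swap_right.swap_left

/-- A tree of minimal cost induces a valid bi-partition of each set of at least two vertices. -/
theorem exists_validBipartition_of_totalCost_eq {T : Tree (Fin n)} (hT : T.IsHCTree)
    (h : totalCost G T = baseCost G) (S : Finset (Fin n)) (hS : 1 < S.card) :
    ∃ A B, ValidBipartition G S A B := by
  classical
  have hnd : T.leaves.Nodup := hT.2 ▸ Finset.univ.nodup
  have hmem : ∀ v, v ∈ T.leaves := fun v => by rw [hT.2]; exact Finset.mem_univ v
  obtain ⟨m, c, l, hsub, hSl, ⟨x, hxS, hx⟩, y, hyS, hy⟩ :=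
    T.exists_separating_node (s := (S : Set (Fin n)))
      (by
        obtain ⟨a, ha, b, hb, hab⟩ := Finset.one_lt_card.1 hS
        exact ⟨a, ha, b, hb, hab⟩)
      (fun v _ => hmem v)
  have hcl : (c l).Sub T := (Tree.Sub.child l (Tree.Sub.refl _)).trans hsub
  -- A node over `i, j` that misses `k` lies properly below the node over `S`, hence inside one of
  -- its children. So the chosen child contains both of `i, j` or neither.
  have hno : ∀ i ∈ S, ∀ j ∈ S, ∀ k ∈ S, T.MergedBefore i j k →
      (i ∈ (c l).leaves ↔ j ∈ (c l).leaves) := by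
    have half : ∀ i ∈ S, ∀ j ∈ S, ∀ k ∈ S, T.MergedBefore i j k →
      i ∈ (c l).leaves → j ∈ (c l).leaves := by
      intro i hi j hj k hk hm hil
      by_contra hjl
      obtain ⟨u, hu, hiu, hju, hku⟩ := (Tree.mergedBefore_iff hnd (hmem i) (hmem j) (hmem k)).1 hm
      rcases hu.comparable hnd hsub hiu (hSl i hi) with h1 | h1
      · cases h1 with
        | refl => exact hku (hSl k hk)
        | child l' h1 =>
          obtain rfl := Tree.child_eq_of_mem (hsub.nodup hnd) hil (h1.mem_leaves hiu)
          exact hjl (h1.mem_leaves hju)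
      · exact hku (h1.mem_leaves (hSl k hk))
    intro i hi j hj k hk hm
    exact ⟨half i hi j hj k hk hm, half j hj i hi k hk hm.swap⟩
  refine ⟨S.filter fun v => v ∈ (c l).leaves, S \ S.filter fun v => v ∈ (c l).leaves,
    validBipartition_iff.2 ⟨Finset.filter_subset _ _, rfl, ⟨x, by simp [hx, Finset.mem_coe.1 hxS]⟩,
      ⟨y, by simp [hy, Finset.mem_coe.1 hyS]⟩, ?_, ?_⟩⟩
  · intro i hi j hj k hk ⟨h1, h2, h3, h4, h5⟩
    simp only [Finset.mem_filter, hi, hj, true_and]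
    have h0 := G.nonneg i k
    rcases resolved_of_totalCost_eq h h1 h2 h3 with ⟨a, b, c⟩ | ⟨a, b, c⟩ | ⟨a, b, c⟩ | ⟨a, b, c⟩
    · exact hno i hi j hj k hk a
    · linarith
    · linarith
    · linarith
  · intro i hi j hj k hk ⟨h1, h2, h3, h4, h5⟩ e
    simp only [Finset.mem_filter, hi, hj, hk, true_and] at e ⊢
    have h0 := G.nonneg j k
    -- `T` merges `i` with `j` or with `k` before the third point. Either suffices, because `j` and
    -- `k` are on the same side.
    rcases resolved_of_totalCost_eq h h1 h2 h3 with ⟨a, b, c⟩ | ⟨a, b, c⟩ | ⟨a, b, c⟩ | ⟨a, b, c⟩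
    · exact hno i hi j hj k hk a
    · exact (hno i hi k hk j hj a).trans e.symm
    · linarith
    · linarith

/-! ### The trees returned by the algorithm -/

theorem leaves_node_two (TA TB : Tree (Fin n)) :
    (Tree.node 2 ![TA, TB]).leaves = TA.leaves + TB.leaves := by
  simp [Tree.leaves]

theorem proper_node_two (TA TB : Tree (Fin n)) :
    (Tree.node 2 ![TA, TB]).Proper ↔ TA.Proper ∧ TB.Proper := by
  simp [Tree.Proper, Fin.forall_fin_two]

theorem sub_node_two {TA TB u : Tree (Fin n)} (h : u.Sub (Tree.node 2 ![TA, TB])) :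
    u = Tree.node 2 ![TA, TB] ∨ u.Sub TA ∨ u.Sub TB := by
  cases h with
  | refl => exact Or.inl rfl
  | child i h => fin_cases i <;> simp_all

theorem left_sub_node_two {TA TB u : Tree (Fin n)} (h : u.Sub TA) :
    u.Sub (Tree.node 2 ![TA, TB]) :=
  Tree.Sub.child (0 : Fin 2) (by simpa using h)

theorem right_sub_node_two {TA TB u : Tree (Fin n)} (h : u.Sub TB) :
    u.Sub (Tree.node 2 ![TA, TB]) :=
  Tree.Sub.child (1 : Fin 2) (by simpa using h)

theorem ValidBipartition.val_eq {S A B : Finset (Fin n)} (h : ValidBipartition G S A B) :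
    S.val = A.val + B.val := by
  obtain ⟨hAS, hB, -⟩ := validBipartition_iff.1 h
  have hd : Disjoint A B := hB ▸ Finset.disjoint_sdiff
  have : S = A.disjUnion B hd := by
    rw [Finset.disjUnion_eq_union, hB, Finset.union_sdiff_of_subset hAS]
  rw [this]
  rfl

theorem BiPartition.leaves_le {S : Finset (Fin n)} {T : Tree (Fin n)} (h : BiPartition G S T) :
    T.leaves ≤ S.val := by
  induction h with
  | single v => simp [Tree.leaves]
  | fail S A B hS h hAB => exact Multiset.zero_le _
  | split S A B hS h hA hB TA TB hTA hTB ihA ihB =>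
    rw [leaves_node_two, (h.validBipartition hA).val_eq]
    exact add_le_add ihA ihB

/-- Leaves are lost only at empty subtrees. Each subtree has at most the leaves of its own part, so
equality for the whole forces equality for both parts. -/
theorem BiPartition.leaves_eq_iff_proper {S : Finset (Fin n)} {T : Tree (Fin n)}
    (h : BiPartition G S T) (hne : S.Nonempty) : T.leaves = S.val ↔ T.Proper := by
  induction h with
  | single v => simp [Tree.leaves, Tree.Proper]
  | fail S A B hS h hAB =>
    simp only [Tree.leaves, Tree.Proper, iff_false]
    intro e
    rw [eq_comm, Finset.val_eq_zero] at e
    exact hne.ne_empty e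
  | split S A B hS h hA hB TA TB hTA hTB ihA ihB =>
    rw [leaves_node_two, (h.validBipartition hA).val_eq, proper_node_two,
      ← ihA (Finset.nonempty_iff_ne_empty.2 hA), ← ihB (Finset.nonempty_iff_ne_empty.2 hB)]
    exact add_eq_add_iff_eq_and_eq hTA.leaves_le hTB.leaves_le

theorem BiPartition.spans_iff_proper {T : Tree (Fin n)} (hn : 1 ≤ n)
    (h : BiPartition G Finset.univ T) : T.Spans ↔ T.Proper := by
  have : Nonempty (Fin n) := ⟨⟨0, hn⟩⟩
  rw [← h.leaves_eq_iff_proper Finset.univ_nonempty]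
  constructor
  · intro hs
    exact le_antisymm h.leaves_le
      ((Multiset.le_iff_subset Finset.univ.nodup).2 fun v _ => hs v)
  · intro e v
    rw [e]
    exact Finset.mem_univ v

/-- The hypothesis covers all vertex sets at once, so it is irrelevant which bi-partitions were
chosen on the way. This is why no backtracking is needed. -/
theorem BiPartition.proper_of_forall {S : Finset (Fin n)} {T : Tree (Fin n)}
    (h : BiPartition G S T) (hne : S.Nonempty)
    (hv : ∀ S' : Finset (Fin n), 1 < S'.card → ∃ A B, ValidBipartition G S' A B) : T.Proper := by
  induction h with
  | single v => simp [Tree.Proper]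
  | fail S A B hS h hAB =>
    have := hne.card_pos
    obtain ⟨A', B', h'⟩ := hv S (by omega)
    have := h.nonempty_of_exists h'
    tauto
  | split S A B hS h hA hB TA TB hTA hTB ihA ihB =>
    exact (proper_node_two _ _).2
      ⟨ihA (Finset.nonempty_iff_ne_empty.2 hA), ihB (Finset.nonempty_iff_ne_empty.2 hB)⟩

/-- Two points separated from a third one by a valid bi-partition have the largest weight. -/
theorem ValidBipartition.weight_le {S A B : Finset (Fin n)} (h : ValidBipartition G S A B)
    {i j k : Fin n} (hi : i ∈ S) (hj : j ∈ S) (hk : k ∈ S) (hij : i ≠ j)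
    (hA : i ∈ A ↔ j ∈ A) (hk' : ¬ (k ∈ A ↔ i ∈ A)) : G.w i k ≤ G.w i j ∧ G.w j k ≤ G.w i j := by
  obtain ⟨-, -, -, -, h1, h2⟩ := validBipartition_iff.1 h
  have hik : i ≠ k := fun e => hk' (e ▸ Iff.rfl)
  have hjk : j ≠ k := fun e => hk' (by rw [← e]; exact hA.symm)
  have n1 : ¬ TypeOne G i k j := fun t => hk' (h1 i hi k hk j hj t).symm
  have n2 : ¬ TypeOne G j k i := fun t => hk' ((h1 j hj k hk i hi t).symm.trans hA.symm)
  have n3 : ¬ TypeTwo G k i j := fun t => hk' (h2 k hk i hi j hj t hA)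
  simp only [TypeOne, TypeTwo, ne_eq, hij, hij.symm, hik, hik.symm, hjk, hjk.symm,
    not_false_eq_true, true_and, not_and, not_lt, G.symm k i, G.symm k j, G.symm j i] at n1 n2 n3
  by_contra hcon
  -- If the weights to `k` differ and the larger one exceeds `w i j`, a type-one triplet has its
  -- heaviest pair across the cut. If they are equal and exceed `w i j`, then `k` is an apex over
  -- `i, j` on the wrong side.
  rcases lt_trichotomy (G.w i k) (G.w j k) with hlt | heq | hgt
  · by_cases h3 : G.w i j < G.w j k
    · exact absurd (n2 h3) (not_le.2 hlt)
    · exact hcon ⟨by linarith, by linarith⟩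
  · have := n3 heq
    exact hcon ⟨this, heq ▸ this⟩
  · by_cases h3 : G.w i j < G.w i k
    · exact absurd (n1 h3) (not_le.2 hgt)
    · exact hcon ⟨by linarith, by linarith⟩

/-- Some split above `u` separates `k` from `i` and `j`, and there `ValidBipartition.weight_le`
applies. -/
theorem BiPartition.weight_le_of_sub {S : Finset (Fin n)} {T : Tree (Fin n)}
    (h : BiPartition G S T) {u : Tree (Fin n)} (hu : u.Sub T)
    {i j k : Fin n} (hk : k ∈ S) (hij : i ≠ j) (hiu : i ∈ u.leaves)
    (hju : j ∈ u.leaves) (hku : k ∉ u.leaves) (hT : T.leaves = S.val) :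
    G.w i k ≤ G.w i j ∧ G.w j k ≤ G.w i j := by
  induction h with
  | single v =>
    cases hu
    simp only [Tree.leaves, Multiset.mem_singleton] at hiu hju
    exact absurd (hiu.trans hju.symm) hij
  | fail S A B hS h hAB =>
    cases hu
    simp [Tree.leaves] at hiu
  | split S A B hS h hA hB TA TB hTA hTB ihA ihB =>
    have hv := h.validBipartition hA
    obtain ⟨hAS, hBe, -⟩ := validBipartition_iff.1 hv
    have hTe : TA.leaves = A.val ∧ TB.leaves = B.val := by
      rw [leaves_node_two, hv.val_eq] at hT
      exact (add_eq_add_iff_eq_and_eq hTA.leaves_le hTB.leaves_le).1 hT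
    have hBS : B ⊆ S := hBe ▸ Finset.sdiff_subset
    rcases sub_node_two hu with rfl | hu | hu
    · rw [hT] at hku
      exact absurd hk hku
    · have hiA : i ∈ A := by have := hu.mem_leaves hiu; rwa [hTe.1] at this
      have hjA : j ∈ A := by have := hu.mem_leaves hju; rwa [hTe.1] at this
      by_cases hkA : k ∈ A
      · exact ihA hu hkA hTe.1
      · exact hv.weight_le (hAS hiA) (hAS hjA) hk hij (by tauto) (by tauto)
    · have hiB : i ∈ B := by have := hu.mem_leaves hiu; rwa [hTe.2] at this
      have hjB : j ∈ B := by have := hu.mem_leaves hju; rwa [hTe.2] at this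
      by_cases hkB : k ∈ B
      · exact ihB hu hkB hTe.2
      · exact hv.symm.weight_le (hBS hiB) (hBS hjB) hk hij (by tauto) (by tauto)

/-- In a binary tree the highest split that separates a triplet leaves two of its points together,
so no triplet is merged at the same time. The two equalities at the end absorb the degenerate cases.
-/
theorem BiPartition.exists_sub {S : Finset (Fin n)} {T : Tree (Fin n)}
    (h : BiPartition G S T) {i j k : Fin n} (hi : i ∈ S) (hj : j ∈ S) (hk : k ∈ S) (hij : i ≠ j)
    (hT : T.leaves = S.val) : ∃ u : Tree (Fin n), u.Sub T ∧
      ((i ∈ u.leaves ∧ j ∈ u.leaves ∧ k ∉ u.leaves) ∨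
        (i ∈ u.leaves ∧ k ∈ u.leaves ∧ j ∉ u.leaves) ∨
        (j ∈ u.leaves ∧ k ∈ u.leaves ∧ i ∉ u.leaves) ∨ i = k ∨ j = k) := by
  induction h with
  | single v =>
    rw [Finset.mem_singleton] at hi hj
    exact absurd (hi.trans hj.symm) hij
  | fail S A B hS h hAB =>
    simp only [Tree.leaves] at hT
    rw [eq_comm, Finset.val_eq_zero] at hT
    simp [hT] at hi
  | split S A B hS h hA hB TA TB hTA hTB ihA ihB =>
    have hv := h.validBipartition hA
    obtain ⟨hAS, hBe, -⟩ := validBipartition_iff.1 hv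
    have hTe : TA.leaves = A.val ∧ TB.leaves = B.val := by
      rw [leaves_node_two, hv.val_eq] at hT
      exact (add_eq_add_iff_eq_and_eq hTA.leaves_le hTB.leaves_le).1 hT
    have hmA : ∀ v, v ∈ TA.leaves ↔ v ∈ A := fun v => by rw [hTe.1]; rfl
    have hmB : ∀ v, v ∈ TB.leaves ↔ v ∈ B := fun v => by rw [hTe.2]; rfl
    have hB' : ∀ v ∈ S, (v ∈ B ↔ v ∉ A) := fun v hv => by simp [hBe, hv]
    by_cases h1 : i ∈ A ∧ j ∈ A ∧ k ∈ A
    · obtain ⟨u, hu, hu'⟩ := ihA h1.1 h1.2.1 h1.2.2 hTe.1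
      exact ⟨u, left_sub_node_two hu, hu'⟩
    by_cases h2 : i ∈ B ∧ j ∈ B ∧ k ∈ B
    · obtain ⟨u, hu, hu'⟩ := ihB h2.1 h2.2.1 h2.2.2 hTe.2
      exact ⟨u, right_sub_node_two hu, hu'⟩
    have e1 := hB' i hi
    have e2 := hB' j hj
    have e3 := hB' k hk
    have hA' := left_sub_node_two (TB := TB) (Tree.Sub.refl TA)
    have hB'' := right_sub_node_two (TA := TA) (Tree.Sub.refl TB)
    by_cases hiA : i ∈ A <;> by_cases hjA : j ∈ A <;> by_cases hkA : k ∈ A <;>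
      simp only [hiA, hjA, hkA, e1, e2, e3, not_true, not_false_eq_true, and_true, and_false] at h1 h2
    · exact ⟨TA, hA', by simp [hmA, hiA, hjA, hkA]⟩
    · exact ⟨TA, hA', by simp [hmA, hiA, hjA, hkA]⟩
    · exact ⟨TB, hB'', by simp [hmB, hiA, hjA, hkA, e1, e2, e3]⟩
    · exact ⟨TA, hA', by simp [hmA, hiA, hjA, hkA]⟩
    · exact ⟨TB, hB'', by simp [hmB, hiA, hjA, hkA, e1, e2, e3]⟩
    · exact ⟨TB, hB'', by simp [hmB, hiA, hjA, hkA, e1, e2, e3]⟩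

theorem BiPartition.totalCost_eq {T : Tree (Fin n)} (h : BiPartition G Finset.univ T)
    (hT : T.leaves = (Finset.univ : Finset (Fin n)).val) : totalCost G T = baseCost G := by
  rw [totalCost_eq_baseCost_iff]
  intro i j k hij hjk
  have hik := hij.trans hjk
  have hnd : T.leaves.Nodup := hT ▸ Finset.univ.nodup
  have hmem : ∀ v, v ∈ T.leaves := fun v => by rw [hT]; exact Finset.mem_univ v
  have hmax : ∀ a b c : Fin n, a ≠ b → T.MergedBefore a b c →
      G.w a c ≤ G.w a b ∧ G.w b c ≤ G.w a b := by
    intro a b c hab hm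
    obtain ⟨u, hu, h1, h2, h3⟩ := (Tree.mergedBefore_iff hnd (hmem a) (hmem b) (hmem c)).1 hm
    exact h.weight_le_of_sub hu (Finset.mem_univ c) hab h1 h2 h3 hT
  unfold tripleCost minTripleCost
  split_ifs with c1 c2 c3
  · obtain ⟨h1, h2⟩ := hmax i j k hij.ne c1
    rw [min_eq_right (b := G.w i k + G.w j k) (by linarith), min_eq_right (by linarith)]
  · obtain ⟨h1, h2⟩ := hmax i k j hik.ne c2
    rw [G.symm k j] at h2
    rw [min_eq_left (a := G.w i j + G.w j k) (by linarith), min_eq_right (by linarith)]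
  · obtain ⟨h1, h2⟩ := hmax j k i hjk.ne c3
    rw [G.symm j i] at h1
    rw [G.symm k i] at h2
    exact (min_eq_left (le_min (by linarith) (by linarith))).symm
  · exfalso
    obtain ⟨u, hu, h1⟩ := h.exists_sub (Finset.mem_univ i) (Finset.mem_univ j)
      (Finset.mem_univ k) hij.ne hT
    rw [Tree.mergedBefore_iff hnd (hmem _) (hmem _) (hmem _)] at c1 c2 c3
    rcases h1 with h1 | h1 | h1 | h1 | h1
    · exact c1 ⟨u, hu, h1⟩
    · exact c2 ⟨u, hu, h1⟩
    · exact c3 ⟨u, hu, h1⟩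
    · exact hik.ne h1
    · exact hjk.ne h1

theorem BiPartition.isHCTree_and_totalCost_eq {T : Tree (Fin n)} (hn : 1 ≤ n)
    (h : BiPartition G Finset.univ T) (hT : T.Proper) :
    T.IsHCTree ∧ totalCost G T = baseCost G := by
  have : Nonempty (Fin n) := ⟨⟨0, hn⟩⟩
  have e := (h.leaves_eq_iff_proper Finset.univ_nonempty).2 hT
  exact ⟨⟨hT, e⟩, h.totalCost_eq e⟩

theorem BiPartition.proper_iff_perfectHC {T : Tree (Fin n)} (hn : 1 ≤ n)
    (h : BiPartition G Finset.univ T) : T.Proper ↔ PerfectHC G := by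
  have : Nonempty (Fin n) := ⟨⟨0, hn⟩⟩
  rw [perfectHC_iff]
  constructor
  · intro hT
    exact ⟨T, h.isHCTree_and_totalCost_eq hn hT⟩
  · rintro ⟨T', hT', h'⟩
    exact h.proper_of_forall Finset.univ_nonempty
      (exists_validBipartition_of_totalCost_eq hT' h')

end Costs

end HC

/-! ### Bisections decided from cluster labels, without claws or cliques -/

namespace HC

/-! ### Clusters given by labels -/

section Labels

variable {n : ℕ} {G : SimGraph n} {S : Finset (Fin n)} {lab : Fin n → ℕ}

/-- The clusters given by the labels satisfy the two conditions on valid partitions. -/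
def LabelsClosed (G : SimGraph n) (S : Finset (Fin n)) (lab : Fin n → ℕ) : Prop :=
  (∀ i ∈ S, ∀ j ∈ S, ∀ k ∈ S, TypeOne G i j k → lab i = lab j) ∧
  (∀ i ∈ S, ∀ j ∈ S, ∀ k ∈ S, TypeTwo G i j k → lab j = lab k → lab i = lab j)

/-- The vertices `u` and `v` are in the same cluster of each valid partition. -/
def Inseparable (G : SimGraph n) (S : Finset (Fin n)) (u v : Fin n) : Prop :=
  ∀ P : Finpartition S, ValidPartition G P → P.part u = P.part v

theorem Inseparable.symm {u v : Fin n} (h : Inseparable G S u v) :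
    Inseparable G S v u := fun P hP => (h P hP).symm

theorem Inseparable.trans {u v w : Fin n} (h : Inseparable G S u v)
    (h' : Inseparable G S v w) : Inseparable G S u w := fun P hP => (h P hP).trans (h' P hP)

/-- Vertices of the same label are in the same cluster of each valid partition. -/
def LabelsSound (G : SimGraph n) (S : Finset (Fin n)) (lab : Fin n → ℕ) : Prop :=
  ∀ u ∈ S, ∀ v ∈ S, lab u = lab v → Inseparable G S u v

/-- The cluster of `x` contains the apex of a triplet of type two the other two points of which are
in other clusters. -/
def Exposed (G : SimGraph n) (S : Finset (Fin n)) (lab : Fin n → ℕ) (x : Fin n) : Prop :=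
  ∃ i ∈ S, ∃ j ∈ S, ∃ k ∈ S, lab i = lab x ∧ lab j ≠ lab i ∧ lab k ≠ lab i ∧ TypeTwo G i j k

/-- The clusters of `j` and `k` have to be separated, because of a crossing triplet. -/
def Conflict (G : SimGraph n) (S : Finset (Fin n)) (lab : Fin n → ℕ) (i j k : Fin n) : Prop :=
  i ∈ S ∧ j ∈ S ∧ k ∈ S ∧ lab i ≠ lab j ∧ lab i ≠ lab k ∧ lab j ≠ lab k ∧ TypeTwo G i j k

/-- Closedness makes the fibres valid; soundness, that labels agree only when this is forced, makes
them least. -/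
theorem minimalValidPartition_fibrePartition (hc : LabelsClosed G S lab)
    (hs : LabelsSound G S lab) (h : ∃ u ∈ S, ∃ v ∈ S, lab u ≠ lab v) :
    MinimalValidPartition G (fibrePartition S lab) := by
  refine ⟨validPartition_iff.2 ⟨?_, ?_, ?_⟩, ?_⟩
  · obtain ⟨u, hu, v, hv, hne⟩ := h
    exact (one_lt_card_parts_iff _).2
      ⟨u, hu, v, hv, fun e => hne ((part_fibrePartition_eq_iff lab hu hv).1 e)⟩
  · intro i hi j hj k hk t
    exact (part_fibrePartition_eq_iff lab hi hj).2 (hc.1 i hi j hj k hk t)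
  · intro i hi j hj k hk t e
    exact (part_fibrePartition_eq_iff lab hi hj).2
      (hc.2 i hi j hj k hk t ((part_fibrePartition_eq_iff lab hj hk).1 e))
  · intro Q hQ
    rw [finpartition_le_iff]
    intro x hx y hy e
    exact hs x hx y hy ((part_fibrePartition_eq_iff lab hx hy).1 e) Q hQ

theorem validBisect_of_labels_eq (hs : LabelsSound G S lab)
    (h : ∀ u ∈ S, ∀ v ∈ S, lab u = lab v) : ValidBisect G S ∅ ∅ := by
  refine ValidBisect.noPartition ?_
  rintro ⟨P, hP⟩
  obtain ⟨x, hx, y, hy, hne⟩ := (one_lt_card_parts_iff P).1 hP.1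
  exact hne (hs x hx y hy (h x hx y hy) P hP)

theorem part_fibrePartition {x : Fin n} (hx : x ∈ S) :
    (fibrePartition S lab).part x = S.filter fun v => lab v = lab x := by
  rw [part_eq_filter _ hx]
  refine Finset.filter_congr fun v hv => ?_
  rw [part_fibrePartition_eq_iff lab hv hx]

/-- A type-two triplet with both base points in one cluster is harmless by closedness. The remaining
obstruction to splitting off a cluster is an apex inside it with both base points outside, which is
exposure. -/
theorem validBisect_of_not_exposed (hc : LabelsClosed G S lab) (hs : LabelsSound G S lab)
    {x u : Fin n} (hx : x ∈ S) (hu : u ∈ S) (hne : lab u ≠ lab x) (he : ¬ Exposed G S lab x) :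
    ValidBisect G S (S.filter fun v => lab v = lab x) (S.filter fun v => ¬ lab v = lab x) := by
  have hP := minimalValidPartition_fibrePartition hc hs ⟨u, hu, x, hx, hne⟩
  have e2 : (S.filter fun v => ¬ lab v = lab x) = S \ S.filter fun v => lab v = lab x := by
    rw [Finset.filter_not]
  rw [e2, ← part_fibrePartition hx]
  refine part_union_sdiff_validBisect hP hx ?_
  rw [part_fibrePartition hx]
  refine validBipartition_iff.2 ⟨Finset.filter_subset _ _, rfl, ⟨x, by simp [hx]⟩,
    ⟨u, by simp [hu, hne]⟩, ?_, ?_⟩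
  · intro i hi j hj k hk t
    simp only [Finset.mem_filter, hi, hj, true_and, hc.1 i hi j hj k hk t]
  · intro i hi j hj k hk t e
    simp only [Finset.mem_filter, hi, hj, hk, true_and] at e ⊢
    by_cases h1 : lab j = lab x
    · rw [hc.2 i hi j hj k hk t (h1.trans (e.1 h1).symm)]
    · have h2 : lab k ≠ lab x := fun h2 => h1 (e.2 h2)
      have h3 : lab i ≠ lab x := fun h3 =>
        he ⟨i, hi, j, hj, k, hk, h3, h3.symm ▸ h1, h3.symm ▸ h2, t⟩
      simp [h1, h3]

theorem Exposed.exists_conflict (hc : LabelsClosed G S lab) {x : Fin n}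
    (h : Exposed G S lab x) : ∃ i j k, Conflict G S lab i j k := by
  obtain ⟨i, hi, j, hj, k, hk, -, h1, h2, t⟩ := h
  exact ⟨i, j, k, hi, hj, hk, h1.symm, h2.symm,
    fun e => h1 (hc.2 i hi j hj k hk t e).symm, t⟩

theorem conflict_of_crossing {i j k : Fin n} (h : Crossing (fibrePartition S lab) [i, j, k])
    (t : TypeTwo G i j k) : Conflict G S lab i j k := by
  obtain ⟨⟨hi, hj, hk⟩, h1, h2, h3⟩ := crossing_triple.1 h
  rw [ne_eq, part_fibrePartition_eq_iff lab (by assumption) (by assumption)] at h1 h2 h3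
  exact ⟨hi, hj, hk, h1, h2, h3, t⟩

theorem Conflict.crossing {i j k : Fin n} (h : Conflict G S lab i j k) :
    Crossing (fibrePartition S lab) [i, j, k] := by
  obtain ⟨hi, hj, hk, h1, h2, h3, -⟩ := h
  rw [crossing_triple, ne_eq, ne_eq, ne_eq, part_fibrePartition_eq_iff lab hi hj,
    part_fibrePartition_eq_iff lab hi hk, part_fibrePartition_eq_iff lab hj hk]
  exact ⟨⟨hi, hj, hk⟩, h1, h2, h3⟩

/-- Exposure only provides a conflict, so that both colours occur. The colouring itself excludes
claws, which makes the branch without claws the applicable one. -/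
theorem validBisect_of_colouring (hc : LabelsClosed G S lab) (hs : LabelsSound G S lab)
    {x : Fin n} (he : Exposed G S lab x) (col : Fin n → ℕ)
    (hlab : ∀ u ∈ S, ∀ v ∈ S, lab u = lab v → col u = col v)
    (hcol : ∀ i j k, Conflict G S lab i j k → ¬ (col j = 1 ↔ col k = 1)) :
    ValidBisect G S (S.filter fun v => col v = 1) (S.filter fun v => ¬ col v = 1) := by
  classical
  obtain ⟨i, j, k, hijk⟩ := he.exists_conflict hc
  have hP := minimalValidPartition_fibrePartition hc hs
    ⟨i, hijk.1, j, hijk.2.1, hijk.2.2.2.1⟩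
  set P := fibrePartition S lab with hPdef
  let z : Finset (Fin n) → Bool := fun C => decide (∃ v ∈ C, col v = 1)
  have hz : ∀ v ∈ S, (z (P.part v) = true ↔ col v = 1) := by
    intro v hv
    simp only [z, decide_eq_true_eq]
    constructor
    · rintro ⟨u, hu, h1⟩
      rw [part_fibrePartition hv, Finset.mem_filter] at hu
      rw [← hlab u hu.1 v hv hu.2, h1]
    · intro h1
      exact ⟨v, P.mem_part hv, h1⟩
  have e1 : side P z true = S.filter fun v => col v = 1 := by
    ext v
    rw [mem_side, Finset.mem_filter]
    exact and_congr_right fun hv => hz v hv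
  have e2 : side P z false = S.filter fun v => ¬ col v = 1 := by
    ext v
    rw [mem_side, Finset.mem_filter]
    exact and_congr_right fun hv => by rw [← hz v hv, Bool.not_eq_true]
  have hgood : GoodAssignment G P z := by
    rw [GoodAssignment, e1, e2]
    have hjk := hcol i j k hijk
    obtain ⟨-, hj, hk, -⟩ := hijk
    refine ⟨?_, ?_, ?_⟩
    · by_cases h1 : col j = 1
      · exact ⟨j, by simp [hj, h1]⟩
      · exact ⟨k, by simp [hk]; tauto⟩
    · by_cases h1 : col j = 1
      · exact ⟨k, by simp [hk]; tauto⟩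
      · exact ⟨j, by simp [hj, h1]⟩
    · intro i j k hcr t e
      have h := conflict_of_crossing hcr t
      refine hcol i j k h ?_
      rw [← hz j h.2.1, ← hz k h.2.2.1, e]
  rw [← e1, ← e2]
  refine ValidBisect.noClaw P hP ?_ z hgood
  rintro ⟨y, a, b, c, h⟩
  exact h.not_goodAssignment z hgood

/-- It need not be known which branch applies: with a claw, exposure prevents every cluster from
being split off, whatever the clique; without one, there is no good assignment. -/
theorem validBisect_of_no_colouring (hc : LabelsClosed G S lab) (hs : LabelsSound G S lab)
    (hS : S.Nonempty) (he : ∀ x ∈ S, Exposed G S lab x)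
    (hno : ¬ ∃ z : Fin n → Bool, (∀ u ∈ S, ∀ v ∈ S, lab u = lab v → z u = z v) ∧
      ∀ i j k, Conflict G S lab i j k → z j ≠ z k) : ValidBisect G S ∅ ∅ := by
  obtain ⟨x, hx⟩ := hS
  obtain ⟨i, j, k, hijk⟩ := (he x hx).exists_conflict hc
  have hP := minimalValidPartition_fibrePartition hc hs
    ⟨i, hijk.1, j, hijk.2.1, hijk.2.2.2.1⟩
  by_cases hcl : ∃ y a b c, IsClaw G (fibrePartition S lab) y a b c
  · obtain ⟨y, a, b, c, hcl⟩ := hcl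
    obtain ⟨K, hK⟩ := hcl.exists_clawChoice
    refine ValidBisect.clawFail _ hP K hK fun y hy hv => ?_
    have hyS : y ∈ S := by
      obtain ⟨_, _, _, _, Y, -, hY, -, hmax⟩ := hK
      exact hY.1 (hmax.1.1 hy)
    obtain ⟨i, hi, j, hj, k, hk, h1, h2, h3, t⟩ := he y hyS
    have := (validBipartition_iff.1 hv).2.2.2.2.2 i hi j hj k hk t
    simp only [part_fibrePartition hyS, Finset.mem_filter, hi, hj, hk, true_and] at this
    rw [h1] at h2 h3
    simp only [h2, h3, iff_self, h1, forall_true_left, iff_false, not_true] at this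
  · refine ValidBisect.noClawFail _ hP hcl ?_
    rintro ⟨z, hz⟩
    refine hno ⟨fun v => z ((fibrePartition S lab).part v), ?_, ?_⟩
    · intro u hu v hv e
      simp only [(part_fibrePartition_eq_iff lab hu hv).2 e]
    · intro i j k h
      exact hz.2.2 i j k h.crossing h.2.2.2.2.2.2

end Labels

end HC

/-! ### A calculus for total correctness with running times -/

namespace HC

/-! ### Running programs -/

namespace Machine

variable {n : ℕ} {G : SimGraph n}

namespace State

def setReg (s : State) (x v : ℕ) : State := ⟨Function.update s.reg x v, s.arr⟩

def setArr (s : State) (a i v : ℕ) : State :=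
  ⟨s.reg, Function.update s.arr a (Function.update (s.arr a) i v)⟩

@[simp] theorem setReg_reg (s : State) (x v y : ℕ) :
    (s.setReg x v).reg y = if y = x then v else s.reg y := by
  simp [setReg, Function.update_apply]

@[simp] theorem setReg_arr (s : State) (x v : ℕ) : (s.setReg x v).arr = s.arr := rfl

@[simp] theorem setArr_reg (s : State) (a i v : ℕ) : (s.setArr a i v).reg = s.reg := rfl

@[simp] theorem setArr_arr (s : State) (a i v b : ℕ) :
    (s.setArr a i v).arr b = if b = a then Function.update (s.arr a) i v else s.arr b := by
  by_cases h : b = a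
  · subst h
    simp [setArr]
  · simp [setArr, h]

end State

/-- The program `p`, started in the state `s`, halts, and its running time and final state
satisfy `Q`. -/
def Runs (G : SimGraph n) (p : Prog) (s : State) (Q : ℕ → State → Prop) : Prop :=
  ∃ t s', Exec G p s t s' ∧ Q t s'

theorem Runs.mono {p : Prog} {s : State} {Q Q' : ℕ → State → Prop} (h : Runs G p s Q)
    (hQ : ∀ t s', Q t s' → Q' t s') : Runs G p s Q' := by
  obtain ⟨t, s', h1, h2⟩ := h
  exact ⟨t, s', h1, hQ t s' h2⟩

/-- This rule and those for the other loop-free constructs are equivalences, so that rewriting with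
them computes the weakest precondition of code without loops. -/
theorem runs_skip {s : State} {Q : ℕ → State → Prop} : Runs G Prog.skip s Q ↔ Q 1 s := by
  constructor
  · rintro ⟨t, s', h, hQ⟩
    cases h
    exact hQ
  · exact fun h => ⟨_, _, Exec.skip s, h⟩

theorem runs_assign {x : ℕ} {e : Expr} {s : State} {Q : ℕ → State → Prop} :
    Runs G (Prog.assign x e) s Q ↔ Q (e.cost + 1) (s.setReg x (e.eval s)) := by
  constructor
  · rintro ⟨t, s', h, hQ⟩
    cases h
    exact hQ
  · exact fun h => ⟨_, _, Exec.assign s x e, h⟩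

theorem runs_store {a : ℕ} {i e : Expr} {s : State} {Q : ℕ → State → Prop} :
    Runs G (Prog.store a i e) s Q ↔
      Q (i.cost + e.cost + 1) (s.setArr a (i.eval s) (e.eval s)) := by
  constructor
  · rintro ⟨t, s', h, hQ⟩
    cases h
    exact hQ
  · exact fun h => ⟨_, _, Exec.store s a i e, h⟩

theorem runs_seq {p q : Prog} {s : State} {Q : ℕ → State → Prop} :
    Runs G (Prog.seq p q) s Q ↔ Runs G p s fun t s' => Runs G q s' fun t' s'' => Q (t + t') s'' := by
  constructor
  · rintro ⟨t, s', h, hQ⟩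
    cases h with
    | seq hp hq => exact ⟨_, _, hp, _, _, hq, hQ⟩
  · rintro ⟨t, s', hp, t', s'', hq, hQ⟩
    exact ⟨_, _, Exec.seq hp hq, hQ⟩

theorem runs_cond {b : Test} {p q : Prog} {s : State} {Q : ℕ → State → Prop} :
    Runs G (Prog.cond b p q) s Q ↔
      (b.Holds G s → Runs G p s fun t s' => Q (b.cost + t) s') ∧
      (¬ b.Holds G s → Runs G q s fun t s' => Q (b.cost + t) s') := by
  constructor
  · rintro ⟨t, s', h, hQ⟩
    cases h with
    | condTrue hb hp => exact ⟨fun _ => ⟨_, _, hp, hQ⟩, fun h => absurd hb h⟩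
    | condFalse hb hp => exact ⟨fun h => absurd h hb, fun _ => ⟨_, _, hp, hQ⟩⟩
  · rintro ⟨h1, h2⟩
    by_cases hb : b.Holds G s
    · obtain ⟨t, s', h, hQ⟩ := h1 hb
      exact ⟨_, _, Exec.condTrue hb h, hQ⟩
    · obtain ⟨t, s', h, hQ⟩ := h2 hb
      exact ⟨_, _, Exec.condFalse hb h, hQ⟩

/-- A loop the iterations of which are paid for by the credit `c`. -/
theorem runs_loop {b : Test} {p : Prog} (I : ℕ → State → Prop) (hb : 0 < b.cost)
    (hp : ∀ c s, I c s → b.Holds G s → Runs G p s fun t s' => ∃ c', t + b.cost + c' ≤ c ∧ I c' s')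
    {c : ℕ} {s : State} (h : I c s) :
    Runs G (Prog.loop b p) s fun t s' => ∃ c', t + c' ≤ b.cost + c ∧ I c' s' ∧ ¬ b.Holds G s' := by
  -- Each pass pays at least for the test, whose cost is positive. The credit therefore decreases
  -- strictly, which also gives termination.
  induction c using Nat.strong_induction_on generalizing s with
  | _ c ih =>
    by_cases hs : b.Holds G s
    · obtain ⟨t, s', h1, c', h2, h3⟩ := hp c s h hs
      obtain ⟨t', s'', h4, c'', h5, h6⟩ := ih c' (by omega) h3
      exact ⟨_, _, Exec.loopTrue hs h1 h4, c'', by omega, h6⟩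
    · exact ⟨_, _, Exec.loopFalse hs, c, le_rfl, h, hs⟩

/-! ### Unchanged registers and arrays -/

/-- The program has an assignment to the register `x`. -/
def Prog.writesReg : Prog → ℕ → Bool
  | .skip, _ => false
  | .assign y _, x => y == x
  | .store _ _ _, _ => false
  | .seq p q, x => p.writesReg x || q.writesReg x
  | .cond _ p q, x => p.writesReg x || q.writesReg x
  | .loop _ p, x => p.writesReg x

/-- The program writes to the array `a`. -/
def Prog.writesArr : Prog → ℕ → Bool
  | .skip, _ => false
  | .assign _ _, _ => false
  | .store b _ _, a => b == a
  | .seq p q, a => p.writesArr a || q.writesArr a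
  | .cond _ p q, a => p.writesArr a || q.writesArr a
  | .loop _ p, a => p.writesArr a

/-- The states agree on the registers and arrays that `p` does not write to. -/
structure Agree (p : Prog) (s s' : State) : Prop where
  reg : ∀ x, p.writesReg x = false → s'.reg x = s.reg x
  arr : ∀ a, p.writesArr a = false → s'.arr a = s.arr a

theorem Agree.refl (p : Prog) (s : State) : Agree p s s := ⟨fun _ _ => rfl, fun _ _ => rfl⟩

theorem Agree.trans {p : Prog} {s s' s'' : State} (h : Agree p s s') (h' : Agree p s' s'') :
    Agree p s s'' :=
  ⟨fun x hx => (h'.reg x hx).trans (h.reg x hx), fun a ha => (h'.arr a ha).trans (h.arr a ha)⟩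

theorem Agree.of_imp {p q : Prog} {s s' : State} (h : Agree p s s')
    (h1 : ∀ x, q.writesReg x = false → p.writesReg x = false)
    (h2 : ∀ x, q.writesArr x = false → p.writesArr x = false) : Agree q s s' :=
  ⟨fun x hx => h.reg x (h1 x hx), fun a ha => h.arr a (h2 a ha)⟩

/-- The frame rule. Its side conditions are Boolean computations on the program text, so for
concrete programs `rfl` proves them. -/
theorem Exec.agree {p : Prog} {s s' : State} {t : ℕ} (h : Exec G p s t s') : Agree p s s' := by
  induction h with
  | skip s => exact Agree.refl _ _
  | assign s x e =>
    refine ⟨fun y hy => ?_, fun _ _ => rfl⟩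
    have : y ≠ x := by
      rintro rfl
      simp [Prog.writesReg] at hy
    simp [this]
  | store s a i e =>
    refine ⟨fun _ _ => rfl, fun b hb => ?_⟩
    have : b ≠ a := by
      rintro rfl
      simp [Prog.writesArr] at hb
    simp [this]
  | seq _ _ ih1 ih2 =>
    refine (ih1.of_imp ?_ ?_).trans (ih2.of_imp ?_ ?_) <;>
      simp +contextual [Prog.writesReg, Prog.writesArr]
  | condTrue _ _ ih => refine ih.of_imp ?_ ?_ <;> simp +contextual [Prog.writesReg, Prog.writesArr]
  | condFalse _ _ ih =>
    refine ih.of_imp ?_ ?_ <;> simp +contextual [Prog.writesReg, Prog.writesArr]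
  | loopTrue _ _ _ ih1 ih2 => exact (ih1.of_imp (q := .loop _ _) (fun _ h => h) fun _ h => h).trans ih2
  | loopFalse _ => exact Agree.refl _ _

theorem Runs.agree {p : Prog} {s : State} {Q : ℕ → State → Prop} (h : Runs G p s Q) :
    Runs G p s fun t s' => Q t s' ∧ Agree p s s' := by
  obtain ⟨t, s', h1, h2⟩ := h
  exact ⟨t, s', h1, h2, h1.agree⟩

/-! ### Counting loops -/

/-- `for x = 0, …, n - 1 do p`, where `n` is the content of register `0`. -/
def forLoop (x : ℕ) (p : Prog) : Prog :=
  .seq (.assign x (.lit 0)) (.loop (.lt (.reg x) (.reg 0)) (.seq p (.assign x (.succ (.reg x)))))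

/-- A counting loop with an invariant `I`, a potential `Φ` and amortised costs `B`. -/
theorem runs_forLoop {x : ℕ} {p : Prog} {s : State} (hs : s.reg 0 = n) (hx : x ≠ 0)
    (hpx : p.writesReg x = false) (hp0 : p.writesReg 0 = false)
    (I : ℕ → State → Prop) (Φ : State → ℕ) (B : ℕ → ℕ)
    (hΦ : ∀ s v, Φ (s.setReg x v) = Φ s) (hI : ∀ i s v, I i s → I i (s.setReg x v))
    (h0 : I 0 s)
    (hp : ∀ i : Fin n, ∀ s', Agree (forLoop x p) s s' → s'.reg x = i → I i s' →
      Runs G p s' fun t s'' => t + Φ s'' ≤ B i + Φ s' ∧ I (i + 1) s'') :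
    Runs G (forLoop x p) s fun t s' =>
      t + Φ s' ≤ ∑ i ∈ Finset.range n, (B i + 6) + 5 + Φ s ∧ I n s' := by
  have hagree : ∀ s', Agree (.assign x (.lit 0)) s s' → Agree (forLoop x p) s s' := fun s' h =>
    h.of_imp (by simp +contextual [forLoop, Prog.writesReg])
      (by simp +contextual [forLoop, Prog.writesArr])
  have hsetx : ∀ (s : State) v, Agree (forLoop x p) s (s.setReg x v) := fun s v =>
    ⟨fun y hy => by
      have : y ≠ x := by
        rintro rfl
        simp [forLoop, Prog.writesReg] at hy
      simp [this], fun _ _ => rfl⟩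
  have h0w : (forLoop x p).writesReg 0 = false := by
    simp [forLoop, Prog.writesReg, hp0, hx]
  rw [forLoop, runs_seq, runs_assign]
  -- Each pass adds 3 for the test and 3 for the increment. The remaining 5 are 2 for the initial
  -- assignment and 3 for the failing test.
  refine (runs_loop (G := G) (b := .lt (.reg x) (.reg 0))
    (fun c s' => ∃ i ≤ n, s'.reg x = i ∧ Agree (forLoop x p) s s' ∧ I i s' ∧
      c = ∑ j ∈ Finset.Ico i n, (B j + 6) + Φ s') (by simp [Test.cost]) ?_
    (c := ∑ j ∈ Finset.Ico 0 n, (B j + 6) + Φ s)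
    ⟨0, Nat.zero_le _, by simp [Expr.eval], hsetx _ _, hI _ _ _ h0, by rw [hΦ]⟩).mono ?_
  · rintro c s' ⟨i, hi, hxi, hag, hIi, rfl⟩ hb
    have hin : i < n := by
      simpa [Test.Holds, Expr.eval, hxi, hag.reg 0 h0w, hs] using hb
    rw [runs_seq]
    refine (hp ⟨i, hin⟩ s' hag hxi hIi).agree.mono ?_
    rintro t s'' ⟨⟨ht, hI'⟩, hag'⟩
    replace ht : t + Φ s'' ≤ B i + Φ s' := ht
    rw [runs_assign]
    refine ⟨∑ j ∈ Finset.Ico (i + 1) n, (B j + 6) + Φ s'', ?_, i + 1, hin, ?_, ?_, hI _ _ _ hI',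
      by rw [hΦ]⟩
    · rw [Finset.sum_eq_sum_Ico_succ_bot hin]
      simp only [Expr.cost, Test.cost]
      omega
    · simp [Expr.eval, hag'.reg x hpx, hxi]
    · refine (hag.trans (hag'.of_imp ?_ ?_)).trans (hsetx _ _) <;>
        simp +contextual [forLoop, Prog.writesReg, Prog.writesArr]
  · rintro t s' ⟨c', ht, ⟨i, hi, hxi, hag, hIi, rfl⟩, hb⟩
    have hin : i = n := by
      have : ¬ i < n := by
        simpa [Test.Holds, Expr.eval, hxi, hag.reg 0 h0w, hs] using hb
      omega
    subst hin
    rw [Finset.Ico_self, Finset.sum_empty] at ht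
    refine ⟨?_, hIi⟩
    rw [Finset.range_eq_Ico]
    simp only [Expr.cost, Test.cost] at ht ⊢
    omega

/-- A counting loop each pass of which establishes a property `D i`, which later passes
preserve. -/
theorem runs_forLoop_of_forall {x : ℕ} {p : Prog} {s : State} (hs : s.reg 0 = n) (hx : x ≠ 0)
    (hpx : p.writesReg x = false) (hp0 : p.writesReg 0 = false)
    (I : State → Prop) (D : Fin n → State → Prop) (Φ : State → ℕ) (B : ℕ → ℕ)
    (hΦ : ∀ s v, Φ (s.setReg x v) = Φ s) (hI : ∀ s v, I s → I (s.setReg x v))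
    (hD : ∀ i s v, D i s → D i (s.setReg x v)) (h0 : I s)
    (hp : ∀ i : Fin n, ∀ s', Agree (forLoop x p) s s' → s'.reg x = i → I s' →
      Runs G p s' fun t s'' => t + Φ s'' ≤ B i + Φ s' ∧ I s'' ∧ D i s'' ∧
        ∀ j, D j s' → D j s'') :
    Runs G (forLoop x p) s fun t s' =>
      t + Φ s' ≤ ∑ i ∈ Finset.range n, (B i + 6) + 5 + Φ s ∧ I s' ∧ ∀ i, D i s' := by
  refine (runs_forLoop (G := G) hs hx hpx hp0 (fun i s => I s ∧ ∀ j : Fin n, j < i → D j s) Φ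
    B hΦ (fun i s v h => ⟨hI s v h.1, fun j hj => hD j s v (h.2 j hj)⟩)
    ⟨h0, fun j hj => absurd hj (Nat.not_lt_zero j)⟩ ?_).mono ?_
  · rintro i s' hag hxi ⟨hI', hD'⟩
    refine (hp i s' hag hxi hI').mono ?_
    rintro t s'' ⟨ht, h1, h2, h3⟩
    refine ⟨ht, h1, fun j hj => ?_⟩
    rcases Nat.lt_succ_iff_lt_or_eq.1 hj with hj | hj
    · exact h3 j (hD' j hj)
    · exact Fin.ext hj ▸ h2
  · rintro t s' ⟨ht, h1, h2⟩
    exact ⟨ht, h1, fun i => h2 i i.2⟩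

/-- As n ≥ 1, the fixed overhead 5 is absorbed into the passes: 11 = 6 + 5. Every further level of
nesting adds another 11. -/
theorem runs_forLoop_const {x : ℕ} {p : Prog} {s : State} (hs : s.reg 0 = n) (hn : 1 ≤ n)
    (hx : x ≠ 0) (hpx : p.writesReg x = false) (hp0 : p.writesReg 0 = false)
    (I : State → Prop) (D : Fin n → State → Prop) (Φ : State → ℕ) (B : ℕ)
    (hΦ : ∀ s v, Φ (s.setReg x v) = Φ s) (hI : ∀ s v, I s → I (s.setReg x v))
    (hD : ∀ i s v, D i s → D i (s.setReg x v)) (h0 : I s)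
    (hp : ∀ i : Fin n, ∀ s', Agree (forLoop x p) s s' → s'.reg x = i → I s' →
      Runs G p s' fun t s'' => t + Φ s'' ≤ B + Φ s' ∧ I s'' ∧ D i s'' ∧
        ∀ j, D j s' → D j s'') :
    Runs G (forLoop x p) s fun t s' =>
      t + Φ s' ≤ n * (B + 11) + Φ s ∧ I s' ∧ ∀ i, D i s' := by
  refine (runs_forLoop_of_forall hs hx hpx hp0 I D Φ (fun _ => B) hΦ hI hD h0 hp).mono ?_
  rintro t s' ⟨ht, h1⟩
  refine ⟨ht.trans ?_, h1⟩
  rw [Finset.sum_const, Finset.card_range, smul_eq_mul]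
  nlinarith

/-- Two nested counting loops. -/
theorem runs_forLoop_forLoop {x y : ℕ} {p : Prog} {s : State} (hs : s.reg 0 = n) (hn : 1 ≤ n)
    (hx : x ≠ 0) (hy : y ≠ 0) (hxy : x ≠ y) (hpx : p.writesReg x = false)
    (hpy : p.writesReg y = false) (hp0 : p.writesReg 0 = false)
    (I : State → Prop) (D : Fin n → Fin n → State → Prop) (Φ : State → ℕ) (B : ℕ)
    (hΦ : ∀ s z v, z = x ∨ z = y → Φ (s.setReg z v) = Φ s)
    (hI : ∀ s z v, z = x ∨ z = y → I s → I (s.setReg z v))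
    (hD : ∀ i j s z v, z = x ∨ z = y → D i j s → D i j (s.setReg z v)) (h0 : I s)
    (hp : ∀ i j : Fin n, ∀ s', Agree (forLoop x (forLoop y p)) s s' → s'.reg x = i →
      s'.reg y = j → I s' → Runs G p s' fun t s'' => t + Φ s'' ≤ B + Φ s' ∧ I s'' ∧ D i j s'' ∧
        ∀ i j, D i j s' → D i j s'') :
    Runs G (forLoop x (forLoop y p)) s fun t s' =>
      t + Φ s' ≤ n * n * (B + 22) + Φ s ∧ I s' ∧ ∀ i j, D i j s' := by
  refine (runs_forLoop_const hs hn hx (by simp [forLoop, Prog.writesReg, hpx, hxy.symm])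
    (by simp [forLoop, Prog.writesReg, hp0, hy]) I
    (fun i s => ∀ j, D i j s) Φ (n * (B + 11)) (fun s v => hΦ s x v (Or.inl rfl))
    (fun s v => hI s x v (Or.inl rfl)) (fun i s v h j => hD i j s x v (Or.inl rfl) (h j)) h0
    ?_).mono ?_
  · intro i s1 hag1 hx1 hI1
    have hs1 : s1.reg 0 = n :=
      (hag1.reg 0 (by simp [forLoop, Prog.writesReg, hp0, hx, hy])).trans hs
    refine (runs_forLoop_const hs1 hn hy hpy hp0
      (fun s => I s ∧ ∀ i j, D i j s1 → D i j s) (D i) Φ B (fun s v => hΦ s y v (Or.inr rfl))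
      (fun s v h => ⟨hI s y v (Or.inr rfl) h.1,
        fun i j h' => hD i j s y v (Or.inr rfl) (h.2 i j h')⟩)
      (fun j s v h => hD i j s y v (Or.inr rfl) h) ⟨hI1, fun _ _ h => h⟩ ?_).mono ?_
    · rintro j s2 hag2 hy2 ⟨hI2, hm2⟩
      have hx2 : s2.reg x = i :=
        (hag2.reg x (by simp [forLoop, Prog.writesReg, hpx, hxy.symm])).trans hx1
      have hag : Agree (forLoop x (forLoop y p)) s s2 := by
        refine hag1.trans (hag2.of_imp ?_ ?_) <;>
          simp +contextual [forLoop, Prog.writesReg, Prog.writesArr]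
      refine (hp i j s2 hag hx2 hy2 hI2).mono ?_
      rintro t s3 ⟨ht, h1, h2, h3⟩
      exact ⟨ht, ⟨h1, fun i j h => h3 i j (hm2 i j h)⟩, h2, fun j h => h3 i j h⟩
    · rintro t s2 ⟨ht, ⟨h1, h2⟩, h3⟩
      exact ⟨ht, h1, h3, fun i h j => h2 i j (h j)⟩
  · rintro t s1 ⟨ht, h1⟩
    refine ⟨ht.trans ?_, h1⟩
    nlinarith

/-- Three nested counting loops. -/
def forLoops (x y z : ℕ) (p : Prog) : Prog := forLoop x (forLoop y (forLoop z p))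

theorem runs_forLoops {x y z : ℕ} {p : Prog} {s : State} (hs : s.reg 0 = n) (hn : 1 ≤ n)
    (hx : x ≠ 0) (hy : y ≠ 0) (hz : z ≠ 0) (hxy : x ≠ y) (hxz : x ≠ z) (hyz : y ≠ z)
    (hpx : p.writesReg x = false) (hpy : p.writesReg y = false) (hpz : p.writesReg z = false)
    (hp0 : p.writesReg 0 = false)
    (I : State → Prop) (D : Fin n → Fin n → Fin n → State → Prop) (Φ : State → ℕ) (B : ℕ)
    (hΦ : ∀ s u v, u = x ∨ u = y ∨ u = z → Φ (s.setReg u v) = Φ s)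
    (hI : ∀ s u v, u = x ∨ u = y ∨ u = z → I s → I (s.setReg u v))
    (hD : ∀ i j k s u v, u = x ∨ u = y ∨ u = z → D i j k s → D i j k (s.setReg u v)) (h0 : I s)
    (hp : ∀ i j k : Fin n, ∀ s', Agree (forLoops x y z p) s s' → s'.reg x = i →
      s'.reg y = j → s'.reg z = k → I s' →
      Runs G p s' fun t s'' => t + Φ s'' ≤ B + Φ s' ∧ I s'' ∧ D i j k s'' ∧
        ∀ i j k, D i j k s' → D i j k s'') :
    Runs G (forLoops x y z p) s fun t s' =>
      t + Φ s' ≤ n * n * n * (B + 33) + Φ s ∧ I s' ∧ ∀ i j k, D i j k s' := by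
  have h3 : ∀ {u}, u = x ∨ u = y → u = x ∨ u = y ∨ u = z := fun h => by tauto
  refine (runs_forLoop_forLoop hs hn hx hy hxy (by simp [forLoop, Prog.writesReg, hpx, hxz.symm])
    (by simp [forLoop, Prog.writesReg, hpy, hyz.symm])
    (by simp [forLoop, Prog.writesReg, hp0, hz]) I
    (fun i j s => ∀ k, D i j k s) Φ (n * (B + 11)) (fun s u v h => hΦ s u v (h3 h))
    (fun s u v h => hI s u v (h3 h)) (fun i j s u v h h' k => hD i j k s u v (h3 h) (h' k)) h0
    ?_).mono ?_
  · intro i j s1 hag1 hx1 hy1 hI1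
    have hs1 : s1.reg 0 = n :=
      (hag1.reg 0 (by simp [forLoop, Prog.writesReg, hp0, hx, hy, hz])).trans hs
    have hz' : z = x ∨ z = y ∨ z = z := by tauto
    refine (runs_forLoop_const hs1 hn hz hpz hp0
      (fun s => I s ∧ ∀ i j k, D i j k s1 → D i j k s) (D i j) Φ B
      (fun s v => hΦ s z v hz') (fun s v h => ⟨hI s z v hz' h.1,
        fun i j k h' => hD i j k s z v hz' (h.2 i j k h')⟩)
      (fun k s v h => hD i j k s z v hz' h) ⟨hI1, fun _ _ _ h => h⟩ ?_).mono ?_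
    · rintro k s2 hag2 hz2 ⟨hI2, hm2⟩
      have hx2 : s2.reg x = i :=
        (hag2.reg x (by simp [forLoop, Prog.writesReg, hpx, hxz.symm])).trans hx1
      have hy2 : s2.reg y = j :=
        (hag2.reg y (by simp [forLoop, Prog.writesReg, hpy, hyz.symm])).trans hy1
      have hag : Agree (forLoops x y z p) s s2 := by
        refine hag1.trans (hag2.of_imp ?_ ?_) <;>
          simp +contextual [forLoop, Prog.writesReg, Prog.writesArr]
      refine (hp i j k s2 hag hx2 hy2 hz2 hI2).mono ?_
      rintro t s3 ⟨ht, h1, h2, h3⟩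
      exact ⟨ht, ⟨h1, fun i j k h => h3 i j k (hm2 i j k h)⟩, h2, fun k h => h3 i j k h⟩
    · rintro t s2 ⟨ht, ⟨h1, h2⟩, h3⟩
      exact ⟨ht, h1, h3, fun i j h k => h2 i j k (h k)⟩
  · rintro t s1 ⟨ht, h1⟩
    refine ⟨ht.trans ?_, h1⟩
    have : n ≤ n * n := by nlinarith
    nlinarith [Nat.mul_le_mul_left (n * n) hn]

end Machine

end HC

/-! ### Tests, labels and the stack of pairs to be merged -/

namespace HC

namespace Machine

variable {n : ℕ} {G : SimGraph n}

/-! ### Tests -/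

theorem weight_coe (G : SimGraph n) (a b : Fin n) : weight G a b = G.w a b := by
  simp [weight]

def eqTest (e f : Expr) : Test := .and (.not (.lt e f)) (.not (.lt f e))

@[simp] theorem holds_eqTest {e f : Expr} {s : State} :
    (eqTest e f).Holds G s ↔ e.eval s = f.eval s := by
  simp only [eqTest, Test.Holds]
  omega

@[simp] theorem cost_eqTest {e f : Expr} : (eqTest e f).cost = 2 * (e.cost + f.cost) + 5 := by
  simp only [eqTest, Test.cost]
  omega

/-- The three registers hold different numbers. -/
def distinctTest (x y z : ℕ) : Test :=
  .and (.not (eqTest (.reg x) (.reg y)))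
    (.and (.not (eqTest (.reg x) (.reg z))) (.not (eqTest (.reg y) (.reg z))))

def typeOneTest (x y z : ℕ) : Test :=
  .and (distinctTest x y z) (.and (.wlt (.reg x) (.reg z) (.reg x) (.reg y))
    (.wlt (.reg y) (.reg z) (.reg x) (.reg y)))

def typeTwoTest (x y z : ℕ) : Test :=
  .and (distinctTest x y z) (.and (.not (.wlt (.reg x) (.reg y) (.reg x) (.reg z)))
    (.and (.not (.wlt (.reg x) (.reg z) (.reg x) (.reg y)))
      (.wlt (.reg y) (.reg z) (.reg x) (.reg y))))

theorem holds_typeOneTest {x y z : ℕ} {s : State} {a b c : Fin n} (hx : s.reg x = a)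
    (hy : s.reg y = b) (hz : s.reg z = c) :
    (typeOneTest x y z).Holds G s ↔ TypeOne G a b c := by
  simp [typeOneTest, distinctTest, Test.Holds, Expr.eval, hx, hy, hz, weight_coe, TypeOne,
    Fin.ext_iff, and_assoc]

theorem holds_typeTwoTest {x y z : ℕ} {s : State} {a b c : Fin n} (hx : s.reg x = a)
    (hy : s.reg y = b) (hz : s.reg z = c) :
    (typeTwoTest x y z).Holds G s ↔ TypeTwo G a b c := by
  simp only [typeTwoTest, distinctTest, Test.Holds, holds_eqTest, Expr.eval, hx, hy, hz,
    weight_coe, TypeTwo, ne_eq, Fin.ext_iff, and_assoc, not_lt]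
  refine and_congr_right fun _ => and_congr_right fun _ => and_congr_right fun _ => ?_
  rw [← and_assoc, and_comm (a := G.w a c ≤ G.w a b), ← le_antisymm_iff]

@[simp] theorem cost_typeOneTest (x y z : ℕ) : (typeOneTest x y z).cost = 44 := rfl

@[simp] theorem cost_typeTwoTest (x y z : ℕ) : (typeTwoTest x y z).cost = 52 := rfl

/-! ### Registers and arrays -/

notation "rAns" => (1 : ℕ)
notation "rTop" => (2 : ℕ)
notation "rId" => (3 : ℕ)
notation "rNew" => (4 : ℕ)
notation "rOut" => (5 : ℕ)
notation "rCount" => (6 : ℕ)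
notation "rRep" => (7 : ℕ)
notation "rI" => (8 : ℕ)
notation "rJ" => (9 : ℕ)
notation "rK" => (10 : ℕ)
notation "rV" => (11 : ℕ)
notation "rQ" => (12 : ℕ)
notation "rA" => (13 : ℕ)
notation "rB" => (14 : ℕ)
notation "rCand" => (15 : ℕ)
notation "rOk" => (16 : ℕ)
notation "rOne" => (17 : ℕ)
notation "rFlip" => (18 : ℕ)
notation "aOut" => (0 : ℕ)
notation "aBlk" => (1 : ℕ)
notation "aStk" => (2 : ℕ)
notation "aLab" => (3 : ℕ)
notation "aX" => (4 : ℕ)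
notation "aY" => (5 : ℕ)
notation "aBad" => (6 : ℕ)
notation "aCol" => (7 : ℕ)
notation "aComp" => (8 : ℕ)

/-- `S` is the current set of vertices: those of the block with number `rId`. -/
def Current (S : Finset (Fin n)) (s : State) : Prop :=
  s.reg 0 = n ∧ ∀ v : Fin n, v ∈ S ↔ s.arr aBlk v = s.reg rId

theorem Current.of_agree {S : Finset (Fin n)} {p : Prog} {s s' : State} (h : Current S s)
    (ha : Agree p s s') (h0 : p.writesReg 0 = false) (h3 : p.writesReg rId = false)
    (h1 : p.writesArr aBlk = false) : Current S s' := by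
  unfold Current
  rw [ha.reg 0 h0, ha.reg rId h3, ha.arr aBlk h1]
  exact h

def memTest (x : ℕ) : Test := eqTest (.load aBlk (.reg x)) (.reg rId)

theorem holds_memTest {S : Finset (Fin n)} {s : State} (h : Current S s) {x : ℕ} {a : Fin n}
    (hx : s.reg x = a) : (memTest x).Holds G s ↔ a ∈ S := by
  rw [memTest, holds_eqTest, h.2 a]
  simp [Expr.eval, hx]

@[simp] theorem cost_memTest (x : ℕ) : (memTest x).cost = 11 := rfl

def memTests (x y z : ℕ) : Test := .and (memTest x) (.and (memTest y) (memTest z))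

theorem holds_memTests {S : Finset (Fin n)} {s : State} (h : Current S s) {x y z : ℕ}
    {a b c : Fin n} (hx : s.reg x = a) (hy : s.reg y = b) (hz : s.reg z = c) :
    (memTests x y z).Holds G s ↔ a ∈ S ∧ b ∈ S ∧ c ∈ S := by
  rw [memTests, Test.Holds, Test.Holds, holds_memTest h hx, holds_memTest h hy, holds_memTest h hz]

@[simp] theorem cost_memTests (x y z : ℕ) : (memTests x y z).cost = 35 := rfl

/-- Whether the labels of the vertices in two registers agree. -/
def sameTest (a x y : ℕ) : Test := eqTest (.load a (.reg x)) (.load a (.reg y))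

theorem holds_sameTest {s : State} {a x y : ℕ} :
    (sameTest a x y).Holds G s ↔ s.arr a (s.reg x) = s.arr a (s.reg y) := by
  simp [sameTest, Expr.eval]

@[simp] theorem cost_sameTest (a x y : ℕ) : (sameTest a x y).cost = 13 := rfl

/-! ### The number of separated pairs -/

/-- The number of pairs of vertices with different values of `f`. -/
def separated (n : ℕ) (f : ℕ → ℕ) : ℕ :=
  ((Finset.range n ×ˢ Finset.range n).filter fun p => f p.1 ≠ f p.2).card

theorem separated_le (n : ℕ) (f : ℕ → ℕ) : separated n f ≤ n * n := by
  refine (Finset.card_filter_le _ _).trans ?_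
  simp

/-- Merging separates no new pair, and it loses all pairs from class `a` to class `b`. One of the
two orders of these pairs is enough for the estimate. -/
theorem separated_merge (n : ℕ) (f g : ℕ → ℕ) (a b : ℕ) (hab : a ≠ b)
    (hg : ∀ v, v < n → g v = if f v = b then a else f v) :
    separated n g + ((Finset.range n).filter fun v => f v = a).card *
      ((Finset.range n).filter fun v => f v = b).card ≤ separated n f := by
  unfold separated
  rw [← Finset.card_product, ← Finset.card_union_of_disjoint]
  · refine Finset.card_le_card fun p hp => ?_
    rw [Finset.mem_union] at hp
    rcases hp with hp | hp
    · simp only [Finset.mem_filter, Finset.mem_product, Finset.mem_range] at hp ⊢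
      refine ⟨hp.1, fun e => hp.2 ?_⟩
      rw [hg _ hp.1.1, hg _ hp.1.2, e]
    · simp only [Finset.mem_filter, Finset.mem_product, Finset.mem_range] at hp ⊢
      exact ⟨⟨hp.1.1, hp.2.1⟩, by rw [hp.1.2, hp.2.2]; exact hab⟩
  · rw [Finset.disjoint_left]
    intro p hp hp'
    simp only [Finset.mem_filter, Finset.mem_product, Finset.mem_range] at hp hp'
    refine hp.2 ?_
    rw [hg _ hp.1.1, hg _ hp.1.2, hp'.1.2, hp'.2.2]
    simp [hab]

/-! ### Computing the minimal valid partition -/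

/-- The labels in the array `a`. -/
def labels (n : ℕ) (a : ℕ) (s : State) : Fin n → ℕ := fun v => s.arr a v

def initLabels : Prog :=
  forLoop rV (.seq (.store aLab (.reg rV) (.reg rV)) (.store aBad (.reg rV) (.lit 0)))

theorem runs_initLabels (hn : 1 ≤ n) {s : State} (hs : s.reg 0 = n) :
    Runs G initLabels s fun t s' => t ≤ n * 20 ∧ ∀ v : Fin n, s'.arr aLab v = v ∧ s'.arr aBad v = 0 := by
  refine (runs_forLoop_const hs hn (by decide) rfl rfl (fun _ => True)
    (fun v s => s.arr aLab v = v ∧ s.arr aBad v = 0) (fun _ => 0) 9 (fun _ _ => rfl)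
    (fun _ _ _ => trivial) (fun _ _ _ h => h) trivial ?_).mono fun t s' h => ⟨by simpa using h.1, h.2.2⟩
  intro i s' _ hx _
  simp only [runs_seq, runs_store, Expr.eval, Expr.cost, hx]
  refine ⟨by norm_num, trivial, by simp [hx], fun j h => ?_⟩
  by_cases e : j = i
  · subst e
    simp [hx]
  · have e' : (j : ℕ) ≠ i := fun h => e (Fin.ext h)
    simpa [hx, Function.update_of_ne e'] using h

/-- The pair `(a, b)` is on the stack of pairs that remain to be merged. -/
def OnStack (s : State) (a b : ℕ) : Prop :=
  ∃ p, p < s.reg rQ ∧ s.arr aX p = a ∧ s.arr aY p = b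

def pushPair : Prog :=
  .seq (.store aX (.reg rQ) (.reg rI))
    (.seq (.store aY (.reg rQ) (.reg rJ)) (.assign rQ (.succ (.reg rQ))))

/-- All pairs on the stack consist of inseparable vertices. -/
def StackSound (G : SimGraph n) (S : Finset (Fin n)) (s : State) : Prop :=
  ∀ p, p < s.reg rQ → ∃ a b : Fin n, s.arr aX p = a ∧ s.arr aY p = b ∧ a ∈ S ∧ b ∈ S ∧
    Inseparable G S a b

/-- The effect of an optional push. -/
theorem runs_cond_pushPair {S : Finset (Fin n)} {b : Test} {s : State} {i j : Fin n}
    (hi : s.reg rI = i) (hj : s.reg rJ = j) (hs : StackSound G S s)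
    (hb : b.Holds G s → i ∈ S ∧ j ∈ S ∧ Inseparable G S i j) :
    Runs G (.cond b pushPair .skip) s fun t s' => t + 60 * s'.reg rQ ≤ b.cost + 69 + 60 * s.reg rQ ∧
      StackSound G S s' ∧ (b.Holds G s → OnStack s' i j) ∧
      ∀ a b, OnStack s a b → OnStack s' a b := by
  simp only [runs_cond, pushPair, runs_seq, runs_store, runs_assign, runs_skip, Expr.eval,
    Expr.cost]
  -- The push takes 9 steps and endows the new entry with a credit of 60 for its later removal.
  refine ⟨fun h => ⟨?_, ?_, fun _ => ?_, ?_⟩, fun h => ⟨?_, hs, fun h' => absurd h' h, fun _ _ h => h⟩⟩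
  · simp
    omega
  · intro p hp
    simp only [State.setReg_reg, if_true, State.setArr_reg] at hp
    rcases Nat.lt_succ_iff_lt_or_eq.1 hp with hp | rfl
    · obtain ⟨a, b, h1, h2, h3⟩ := hs p hp
      exact ⟨a, b, by simpa [Function.update_of_ne hp.ne] using h1,
        by simpa [Function.update_of_ne hp.ne] using h2, h3⟩
    · exact ⟨i, j, by simp [hi], by simp [hj], hb h⟩
  · exact ⟨s.reg rQ, by simp, by simp [hi], by simp [hj]⟩
  · rintro a b ⟨p, hp, h1, h2⟩
    exact ⟨p, by simp; omega, by simpa [Function.update_of_ne hp.ne] using h1,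
      by simpa [Function.update_of_ne hp.ne] using h2⟩
  · omega

def pushTypeOne : Prog :=
  .seq (.assign rQ (.lit 0)) (forLoops rI rJ rK
    (.cond (.and (memTests rI rJ rK) (typeOneTest rI rJ rK)) pushPair .skip))

theorem runs_pushTypeOne (hn : 1 ≤ n) {S : Finset (Fin n)} {s : State} (hs : Current S s) :
    Runs G pushTypeOne s fun t s' => t + 60 * s'.reg rQ ≤ n * n * n * 190 ∧ StackSound G S s' ∧
      ∀ i ∈ S, ∀ j ∈ S, ∀ k ∈ S, TypeOne G i j k → OnStack s' i j := by
  rw [pushTypeOne, runs_seq, runs_assign]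
  have h0 : Current S (s.setReg rQ (Expr.eval s (.lit 0))) := hs
  refine (runs_forLoops h0.1 hn (by decide) (by decide) (by decide) (by decide) (by decide)
    (by decide) rfl rfl rfl rfl (StackSound G S)
    (fun i j k s => i ∈ S → j ∈ S → k ∈ S → TypeOne G i j k → OnStack s i j)
    (fun s => 60 * s.reg rQ) 150 ?_ ?_ ?_ ?_ ?_).mono ?_
  · rintro s u v (rfl | rfl | rfl) <;> simp
  · rintro s u v (rfl | rfl | rfl) h <;> exact h
  · rintro i j k s u v (rfl | rfl | rfl) h <;> exact h
  · intro p hp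
    simp [Expr.eval] at hp
  · intro i j k s' hag hi hj hk hI
    have hc : Current S s' := h0.of_agree hag rfl rfl rfl
    have hb : (Test.and (memTests rI rJ rK) (typeOneTest rI rJ rK)).Holds G s' ↔
        (i ∈ S ∧ j ∈ S ∧ k ∈ S) ∧ TypeOne G i j k := by
      rw [Test.Holds, holds_memTests hc hi hj hk, holds_typeOneTest hi hj hk]
    refine (runs_cond_pushPair hi hj hI fun h => ?_).mono ?_
    · obtain ⟨⟨hi, hj, hk⟩, h⟩ := hb.1 h
      exact ⟨hi, hj, fun P hP => hP.part_eq_of_typeOne hi hj hk h⟩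
    · rintro t s'' ⟨h1, h2, h3, h4⟩
      refine ⟨?_, h2, fun hi hj hk h => h3 (hb.2 ⟨⟨hi, hj, hk⟩, h⟩),
        fun i j k h hi hj hk ht => h4 _ _ (h hi hj hk ht)⟩
      simp only [Test.cost, cost_memTests, cost_typeOneTest] at h1
      omega
  · rintro t s' ⟨h1, h2, h3⟩
    refine ⟨?_, h2, fun i hi j hj k hk ht => h3 i j k hi hj hk ht⟩
    simp [Expr.eval, Expr.cost] at h1 ⊢
    nlinarith [Nat.mul_le_mul (Nat.mul_le_mul hn hn) hn]

end Machine

end HC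

/-! ### Closure under the forced merges, in amortised cubic time -/

namespace HC

namespace Machine

variable {n : ℕ} {G : SimGraph n}

theorem sum_range_ite_const (n : ℕ) (f : ℕ → ℕ) (a b c : ℕ) :
    ∑ i ∈ Finset.range n, (b + (if f i = a then c else 0) + 6) =
      n * (b + 6) + ((Finset.range n).filter fun v => f v = a).card * c := by
  simp only [Finset.sum_add_distrib, Finset.sum_const, Finset.card_range, smul_eq_mul,
    ← Finset.sum_filter]
  ring

/-- For all `j, k` with the labels `rA, rB`, push the pairs which are to be merged when these labels
are identified. -/
def pushTypeTwo : Prog :=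
  forLoop rJ (.cond (.and (memTest rJ) (eqTest (.load aLab (.reg rJ)) (.reg rA)))
    (forLoop rK (.cond (.and (memTest rK) (eqTest (.load aLab (.reg rK)) (.reg rB)))
      (forLoop rI (.cond (.and (memTest rI) (typeTwoTest rI rJ rK)) pushPair .skip))
      .skip))
    .skip)

/-- The innermost loop over the apexes runs only for pairs from the two classes that are being
merged. The product of the class sizes in the bound is what `separated_merge` pays for. -/
theorem runs_pushTypeTwo (hn : 1 ≤ n) {S : Finset (Fin n)} {s : State} (hs : Current S s)
    (hst : StackSound G S s) (hsep : ∀ j ∈ S, ∀ k ∈ S, s.arr aLab j = s.reg rA →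
      s.arr aLab k = s.reg rB → Inseparable G S j k) :
    Runs G pushTypeTwo s fun t s' => t + 60 * s'.reg rQ ≤ n * 30 +
        ((Finset.range n).filter fun v => s.arr aLab v = s.reg rA).card *
        (n * 30 + ((Finset.range n).filter fun v => s.arr aLab v = s.reg rB).card *
        (n * 144) + 5) + 5 + 60 * s.reg rQ ∧ StackSound G S s' ∧
      (∀ a b, OnStack s a b → OnStack s' a b) ∧
      ∀ i ∈ S, ∀ j ∈ S, ∀ k ∈ S, s.arr aLab j = s.reg rA → s.arr aLab k = s.reg rB →
        TypeTwo G i j k → OnStack s' i j := by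
  set D := ((Finset.range n).filter fun v => s.arr aLab v = s.reg rB).card with hD
  refine (runs_forLoop_of_forall (x := rJ) hs.1 (by decide) rfl rfl
    (fun s' => StackSound G S s' ∧ ∀ a b, OnStack s a b → OnStack s' a b)
    (fun j s' => j ∈ S → ∀ i ∈ S, ∀ k ∈ S, s.arr aLab j = s.reg rA → s.arr aLab k = s.reg rB →
        TypeTwo G i j k → OnStack s' i j) (fun s => 60 * s.reg rQ)
    (fun j => 24 + if s.arr aLab j = s.reg rA then (n * 30 + D * (n * 144) + 5) else 0)
    (fun _ _ => rfl) (fun _ _ h => h) (fun _ _ _ h => h) ⟨hst, fun _ _ h => h⟩ ?_).mono ?_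
  · rintro j s1 hag1 hj ⟨hst1, hm1⟩
    have hc1 : Current S s1 := hs.of_agree hag1 rfl rfl rfl
    have hl1 : s1.arr aLab = s.arr aLab := hag1.arr aLab rfl
    have ha1 : s1.reg rA = s.reg rA := hag1.reg rA rfl
    have hb1 : s1.reg rB = s.reg rB := hag1.reg rB rfl
    rw [runs_cond]
    simp only [Test.Holds, holds_memTest hc1 hj, holds_eqTest, Expr.eval, hj, hl1, ha1]
    refine ⟨fun ⟨hjS, hja⟩ => ?_, fun h => ?_⟩
    · refine (runs_forLoop_of_forall (x := rK) hc1.1 (by decide) rfl rfl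
        (fun s' => StackSound G S s' ∧ ∀ a b, OnStack s1 a b → OnStack s' a b)
        (fun k s' => k ∈ S → ∀ i ∈ S, s.arr aLab k = s.reg rB →
          TypeTwo G i j k → OnStack s' i j) (fun s => 60 * s.reg rQ)
        (fun k => 24 + if s.arr aLab k = s.reg rB then n * 144 else 0)
        (fun _ _ => rfl) (fun _ _ h => h) (fun _ _ _ h => h) ⟨hst1, fun _ _ h => h⟩ ?_).mono ?_
      · rintro k s2 hag2 hk ⟨hst2, hm2⟩
        have hc2 : Current S s2 := hc1.of_agree hag2 rfl rfl rfl
        have hl2 : s2.arr aLab = s.arr aLab := (hag2.arr aLab rfl).trans hl1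
        have hb2 : s2.reg rB = s.reg rB := (hag2.reg rB rfl).trans hb1
        have hj2 : s2.reg rJ = j := (hag2.reg rJ rfl).trans hj
        rw [runs_cond]
        simp only [Test.Holds, holds_memTest hc2 hk, holds_eqTest, Expr.eval, hk, hl2, hb2]
        refine ⟨fun ⟨hkS, hkb⟩ => ?_, fun h => ?_⟩
        · refine (runs_forLoop_const (x := rI) hc2.1 hn (by decide) rfl rfl
            (fun s' => StackSound G S s' ∧ ∀ a b, OnStack s2 a b → OnStack s' a b)
            (fun i s' => i ∈ S → TypeTwo G i j k → OnStack s' i j) (fun s => 60 * s.reg rQ)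
            133 (fun _ _ => rfl) (fun _ _ h => h) (fun _ _ _ h => h)
            ⟨hst2, fun _ _ h => h⟩ ?_).mono ?_
          · rintro i s3 hag3 hi ⟨hst3, hm3⟩
            have hc3 : Current S s3 := hc2.of_agree hag3 rfl rfl rfl
            have hj3 : s3.reg rJ = j := (hag3.reg rJ rfl).trans hj2
            have hk3 : s3.reg rK = k := (hag3.reg rK rfl).trans hk
            have hb : (Test.and (memTest rI) (typeTwoTest rI rJ rK)).Holds G s3 ↔
                i ∈ S ∧ TypeTwo G i j k := by
              rw [Test.Holds, holds_memTest hc3 hi, holds_typeTwoTest hi hj3 hk3]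
            refine (runs_cond_pushPair hi hj3 hst3 fun h => ?_).mono ?_
            · obtain ⟨hiS, h⟩ := hb.1 h
              exact ⟨hiS, hjS, fun P hP => hP.part_eq_of_typeTwo hiS hjS hkS h
                (hsep j hjS k hkS hja hkb P hP)⟩
            · rintro t s4 ⟨h1, h2, h3, h4⟩
              refine ⟨?_, ⟨h2, fun a b h => h4 a b (hm3 a b h)⟩, fun hi ht => h3 (hb.2 ⟨hi, ht⟩),
                fun i h hi ht => h4 _ _ (h hi ht)⟩
              simp only [Test.cost, cost_memTest, cost_typeTwoTest] at h1
              omega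
          · rintro t s3 ⟨h1, ⟨h2, h3⟩, h4⟩
            refine ⟨?_, ⟨h2, fun a b h => h3 a b (hm2 a b h)⟩, fun _ i hi _ ht => h4 i hi ht,
              fun k h hk i hi hkb ht => h3 _ _ (h hk i hi hkb ht)⟩
            simp only [Test.cost, cost_memTest, cost_eqTest, Expr.cost, if_pos hkb]
            omega
        · rw [runs_skip]
          refine ⟨?_, ⟨hst2, hm2⟩, fun hk i _ hkb _ => absurd ⟨hk, hkb⟩ h, fun _ h => h⟩
          simp only [Test.cost, cost_memTest, cost_eqTest, Expr.cost]
          omega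
      · rintro t s2 ⟨h1, ⟨h2, h3⟩, h4⟩
        refine ⟨?_, ⟨h2, fun a b h => h3 a b (hm1 a b h)⟩,
          fun _ i hi k hk _ hkb ht => h4 k hk i hi hkb ht,
          fun j h hj i hi k hk hja hkb ht => h3 _ _ (h hj i hi k hk hja hkb ht)⟩
        rw [sum_range_ite_const, ← hD] at h1
        simp only [Test.cost, cost_memTest, cost_eqTest, Expr.cost, if_pos hja]
        omega
    · rw [runs_skip]
      refine ⟨?_, ⟨hst1, hm1⟩, fun hj i _ k _ hja _ _ => absurd ⟨hj, hja⟩ h, fun _ h => h⟩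
      simp only [Test.cost, cost_memTest, cost_eqTest, Expr.cost]
      omega
  · rintro t s1 ⟨h1, ⟨h2, h3⟩, h4⟩
    refine ⟨?_, h2, h3, fun i hi j hj k hk hja hkb ht => h4 j hj i hi k hk hja hkb ht⟩
    rw [sum_range_ite_const] at h1
    omega

/-- Replace the label `rB` by `rA`. -/
def replaceLabel : Prog :=
  forLoop rV (.cond (eqTest (.load aLab (.reg rV)) (.reg rB))
    (.store aLab (.reg rV) (.reg rA)) .skip)

theorem runs_replaceLabel (hn : 1 ≤ n) {s : State} (hs : s.reg 0 = n) :
    Runs G replaceLabel s fun t s' => t ≤ n * 25 ∧ ∀ v, v < n →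
      s'.arr aLab v = if s.arr aLab v = s.reg rB then s.reg rA else s.arr aLab v := by
  refine (runs_forLoop hs (by decide) rfl rfl
    (fun i s' => ∀ v, s'.arr aLab v =
      if v < i ∧ s.arr aLab v = s.reg rB then s.reg rA else s.arr aLab v)
    (fun _ => 0) (fun _ => 14) (fun _ _ => rfl) (fun _ _ _ h => h) (by simp) ?_).mono ?_
  · intro i s1 hag hi hI
    have ha : s1.reg rA = s.reg rA := hag.reg rA rfl
    have hb : s1.reg rB = s.reg rB := hag.reg rB rfl
    have hli : s1.arr aLab i = s.arr aLab i := by simpa using hI i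
    simp only [runs_cond, runs_store, runs_skip, holds_eqTest, Expr.eval, cost_eqTest, Expr.cost,
      hi, ha, hb, hli]
    refine ⟨fun h => ⟨by norm_num, fun v => ?_⟩, fun h => ⟨by norm_num, fun v => ?_⟩⟩
    · by_cases hv : v = i
      · subst hv
        simp [h]
      · have : v < i + 1 ↔ v < i := by omega
        simp [Function.update_of_ne hv, hI v, this]
    · by_cases hv : v = i
      · subst hv
        simp [h, hli]
      · have : v < i + 1 ↔ v < i := by omega
        simp only [hI v, this]
  · rintro t s1 ⟨h1, h2⟩
    refine ⟨?_, fun v hv => by simpa [hv] using h2 v⟩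
    rw [Finset.sum_const, Finset.card_range, smul_eq_mul] at h1
    omega

/-- Take a pair off the stack, and merge the two clusters. -/
def popMerge : Prog :=
  .seq (.assign rQ (.pred (.reg rQ)))
    (.seq (.assign rA (.load aLab (.load aX (.reg rQ))))
      (.seq (.assign rB (.load aLab (.load aY (.reg rQ))))
        (.cond (eqTest (.reg rA) (.reg rB)) .skip (.seq pushTypeTwo replaceLabel))))

/-- The invariant of the computation of the minimal valid partition. -/
structure ClosureInv (G : SimGraph n) (S : Finset (Fin n)) (s : State) : Prop where
  current : Current S s
  stackSound : StackSound G S s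
  labelsSound : LabelsSound G S (labels n aLab s)
  one : ∀ i ∈ S, ∀ j ∈ S, ∀ k ∈ S, TypeOne G i j k →
    s.arr aLab i = s.arr aLab j ∨ OnStack s i j
  two : ∀ i ∈ S, ∀ j ∈ S, ∀ k ∈ S, TypeTwo G i j k → s.arr aLab j = s.arr aLab k →
    s.arr aLab i = s.arr aLab j ∨ OnStack s i j ∨ OnStack s i k
  lt : ∀ v : Fin n, s.arr aLab v < n

/-- The potential is 60 for each stack entry and 300n for each separated pair. The removed entry
pays for the constant work, including the 3 steps of the surrounding loop test. Merging classes of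
sizes C and D releases at least 300nCD, which covers scanning and relabelling. -/
theorem runs_popMerge (hn : 1 ≤ n) {S : Finset (Fin n)} {s : State} (hs : ClosureInv G S s)
    (hq : 0 < s.reg rQ) :
    Runs G popMerge s fun t s' => t + 3 + (60 * s'.reg rQ + 300 * (n * separated n (s'.arr aLab)))
      ≤ 60 * s.reg rQ + 300 * (n * separated n (s.arr aLab)) ∧ ClosureInv G S s' := by
  obtain ⟨a, b, hXa, hYb, haS, hbS, hab⟩ := hs.stackSound (s.reg rQ - 1) (by omega)
  simp only [popMerge, runs_seq, runs_assign, Expr.eval, Expr.cost, State.setReg_reg,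
    State.setReg_arr, if_true, Nat.reduceEqDiff, if_false, hXa, hYb]
  set s1 := ((s.setReg rQ (s.reg rQ - 1)).setReg rA
    (s.arr aLab a)).setReg rB (s.arr aLab b) with hs1
  have hq1 : s1.reg rQ = s.reg rQ - 1 := by simp [hs1]
  have hA1 : s1.reg rA = s.arr aLab a := by simp [hs1]
  have hB1 : s1.reg rB = s.arr aLab b := by simp [hs1]
  have harr : s1.arr = s.arr := by simp [hs1]
  have hc1 : Current S s1 := hs.current
  have hst1 : StackSound G S s1 := by
    intro p hp
    rw [harr]
    exact hs.stackSound p (by omega)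
  have hon1 : ∀ u v : Fin n, OnStack s u v → OnStack s1 u v ∨ (u = a ∧ v = b) := by
    rintro u v ⟨p, hp, h1, h2⟩
    by_cases hp' : p < s1.reg rQ
    · exact Or.inl ⟨p, hp', by rw [harr, h1], by rw [harr, h2]⟩
    · obtain rfl : p = s.reg rQ - 1 := by omega
      right
      exact ⟨Fin.ext (h1.symm.trans hXa), Fin.ext (h2.symm.trans hYb)⟩
  simp only [runs_cond, holds_eqTest, Expr.eval, cost_eqTest, Expr.cost, runs_skip, hA1, hB1]
  refine ⟨fun hlab => ⟨?_, ?_⟩, fun hlab => ?_⟩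
  · rw [hq1, harr]
    omega
  · refine ⟨hc1, hst1, ?_, ?_, ?_, ?_⟩
    · intro u hu v hv e
      simp only [labels, harr] at e
      exact hs.labelsSound u hu v hv e
    · intro i hi j hj k hk t
      rw [harr]
      rcases hs.one i hi j hj k hk t with h | h
      · exact Or.inl h
      · rcases hon1 i j h with h | ⟨rfl, rfl⟩
        · exact Or.inr h
        · exact Or.inl hlab
    · intro i hi j hj k hk t e
      rw [harr] at e ⊢
      rcases hs.two i hi j hj k hk t e with h | h | h
      · exact Or.inl h
      · rcases hon1 i j h with h | ⟨rfl, rfl⟩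
        · exact Or.inr (Or.inl h)
        · exact Or.inl hlab
      · rcases hon1 i k h with h | ⟨rfl, rfl⟩
        · exact Or.inr (Or.inr h)
        · exact Or.inl (hlab.trans e.symm)
    · intro v
      rw [harr]
      exact hs.lt v
  · have hins : ∀ j ∈ S, ∀ k ∈ S, s.arr aLab j = s.arr aLab a → s.arr aLab k = s.arr aLab b →
        Inseparable G S j k := fun j hj k hk h1 h2 =>
      ((hs.labelsSound j hj a haS h1).trans hab).trans (hs.labelsSound k hk b hbS h2).symm
    rw [runs_seq]
    refine (runs_pushTypeTwo hn hc1 hst1 ?_).agree.mono ?_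
    · rw [harr, hA1, hB1]
      exact hins
    rintro t2 s2 ⟨⟨ht2, hst2, hm2, hnew2⟩, hag2⟩
    rw [harr, hA1, hB1] at ht2 hnew2
    have hc2 : Current S s2 := hc1.of_agree hag2 rfl rfl rfl
    have hl2 : s2.arr aLab = s.arr aLab := (hag2.arr aLab rfl).trans (by rw [harr])
    have hA2 : s2.reg rA = s.arr aLab a := (hag2.reg rA rfl).trans hA1
    have hB2 : s2.reg rB = s.arr aLab b := (hag2.reg rB rfl).trans hB1
    refine (runs_replaceLabel hn hc2.1).agree.mono ?_
    rintro t3 s3 ⟨⟨ht3, hl3⟩, hag3⟩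
    rw [hl2, hA2, hB2] at hl3
    have hq3 : s3.reg rQ = s2.reg rQ := hag3.reg rQ rfl
    have hX3 : s3.arr aX = s2.arr aX := hag3.arr aX rfl
    have hY3 : s3.arr aY = s2.arr aY := hag3.arr aY rfl
    have hon3 : ∀ u v, OnStack s3 u v ↔ OnStack s2 u v := by
      intro u v
      unfold OnStack
      rw [hq3, hX3, hY3]
    have hl3' : ∀ v : Fin n, s3.arr aLab v =
        if s.arr aLab v = s.arr aLab b then s.arr aLab a else s.arr aLab v :=
      fun v => hl3 v v.2
    have hcong : ∀ u v : Fin n, s.arr aLab u = s.arr aLab v → s3.arr aLab u = s3.arr aLab v := by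
      intro u v e
      rw [hl3' u, hl3' v, e]
    have hab3 : s3.arr aLab a = s3.arr aLab b := by
      rw [hl3' a, hl3' b]
      simp
    have heq3 : ∀ u v : Fin n, s3.arr aLab u = s3.arr aLab v → s.arr aLab u = s.arr aLab v ∨
        (s.arr aLab u = s.arr aLab a ∧ s.arr aLab v = s.arr aLab b) ∨
        (s.arr aLab u = s.arr aLab b ∧ s.arr aLab v = s.arr aLab a) := by
      intro u v e
      rw [hl3' u, hl3' v] at e
      split_ifs at e with h1 h2 h2
      · exact Or.inl (h1.trans h2.symm)
      · exact Or.inr (Or.inr ⟨h1, e.symm⟩)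
      · exact Or.inr (Or.inl ⟨e, h2⟩)
      · exact Or.inl e
    have hU := separated_merge n (s.arr aLab) (s3.arr aLab) _ _ hlab hl3
    refine ⟨?_, hc2.of_agree hag3 rfl rfl rfl, ?_, ?_, ?_, ?_, ?_⟩
    -- Both classes are non-empty, so n, nC and C are all at most nCD.
    · set C := ((Finset.range n).filter fun v => s.arr aLab v = s.arr aLab a).card with hC
      set D := ((Finset.range n).filter fun v => s.arr aLab v = s.arr aLab b).card with hD
      have hC1 : 1 ≤ C := Finset.card_pos.2 ⟨a, by simp⟩
      have hD1 : 1 ≤ D := Finset.card_pos.2 ⟨b, by simp⟩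
      have h1 : n ≤ n * (C * D) := Nat.le_mul_of_pos_right n (Nat.mul_pos hC1 hD1)
      have h2 : n * C ≤ n * (C * D) := Nat.mul_le_mul_left n (Nat.le_mul_of_pos_right C hD1)
      have h3 : C ≤ n * C := Nat.le_mul_of_pos_left C hn
      have h4 : n * separated n (s3.arr aLab) + n * (C * D) ≤ n * separated n (s.arr aLab) := by
        rw [← Nat.mul_add]
        exact Nat.mul_le_mul_left n hU
      have h5 : C * (n * 30 + D * (n * 144) + 5) = 30 * (n * C) + 144 * (n * (C * D)) + 5 * C := by
        ring
      rw [h5] at ht2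
      rw [hq3]
      omega
    · intro p hp
      rw [hq3] at hp
      rw [hX3, hY3]
      exact hst2 p hp
    · intro u hu v hv e
      rcases heq3 u v e with h | ⟨h1, h2⟩ | ⟨h1, h2⟩
      · exact hs.labelsSound u hu v hv h
      · exact hins u hu v hv h1 h2
      · exact (hins v hv u hu h2 h1).symm
    · intro i hi j hj k hk t
      rw [hon3]
      rcases hs.one i hi j hj k hk t with h | h
      · exact Or.inl (hcong _ _ h)
      · rcases hon1 i j h with h | ⟨rfl, rfl⟩
        · exact Or.inr (hm2 _ _ h)
        · exact Or.inl hab3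
    · intro i hi j hj k hk t e
      rw [hon3, hon3]
      rcases heq3 j k e with e' | ⟨h1, h2⟩ | ⟨h1, h2⟩
      · rcases hs.two i hi j hj k hk t e' with h | h | h
        · exact Or.inl (hcong _ _ h)
        · rcases hon1 i j h with h | ⟨rfl, rfl⟩
          · exact Or.inr (Or.inl (hm2 _ _ h))
          · exact Or.inl hab3
        · rcases hon1 i k h with h | ⟨rfl, rfl⟩
          · exact Or.inr (Or.inr (hm2 _ _ h))
          · exact Or.inl (hab3.trans e.symm)
      · exact Or.inr (Or.inl (hnew2 i hi j hj k hk h1 h2 t))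
      -- The scan meets the base points in the order `rA`, `rB` only. In the opposite order it
      -- pushes `(i, k)`, which is why the invariant allows either pair.
      · exact Or.inr (Or.inr (hnew2 i hi k hk j hj h2 h1 t.swap))
    · intro v
      rw [hl3' v]
      split_ifs
      · exact hs.lt a
      · exact hs.lt v

/-- Compute the minimal valid partition. -/
def closeLabels : Prog :=
  .seq initLabels (.seq pushTypeOne (.loop (.lt (.lit 0) (.reg rQ)) popMerge))

theorem runs_closeLabels (hn : 1 ≤ n) {S : Finset (Fin n)} {s : State} (hs : Current S s) :
    Runs G closeLabels s fun t s' => t ≤ n * n * n * 600 ∧ LabelsClosed G S (labels n aLab s') ∧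
      LabelsSound G S (labels n aLab s') ∧
      ∀ v : Fin n, s'.arr aLab v < n ∧ s'.arr aBad v = 0 := by
  rw [closeLabels, runs_seq]
  refine (runs_initLabels hn hs.1).agree.mono ?_
  rintro t1 s1 ⟨⟨ht1, hl1⟩, hag1⟩
  have hc1 : Current S s1 := hs.of_agree hag1 rfl rfl rfl
  rw [runs_seq]
  refine (runs_pushTypeOne hn hc1).agree.mono ?_
  rintro t2 s2 ⟨⟨ht2, hst2, hone2⟩, hag2⟩
  have hc2 : Current S s2 := hc1.of_agree hag2 rfl rfl rfl
  have hl2 : ∀ v : Fin n, s2.arr aLab v = v := fun v => by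
    rw [hag2.arr aLab rfl]
    exact (hl1 v).1
  -- All labels are distinct at this point, so the type-two clauses hold vacuously; the type-one
  -- clauses are all on the stack.
  have hinv : ClosureInv G S s2 := by
    refine ⟨hc2, hst2, ?_, fun i hi j hj k hk t => Or.inr (hone2 i hi j hj k hk t), ?_, ?_⟩
    · intro u _ v _ e P _
      simp only [labels, hl2] at e
      rw [Fin.ext e]
    · intro i _ j _ k _ t e
      rw [hl2, hl2] at e
      exact absurd (Fin.ext e) t.2.2.1
    · intro v
      rw [hl2]
      exact v.2
  refine (runs_loop (fun c s => ClosureInv G S s ∧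
    c = 60 * s.reg rQ + 300 * (n * separated n (s.arr aLab))) (by decide) ?_
    ⟨hinv, rfl⟩).agree.mono ?_
  · rintro c s ⟨hI, rfl⟩ hb
    refine (runs_popMerge hn hI hb).mono ?_
    rintro t s' ⟨h1, h2⟩
    exact ⟨_, h1, h2, rfl⟩
  · rintro t3 s3 ⟨⟨c, ht3, ⟨hI, -⟩, hb⟩, hag3⟩
    have hq : s3.reg rQ = 0 := by
      simpa [Test.Holds, Expr.eval] using hb
    have hon : ∀ a b, ¬ OnStack s3 a b := by
      rintro a b ⟨p, hp, -⟩
      omega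
    refine ⟨?_, ⟨?_, ?_⟩, hI.labelsSound, fun v => ⟨hI.lt v, ?_⟩⟩
    · have h1 : n * separated n (s2.arr aLab) ≤ n * (n * n) :=
        Nat.mul_le_mul_left n (separated_le n _)
      have h2 : n * (n * n) = n * n * n := by ring
      have h3 : n ≤ n * n * n := by nlinarith [Nat.mul_le_mul hn hn]
      simp only [Test.cost, Expr.cost] at ht3
      omega
    · intro i hi j hj k hk t
      exact (hI.one i hi j hj k hk t).resolve_right (hon _ _)
    · intro i hi j hj k hk t e
      rcases hI.two i hi j hj k hk t e with h | h | h
      · exact h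
      · exact absurd h (hon _ _)
      · exact absurd h (hon _ _)
    · rw [hag3.arr aBad rfl, hag2.arr aBad rfl]
      exact (hl1 v).2

end Machine

end HC

/-! ### Bisection by a single cluster or by a two-colouring -/

namespace HC

namespace Machine

variable {n : ℕ} {G : SimGraph n}

/-! ### Splitting off a cluster -/

/-- Mark the labels of the exposed clusters. -/
def markExposed : Prog :=
  forLoops rI rJ rK (.cond (.and (memTests rI rJ rK) (.and (.not (sameTest aLab rJ rI))
    (.and (.not (sameTest aLab rK rI)) (typeTwoTest rI rJ rK))))
    (.store aBad (.load aLab (.reg rI)) (.lit 1)) .skip)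

theorem runs_markExposed (hn : 1 ≤ n) {S : Finset (Fin n)} {s : State} (hs : Current S s)
    (hl : ∀ v : Fin n, s.arr aLab v < n ∧ s.arr aBad v = 0) :
    Runs G markExposed s fun t s' => t ≤ n * n * n * 200 ∧
      ∀ x : Fin n, s'.arr aBad (s.arr aLab x) = 0 ↔ ¬ Exposed G S (labels n aLab s) x := by
  refine (runs_forLoops hs.1 hn (by decide) (by decide) (by decide) (by decide) (by decide)
    (by decide) rfl rfl rfl rfl
    (fun s' => ∀ x : Fin n, s'.arr aBad (s.arr aLab x) ≠ 0 → Exposed G S (labels n aLab s) x)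
    (fun i j k s' => i ∈ S → j ∈ S → k ∈ S → s.arr aLab j ≠ s.arr aLab i →
      s.arr aLab k ≠ s.arr aLab i → TypeTwo G i j k → s'.arr aBad (s.arr aLab i) ≠ 0)
    (fun _ => 0) 150 (fun _ _ _ _ => rfl) (fun _ _ _ _ h => h) (fun _ _ _ _ _ _ _ h => h) ?_
    ?_).mono ?_
  · intro x h
    -- Labels are smaller than `n`, so the mark consulted at a label is among those that have been
    -- cleared.
    exact absurd (hl ⟨_, (hl x).1⟩).2 h
  · intro i j k s' hag hi hj hk hI
    have hc : Current S s' := hs.of_agree hag rfl rfl rfl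
    have hlab : s'.arr aLab = s.arr aLab := hag.arr aLab rfl
    simp only [runs_cond, Test.Holds, holds_memTests hc hi hj hk, holds_typeTwoTest hi hj hk,
      holds_sameTest, runs_store, runs_skip, Test.cost, cost_memTests, cost_sameTest,
      cost_typeTwoTest, Expr.cost, Expr.eval, hi, hj, hk, hlab]
    refine ⟨fun ⟨⟨hiS, hjS, hkS⟩, h1, h2, t⟩ => ⟨by norm_num, fun x hx => ?_, fun _ _ _ _ _ _ => ?_,
      fun i' j' k' h' hi' hj' hk' h1' h2' t' => ?_⟩,
      fun h => ⟨by norm_num, hI, fun hi hj hk h1 h2 t => absurd ⟨⟨hi, hj, hk⟩, h1, h2, t⟩ h,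
        fun _ _ _ h => h⟩⟩
    · by_cases e : s.arr aLab x = s.arr aLab i
      · exact ⟨i, hiS, j, hjS, k, hkS, e.symm, h1, h2, t⟩
      · refine hI x ?_
        simpa [Function.update_of_ne e] using hx
    · simp
    · by_cases e : s.arr aLab i' = s.arr aLab i
      · simp [e]
      · simpa [Function.update_of_ne e] using h' hi' hj' hk' h1' h2' t'
  · rintro t s' ⟨h1, h2, h3⟩
    refine ⟨by omega, fun x => ⟨?_, fun h => ?_⟩⟩
    · rintro h0 ⟨i, hi, j, hj, k, hk, e, h4, h5, t⟩
      refine h3 i j k hi hj hk h4 h5 t ?_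
      have e' : s.arr aLab i = s.arr aLab x := e
      rw [e', h0]
    · by_contra hne
      exact h (h2 x hne)

/-- Look for a cluster that can be split off; also find out whether there are two clusters. -/
def findCluster : Prog :=
  .seq (.assign rCand (.lit 0)) (.seq (.assign rOne (.lit 0))
    (forLoop rI (forLoop rJ
      (.cond (.and (memTest rI) (.and (memTest rJ) (.not (sameTest aLab rJ rI))))
        (.seq (.assign rOne (.lit 1))
          (.cond (eqTest (.load aBad (.load aLab (.reg rI))) (.lit 0))
            (.assign rCand (.succ (.reg rI))) .skip)) .skip))))

/-- A candidate `x` is stored as `x + 1`, so that 0 means that none was found. Pairs of vertices are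
inspected because the complement of the cluster must not be empty. -/
theorem runs_findCluster (hn : 1 ≤ n) {S : Finset (Fin n)} {s : State} (hs : Current S s) :
    Runs G findCluster s fun t s' => t ≤ n * n * 100 ∧
      ((s'.reg rOne = 0 ∧ ∀ x ∈ S, ∀ u ∈ S, s.arr aLab u = s.arr aLab x) ∨
        (s'.reg rOne = 1 ∧ ∃ x ∈ S, ∃ u ∈ S, s.arr aLab u ≠ s.arr aLab x)) ∧
      ((s'.reg rCand = 0 ∧ ∀ x ∈ S, ∀ u ∈ S, s.arr aLab u ≠ s.arr aLab x →
        s.arr aBad (s.arr aLab x) ≠ 0) ∨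
        ∃ x ∈ S, s'.reg rCand = x + 1 ∧ s.arr aBad (s.arr aLab x) = 0 ∧
          ∃ u ∈ S, s.arr aLab u ≠ s.arr aLab x) := by
  simp only [findCluster, runs_seq, runs_assign, Expr.eval, Expr.cost]
  have hc0 : Current S ((s.setReg rCand 0).setReg rOne 0) := hs
  refine (runs_forLoop_forLoop hc0.1 hn (by decide) (by decide) (by decide) rfl rfl rfl
    (fun s' => (s'.reg rOne = 0 ∨ s'.reg rOne = 1 ∧ ∃ x ∈ S, ∃ u ∈ S,
        s.arr aLab u ≠ s.arr aLab x) ∧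
      (s'.reg rCand = 0 ∨ ∃ x ∈ S, s'.reg rCand = x + 1 ∧ s.arr aBad (s.arr aLab x) = 0 ∧
          ∃ u ∈ S, s.arr aLab u ≠ s.arr aLab x))
    (fun x u s' => x ∈ S → u ∈ S → s.arr aLab u ≠ s.arr aLab x → s'.reg rOne ≠ 0 ∧
      (s.arr aBad (s.arr aLab x) = 0 → s'.reg rCand ≠ 0))
    (fun _ => 0) 70 (fun _ _ _ _ => rfl) ?_ ?_ ?_ ?_).mono ?_
  · rintro s u v (rfl | rfl) h <;> exact h
  · rintro i j s u v (rfl | rfl) h <;> exact h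
  · simp
  · rintro i j s' hag hi hj ⟨hI1, hI2⟩
    have hc : Current S s' := hc0.of_agree hag rfl rfl rfl
    have hlab : s'.arr aLab = s.arr aLab := hag.arr aLab rfl
    have hbad : s'.arr aBad = s.arr aBad := hag.arr aBad rfl
    simp only [runs_cond, runs_seq, Test.Holds, holds_memTest hc hi, holds_memTest hc hj,
      holds_sameTest, holds_eqTest, runs_assign, runs_skip, Test.cost, cost_memTest, cost_sameTest,
      cost_eqTest, Expr.cost, Expr.eval, State.setReg_reg, State.setReg_arr, Nat.reduceEqDiff,
      if_false, if_true, hi, hj, hlab, hbad]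
    refine ⟨fun ⟨hiS, hjS, hne⟩ => ⟨fun h0 => ?_, fun h0 => ?_⟩, fun h => ?_⟩
    · refine ⟨by norm_num, ⟨Or.inr ⟨trivial, i, hiS, j, hjS, hne⟩,
        Or.inr ⟨i, hiS, rfl, h0, j, hjS, hne⟩⟩, fun _ _ _ => ⟨by simp, fun _ => by simp⟩,
        fun x u h hx hu hne' => ⟨by simp, fun _ => by simp⟩⟩
    · refine ⟨by norm_num, ⟨Or.inr ⟨trivial, i, hiS, j, hjS, hne⟩, hI2⟩,
        fun _ _ _ => ⟨by simp, fun h1 => absurd h1 h0⟩,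
        fun x u h hx hu hne' => ⟨by simp, (h hx hu hne').2⟩⟩
    · exact ⟨by norm_num, ⟨hI1, hI2⟩, fun hiS hjS hne => absurd ⟨hiS, hjS, hne⟩ h,
        fun _ _ h => h⟩
  · rintro t s' ⟨h1, ⟨h2, h3⟩, h4⟩
    refine ⟨?_, ?_, ?_⟩
    · nlinarith [Nat.mul_le_mul hn hn]
    · rcases h2 with h2 | h2
      · refine Or.inl ⟨h2, fun x hx u hu => ?_⟩
        by_contra hne
        exact (h4 x u hx hu hne).1 h2
      · exact Or.inr h2
    · rcases h3 with h3 | h3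
      · exact Or.inl ⟨h3, fun x hx u hu hne h0 => (h4 x u hx hu hne).2 h0 h3⟩
      · exact Or.inr h3

/-- Give the colour `1` to the cluster that has been found, and `0` to the others. -/
def splitOff : Prog :=
  .seq (.assign rA (.load aLab (.pred (.reg rCand))))
    (forLoop rV (.cond (eqTest (.load aLab (.reg rV)) (.reg rA))
      (.store aCol (.reg rV) (.lit 1)) (.store aCol (.reg rV) (.lit 0))))

theorem runs_splitOff (hn : 1 ≤ n) {s : State} (hs : s.reg 0 = n) {x : Fin n}
    (hx : s.reg rCand = x + 1) :
    Runs G splitOff s fun t s' => t ≤ n * 40 ∧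
      ∀ v : Fin n, s'.arr aCol v = 1 ↔ s.arr aLab v = s.arr aLab x := by
  simp only [splitOff, runs_seq, runs_assign, Expr.eval, Expr.cost, hx, Nat.add_sub_cancel]
  have hs0 : (s.setReg rA (s.arr aLab x)).reg 0 = n := hs
  refine (runs_forLoop_const hs0 hn (by decide) rfl rfl (fun _ => True)
    (fun v s' => s'.arr aCol v = 1 ↔ s.arr aLab v = s.arr aLab x) (fun _ => 0) 14 (fun _ _ => rfl)
    (fun _ _ _ => trivial) (fun _ _ _ h => h) trivial ?_).mono ?_
  · intro i s' hag hi _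
    have hlab : s'.arr aLab = s.arr aLab := hag.arr aLab rfl
    have ha : s'.reg rA = s.arr aLab x := hag.reg rA rfl
    simp only [runs_cond, runs_store, holds_eqTest, cost_eqTest, Expr.cost, Expr.eval, hi, hlab, ha]
    have hupd : ∀ (c : ℕ) (j : Fin n), j ≠ i → (s'.setArr aCol i c).arr aCol j = s'.arr aCol j := by
      intro c j hne
      have hne' : (j : ℕ) ≠ i := fun h => hne (Fin.ext h)
      simp [Function.update_of_ne hne']
    refine ⟨fun h => ⟨by norm_num, trivial, by simp [h], fun j hj => ?_⟩,
      fun h => ⟨by norm_num, trivial, by simp [h], fun j hj => ?_⟩⟩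
    · by_cases e : j = i
      · subst e
        simp [h]
      · rw [hupd _ _ e]
        exact hj
    · by_cases e : j = i
      · subst e
        simp [h]
      · rw [hupd _ _ e]
        exact hj
  · rintro t s' ⟨h1, -, h2⟩
    exact ⟨by omega, h2⟩

/-! ### Colouring the clusters -/

/-- A colouring of the clusters with two colours that separates all conflicting clusters. -/
def IsColouring (G : SimGraph n) (S : Finset (Fin n)) (lab : Fin n → ℕ) (z : Fin n → Bool) :
    Prop :=
  (∀ u ∈ S, ∀ v ∈ S, lab u = lab v → z u = z v) ∧ ∀ i j k, Conflict G S lab i j k → z j ≠ z k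

/-- Attach the component `rB` to the component `rA`, with exchanged colours if `rFlip` is `1`. -/
def attach : Prog :=
  forLoop rV (.cond (eqTest (.load aComp (.reg rV)) (.reg rB))
    (.seq (.store aComp (.reg rV) (.reg rA))
      (.cond (.and (.lt (.lit 0) (.reg rFlip)) (.lt (.load aCol (.reg rV)) (.lit 1)))
        (.store aCol (.reg rV) (.lit 1))
        (.cond (.lt (.lit 0) (.reg rFlip)) (.store aCol (.reg rV) (.lit 0)) .skip))) .skip)

theorem runs_attach (hn : 1 ≤ n) {s : State} (hs : s.reg 0 = n)
    (hcol : ∀ v : Fin n, s.arr aCol v ≤ 1) (hflip : s.reg rFlip ≤ 1) :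
    Runs G attach s fun t s' => t ≤ n * 50 ∧
      (∀ v, v < n → s'.arr aComp v =
        if s.arr aComp v = s.reg rB then s.reg rA else s.arr aComp v) ∧
      (∀ v : Fin n, s'.arr aCol v =
        if s.arr aComp v = s.reg rB ∧ s.reg rFlip = 1 then 1 - s.arr aCol v else s.arr aCol v) := by
  refine (runs_forLoop hs (by decide) rfl rfl
    (fun i s' => (∀ v, s'.arr aComp v =
      if v < i ∧ s.arr aComp v = s.reg rB then s.reg rA else s.arr aComp v) ∧
      (∀ v, s'.arr aCol v = if v < i ∧ s.arr aComp v = s.reg rB ∧ s.reg rFlip = 1 then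
        1 - s.arr aCol v else s.arr aCol v))
    (fun _ => 0) (fun _ => 39) (fun _ _ => rfl) (fun _ _ _ h => h) (by simp) ?_).mono ?_
  · rintro i s1 hag hi ⟨hI1, hI2⟩
    have ha : s1.reg rA = s.reg rA := hag.reg rA rfl
    have hb : s1.reg rB = s.reg rB := hag.reg rB rfl
    have hf : s1.reg rFlip = s.reg rFlip := hag.reg rFlip rfl
    have hci : s1.arr aComp i = s.arr aComp i := by simpa using hI1 i
    have hli : s1.arr aCol i = s.arr aCol i := by simpa using hI2 i
    have hlt : ∀ v : ℕ, v ≠ i → (v < i + 1 ↔ v < i) := fun v hv => by omega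
    have hle := hcol i
    simp only [runs_cond, runs_seq, runs_store, runs_skip, holds_eqTest, Test.Holds, Test.cost,
      Expr.eval, cost_eqTest, Expr.cost, State.setArr_reg, State.setArr_arr, Nat.reduceEqDiff,
      if_false, hi, ha, hb, hf, hci, hli]
    refine ⟨fun h => ⟨fun h' => ⟨by norm_num, fun v => ?_, fun v => ?_⟩,
      fun h' => ⟨fun h'' => ⟨by norm_num, fun v => ?_, fun v => ?_⟩,
        fun h'' => ⟨by norm_num, fun v => ?_, fun v => ?_⟩⟩⟩,
      fun h => ⟨by norm_num, fun v => ?_, fun v => ?_⟩⟩ <;>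
    by_cases hv : v = i
    · subst hv; simp [h]
    · simp [Function.update_of_ne hv, hI1 v, hlt v hv]
    · subst hv
      have h1 : s.reg rFlip = 1 := by omega
      have h2 : s.arr aCol i = 0 := by omega
      simp [h, h1, h2]
    · simp [Function.update_of_ne hv, hI2 v, hlt v hv]
    · subst hv; simp [h]
    · simp [Function.update_of_ne hv, hI1 v, hlt v hv]
    · subst hv
      have h1 : s.reg rFlip = 1 := by omega
      have h2 : s.arr aCol i = 1 := by omega
      simp [h, h1, h2]
    · simp [Function.update_of_ne hv, hI2 v, hlt v hv]
    · subst hv; simp [h]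
    · simp [Function.update_of_ne hv, hI1 v, hlt v hv]
    · subst hv
      have h1 : s.reg rFlip ≠ 1 := by omega
      simp [h1, hli]
    · simp only [hI2 v, hlt v hv]
    · subst hv; simp [h, hci]
    · simp only [hI1 v, hlt v hv]
    · subst hv; simp [h, hli]
    · simp only [hI2 v, hlt v hv]
  · rintro t s1 ⟨h1, h2, h3⟩
    refine ⟨?_, fun v hv => by simpa [hv] using h2 v, fun v => by simpa using h3 v⟩
    rw [Finset.sum_const, Finset.card_range, smul_eq_mul] at h1
    omega

/-- Give different colours to the clusters of `rJ` and `rK`, if this is still possible. -/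
def separateColours : Prog :=
  .cond (sameTest aComp rJ rK) (.cond (sameTest aCol rJ rK) (.assign rOk (.lit 0)) .skip)
    (.seq (.assign rA (.load aComp (.reg rJ))) (.seq (.assign rB (.load aComp (.reg rK)))
      (.seq (.cond (sameTest aCol rJ rK) (.assign rFlip (.lit 1)) (.assign rFlip (.lit 0)))
        attach)))

/-- The invariant of the colouring of the components; within a component the colours are
determined up to an exchange. -/
structure ColourInv (G : SimGraph n) (S : Finset (Fin n)) (lab : Fin n → ℕ) (s : State) : Prop where
  le : ∀ v : Fin n, s.arr aCol v ≤ 1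
  congr : ∀ u v : Fin n, lab u = lab v → s.arr aComp u = s.arr aComp v ∧
    s.arr aCol u = s.arr aCol v
  sound : ∀ z, IsColouring G S lab z → ∀ u ∈ S, ∀ v ∈ S, s.arr aComp u = s.arr aComp v →
    (z u = z v ↔ s.arr aCol u = s.arr aCol v)
  ok : s.reg rOk = 1 ∨ (s.reg rOk = 0 ∧ ¬ ∃ z, IsColouring G S lab z)

/-- Within a component colours are forced up to an exchange, so equal colours of `j` and `k` there
refute every colouring. If the components differ, that of `k` is attached, exchanged exactly when
the colours agree. This takes O(n) steps, paid for by the credit 100n of at least one pair that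
ceases to be separated. -/
theorem runs_separateColours (hn : 1 ≤ n) {S : Finset (Fin n)} {lab : Fin n → ℕ} {s : State}
    (hs : s.reg 0 = n) (hI : ColourInv G S lab s) {i j k : Fin n} (hj : s.reg rJ = j)
    (hk : s.reg rK = k) (hc : Conflict G S lab i j k) :
    Runs G separateColours s fun t s' => t + 100 * (n * separated n (s'.arr aComp)) ≤
        40 + 100 * (n * separated n (s.arr aComp)) ∧ ColourInv G S lab s' ∧
      (s'.reg rOk = 0 ∨ (s'.arr aComp j = s'.arr aComp k ∧ s'.arr aCol j ≠ s'.arr aCol k)) ∧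
      (s.reg rOk = 0 → s'.reg rOk = 0) ∧
      ∀ u v : Fin n, s.arr aComp u = s.arr aComp v ∧ s.arr aCol u ≠ s.arr aCol v →
        s'.arr aComp u = s'.arr aComp v ∧ s'.arr aCol u ≠ s'.arr aCol v := by
  have hjS := hc.2.1
  have hkS := hc.2.2.1
  have hz : ∀ z, IsColouring G S lab z → z j ≠ z k := fun z hz => hz.2 i j k hc
  simp only [separateColours, runs_cond, runs_seq, runs_assign, runs_skip, holds_sameTest,
    cost_sameTest, Expr.eval, Expr.cost, State.setReg_reg, State.setReg_arr, Nat.reduceEqDiff,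
    if_false, hj, hk]
  refine ⟨fun h1 => ⟨fun h2 => ?_, fun h2 => ?_⟩, fun h1 => ?_⟩
  · refine ⟨by simp, ⟨hI.le, hI.congr, hI.sound, Or.inr ⟨by simp, ?_⟩⟩, Or.inl (by simp),
      fun _ => by simp, fun _ _ h => h⟩
    rintro ⟨z, hz'⟩
    exact hz z hz' ((hI.sound z hz' j hjS k hkS h1).2 h2)
  · exact ⟨by omega, hI, Or.inr ⟨h1, h2⟩, fun h => h, fun _ _ h => h⟩
  · have key : ∀ f : ℕ, f ≤ 1 → (f = 1 ↔ s.arr aCol j = s.arr aCol k) →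
        Runs G attach ((((s.setReg rA (s.arr aComp j)).setReg rB (s.arr aComp k))).setReg rFlip f)
          fun t s' => t + 100 * (n * separated n (s'.arr aComp)) ≤
            100 * (n * separated n (s.arr aComp)) ∧ ColourInv G S lab s' ∧
          (s'.reg rOk = 0 ∨ (s'.arr aComp j = s'.arr aComp k ∧ s'.arr aCol j ≠ s'.arr aCol k)) ∧
          (s.reg rOk = 0 → s'.reg rOk = 0) ∧
          ∀ u v : Fin n, s.arr aComp u = s.arr aComp v ∧ s.arr aCol u ≠ s.arr aCol v →
            s'.arr aComp u = s'.arr aComp v ∧ s'.arr aCol u ≠ s'.arr aCol v := by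
      intro f hf hfe
      refine (runs_attach hn (by simpa using hs) (by simpa using hI.le)
        (by simpa using hf)).agree.mono ?_
      rintro t s' ⟨⟨ht, hcomp, hcol⟩, hag⟩
      simp only [State.setReg_reg, State.setReg_arr, Nat.reduceEqDiff, if_false, if_true]
        at hcomp hcol
      have hok : s'.reg rOk = s.reg rOk := by simpa using hag.reg rOk rfl
      have hcomp' : ∀ v : Fin n, s'.arr aComp v =
        if s.arr aComp v = s.arr aComp k then s.arr aComp j else s.arr aComp v :=
        fun v => hcomp v v.2
      have hU := separated_merge n (s.arr aComp) (s'.arr aComp) _ _ h1 hcomp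
      have hcolj : s'.arr aCol j = s.arr aCol j := by simp [hcol, h1]
      have hle := hI.le
      have hcolk : s'.arr aCol k ≠ s.arr aCol j := by
        have h2 := hle j
        have h3 := hle k
        rw [hcol k]
        by_cases hf1 : f = 1
        · have := hfe.1 hf1
          rw [if_pos ⟨rfl, hf1⟩]
          omega
        · simp only [hf1, and_false, if_false]
          exact fun e => hf1 (hfe.2 e.symm)
      have hcompk : s'.arr aComp k = s.arr aComp j := by simp [hcomp']
      have hcompj : s'.arr aComp j = s.arr aComp j := by simp [hcomp', h1]
      have hpres : ∀ u v : Fin n, s.arr aComp u = s.arr aComp v →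
          (s'.arr aCol u = s'.arr aCol v ↔ s.arr aCol u = s.arr aCol v) := by
        intro u v e
        have h2 := hle u
        have h3 := hle v
        rw [hcol u, hcol v, e]
        split_ifs
        · omega
        · rfl
      refine ⟨?_, ⟨?_, ?_, ?_, ?_⟩, Or.inr ⟨by rw [hcompj, hcompk], by rw [hcolj]; exact hcolk.symm⟩,
        by rw [hok]; exact id, ?_⟩
      · have hC1 : 1 ≤ ((Finset.range n).filter fun v => s.arr aComp v = s.arr aComp j).card :=
          Finset.card_pos.2 ⟨j, by simp⟩
        have hD1 : 1 ≤ ((Finset.range n).filter fun v => s.arr aComp v = s.arr aComp k).card :=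
          Finset.card_pos.2 ⟨k, by simp⟩
        have h2 := Nat.mul_le_mul hC1 hD1
        have h3 : n * (separated n (s'.arr aComp) + 1) ≤ n * separated n (s.arr aComp) :=
          Nat.mul_le_mul_left n (by omega)
        rw [Nat.mul_add] at h3
        omega
      · intro v
        have := hle v
        rw [hcol v]
        split_ifs <;> omega
      · intro u v e
        obtain ⟨h2, h3⟩ := hI.congr u v e
        rw [hcomp' u, hcomp' v, hcol u, hcol v, h2, h3]
        exact ⟨rfl, rfl⟩
      · intro z hz' u hu v hv e
        have hzjk := hz z hz'
        have hs' := hI.sound z hz'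
        -- two vertices of the merged components, compared via `j` and `k`
        have hcross : ∀ u ∈ S, ∀ v ∈ S, s.arr aComp u = s.arr aComp j →
            s.arr aComp v = s.arr aComp k → (z u = z v ↔ s'.arr aCol u = s'.arr aCol v) := by
          intro u hu v hv eu ev
          have e1 := (hs' u hu j hjS eu).trans (hpres u j eu).symm
          have e2 := (hs' v hv k hkS ev).trans (hpres v k ev).symm
          rw [hcolj] at e1
          have b1 : s'.arr aCol u ≤ 1 := by
            have := hle u
            rw [hcol u]
            split_ifs <;> omega
          have b2 : s'.arr aCol v ≤ 1 := by
            have := hle v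
            rw [hcol v]
            split_ifs <;> omega
          have b3 : s'.arr aCol k ≤ 1 := by
            have := hle k
            rw [hcol k]
            split_ifs <;> omega
          have b4 := hle j
          -- A parity identity for bits with `z j ≠ z k`. The new colours satisfy the same one, as
          -- those of `j` and `k` now differ.
          have hzz : (z u = z v) ↔ ¬ (z u = z j ↔ z v = z k) := by
            revert hzjk
            cases z u <;> cases z v <;> cases z j <;> cases z k <;> simp
          rw [hzz, e1, e2]
          omega
        rw [hcomp' u, hcomp' v] at e
        split_ifs at e with h2 h3 h3
        · exact (hs' u hu v hv (h2.trans h3.symm)).trans (hpres u v (h2.trans h3.symm)).symm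
        · rw [eq_comm (a := z u), eq_comm (a := s'.arr aCol u)]
          exact hcross v hv u hu e.symm h2
        · exact hcross u hu v hv e h3
        · exact (hs' u hu v hv e).trans (hpres u v e).symm
      · rw [hok]
        exact hI.ok
      · rintro u v ⟨h2, h3⟩
        refine ⟨by rw [hcomp' u, hcomp' v, h2], fun h4 => h3 ((hpres u v h2).1 h4)⟩
    refine ⟨fun h2 => ?_, fun h2 => ?_⟩
    · refine (key 1 le_rfl (by simp [h2])).mono ?_
      rintro t s' ⟨h3, h4⟩
      exact ⟨by omega, h4⟩
    · refine (key 0 (by norm_num) (by simp [h2])).mono ?_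
      rintro t s' ⟨h3, h4⟩
      exact ⟨by omega, h4⟩

def initColours : Prog :=
  forLoop rV (.seq (.store aComp (.reg rV) (.load aLab (.reg rV)))
    (.store aCol (.reg rV) (.lit 0)))

theorem runs_initColours (hn : 1 ≤ n) {s : State} (hs : s.reg 0 = n) :
    Runs G initColours s fun t s' => t ≤ n * 20 ∧
      ∀ v : Fin n, s'.arr aComp v = s.arr aLab v ∧ s'.arr aCol v = 0 := by
  refine (runs_forLoop_const hs hn (by decide) rfl rfl (fun _ => True)
    (fun v s' => s'.arr aComp v = s.arr aLab v ∧ s'.arr aCol v = 0) (fun _ => 0) 9 (fun _ _ => rfl)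
    (fun _ _ _ => trivial) (fun _ _ _ h => h) trivial ?_).mono
    fun t s' h => ⟨by simpa using h.1, h.2.2⟩
  intro i s' hag hx _
  have hlab : s'.arr aLab = s.arr aLab := hag.arr aLab rfl
  simp only [runs_seq, runs_store, Expr.eval, Expr.cost, hx, hlab]
  refine ⟨by norm_num, trivial, by simp [hx], fun j h => ?_⟩
  by_cases e : j = i
  · subst e
    simp [hx]
  · have e' : (j : ℕ) ≠ i := fun h => e (Fin.ext h)
    simpa [hx, Function.update_of_ne e'] using h

/-- Colour the clusters. -/
def colour : Prog :=
  .seq (.assign rOk (.lit 1)) (.seq initColours (forLoops rI rJ rK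
    (.cond (.and (memTests rI rJ rK) (.and (.not (sameTest aLab rI rJ))
      (.and (.not (sameTest aLab rI rK)) (.and (.not (sameTest aLab rJ rK))
        (typeTwoTest rI rJ rK))))) separateColours .skip)))

/-- Every cluster starts as its own component, with initial potential at most 100n³. A pair, once
separated within its component, stays so under later merges, so one pass over all triplets suffices
unless a contradiction occurs. -/
theorem runs_colour (hn : 1 ≤ n) {S : Finset (Fin n)} {s : State} (hs : Current S s) :
    Runs G colour s fun t s' => t ≤ n * n * n * 400 ∧
      ((s'.reg rOk = 0 ∧ ¬ ∃ z, IsColouring G S (labels n aLab s) z) ∨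
        (s'.reg rOk = 1 ∧
          (∀ u v : Fin n, s.arr aLab u = s.arr aLab v → s'.arr aCol u = s'.arr aCol v) ∧
          ∀ i j k, Conflict G S (labels n aLab s) i j k →
            ¬ (s'.arr aCol j = 1 ↔ s'.arr aCol k = 1))) := by
  rw [colour, runs_seq, runs_assign, runs_seq]
  have hc0 : Current S (s.setReg rOk (Expr.eval s (.lit 1))) := hs
  refine (runs_initColours hn hc0.1).agree.mono ?_
  rintro t1 s1 ⟨⟨ht1, hinit⟩, hag1⟩
  have hc1 : Current S s1 := hc0.of_agree hag1 rfl rfl rfl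
  have hl1 : s1.arr aLab = s.arr aLab := hag1.arr aLab rfl
  have hok1 : s1.reg rOk = 1 := (hag1.reg rOk rfl).trans (by simp [Expr.eval])
  simp only [State.setReg_arr] at hinit
  set lab := labels n aLab s with hlabdef
  refine (runs_forLoops hc1.1 hn (by decide) (by decide) (by decide) (by decide) (by decide)
    (by decide) rfl rfl rfl rfl (ColourInv G S lab)
    (fun i j k s' => Conflict G S lab i j k → s'.reg rOk = 0 ∨
      (s'.arr aComp j = s'.arr aComp k ∧ s'.arr aCol j ≠ s'.arr aCol k))
    (fun s => 100 * (n * separated n (s.arr aComp))) 180 (fun _ _ _ _ => rfl) ?_ ?_ ?_ ?_).mono ?_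
  · rintro s u v (rfl | rfl | rfl) h <;> exact ⟨h.1, h.2, h.3, h.4⟩
  · rintro i j k s u v (rfl | rfl | rfl) h <;> exact h
  · refine ⟨fun v => by simp [(hinit v).2], fun u v e => ?_, ?_, Or.inl hok1⟩
    · rw [(hinit u).1, (hinit v).1, (hinit u).2, (hinit v).2]
      exact ⟨e, rfl⟩
    · intro z hz u hu v hv e
      rw [(hinit u).1, (hinit v).1] at e
      rw [(hinit u).2, (hinit v).2]
      simp [hz.1 u hu v hv e]
  · intro i j k s2 hag2 hi hj hk hI
    have hc2 : Current S s2 := hc1.of_agree hag2 rfl rfl rfl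
    have hl2 : s2.arr aLab = s.arr aLab := (hag2.arr aLab rfl).trans hl1
    have hb : (Test.and (memTests rI rJ rK) (.and (.not (sameTest aLab rI rJ))
      (.and (.not (sameTest aLab rI rK)) (.and (.not (sameTest aLab rJ rK))
        (typeTwoTest rI rJ rK))))).Holds G s2 ↔ Conflict G S lab i j k := by
      simp only [Test.Holds, holds_memTests hc2 hi hj hk, holds_typeTwoTest hi hj hk,
        holds_sameTest, hi, hj, hk, hl2, Conflict, and_assoc]
      rfl
    rw [runs_cond, hb]
    refine ⟨fun hc => ?_, fun hc => ?_⟩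
    · refine (runs_separateColours hn hc2.1 hI hj hk hc).mono ?_
      rintro t s3 ⟨h1, h2, h3, h4, h5⟩
      refine ⟨?_, h2, fun _ => h3, fun i j k h hc => ?_⟩
      · simp only [Test.cost, cost_memTests, cost_sameTest, cost_typeTwoTest]
        omega
      · rcases h hc with h | h
        · exact Or.inl (h4 h)
        · exact Or.inr (h5 j k h)
    · rw [runs_skip]
      refine ⟨?_, hI, fun h => absurd h hc, fun _ _ _ h => h⟩
      simp only [Test.cost, cost_memTests, cost_sameTest, cost_typeTwoTest]
      omega
  · rintro t s2 ⟨h1, h2, h3⟩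
    refine ⟨?_, ?_⟩
    · have h4 : n * separated n (s1.arr aComp) ≤ n * (n * n) :=
        Nat.mul_le_mul_left n (separated_le n _)
      have h5 : n * (n * n) = n * n * n := by ring
      have h6 : n ≤ n * n * n := by nlinarith [Nat.mul_le_mul hn hn]
      simp only [Expr.cost]
      omega
    · rcases h2.ok with h4 | h4
      · refine Or.inr ⟨h4, fun u v e => (h2.congr u v e).2, fun i j k hc e => ?_⟩
        rcases h3 i j k hc with h5 | ⟨-, h5⟩
        · omega
        · have := h2.le j
          have := h2.le k
          omega
      · exact Or.inl h4

/-! ### Bisection -/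

/-- Look for a valid bi-partition of the current set. If there is one, then `rOk` is `1` and the
colours describe it. -/
def bisect : Prog :=
  .seq closeLabels (.seq markExposed (.seq findCluster
    (.cond (.lt (.lit 0) (.reg rCand)) (.seq (.assign rOk (.lit 1)) splitOff)
      (.cond (.lt (.lit 0) (.reg rOne)) colour (.assign rOk (.lit 0))))))

/-- The order of the attempts matters: colouring is reached only when every cluster is exposed, and
this is what makes a failed colouring a legal failure of the procedure even if there is a claw. -/
theorem runs_bisect (hn : 1 ≤ n) {S : Finset (Fin n)} (hS : S.Nonempty) {s : State}
    (hs : Current S s) :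
    Runs G bisect s fun t s' => t ≤ n * n * n * 1400 ∧
      ((s'.reg rOk = 0 ∧ ValidBisect G S ∅ ∅) ∨
        (s'.reg rOk = 1 ∧
          ValidBisect G S (S.filter fun v : Fin n => s'.arr aCol v = 1)
            (S.filter fun v : Fin n => ¬ s'.arr aCol v = 1) ∧
          (S.filter fun v : Fin n => s'.arr aCol v = 1).Nonempty ∧
          (S.filter fun v : Fin n => ¬ s'.arr aCol v = 1).Nonempty)) := by
  rw [bisect, runs_seq]
  refine (runs_closeLabels hn hs).agree.mono ?_
  rintro t1 s1 ⟨⟨ht1, hclosed, hsound, hl1⟩, hag1⟩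
  have hc1 : Current S s1 := hs.of_agree hag1 rfl rfl rfl
  rw [runs_seq]
  refine (runs_markExposed hn hc1 hl1).agree.mono ?_
  rintro t2 s2 ⟨⟨ht2, hex⟩, hag2⟩
  have hc2 : Current S s2 := hc1.of_agree hag2 rfl rfl rfl
  have hl2 : s2.arr aLab = s1.arr aLab := hag2.arr aLab rfl
  rw [runs_seq]
  refine (runs_findCluster hn hc2).agree.mono ?_
  rintro t3 s3 ⟨⟨ht3, hone, hcand⟩, hag3⟩
  have hc3 : Current S s3 := hc2.of_agree hag3 rfl rfl rfl
  have hl3 : s3.arr aLab = s1.arr aLab := (hag3.arr aLab rfl).trans hl2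
  have hn3 : n ≤ n * n * n := by nlinarith [Nat.mul_le_mul hn hn]
  have hn2 : n * n ≤ n * n * n := Nat.le_mul_of_pos_right _ hn
  rw [hl2] at hone hcand
  simp only [runs_cond, runs_seq, runs_assign, Test.Holds, Test.cost, Expr.eval, Expr.cost]
  refine ⟨fun h => ?_, fun h => ⟨fun h' => ?_, fun h' => ?_⟩⟩
  · rcases hcand with ⟨h0, -⟩ | ⟨x, hx, hxc, hbad, u, hu, hne⟩
    · omega
    refine (runs_splitOff (x := x) hn (by simpa using hc3.1) (by simpa using hxc)).agree.mono ?_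
    rintro t4 s4 ⟨⟨ht4, hcol⟩, hag4⟩
    refine ⟨by omega, Or.inr ⟨(hag4.reg rOk rfl).trans (by simp), ?_⟩⟩
    have e1 : (S.filter fun v : Fin n => s4.arr aCol v = 1) =
        S.filter fun v => labels n aLab s1 v = labels n aLab s1 x := by
      refine Finset.filter_congr fun v _ => ?_
      rw [hcol v]
      simp only [State.setReg_arr, hl3, labels]
    have e2 : (S.filter fun v : Fin n => ¬ s4.arr aCol v = 1) =
        S.filter fun v => ¬ labels n aLab s1 v = labels n aLab s1 x := by
      refine Finset.filter_congr fun v _ => ?_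
      rw [hcol v]
      simp only [State.setReg_arr, hl3, labels]
    rw [e1, e2]
    exact ⟨validBisect_of_not_exposed hclosed hsound hx hu hne ((hex x).1 hbad),
      ⟨x, by simp [hx]⟩, ⟨u, by simp only [Finset.mem_filter, hu, true_and]; exact hne⟩⟩
  · rcases hone with ⟨h0, -⟩ | ⟨-, x, hx, u, hu, hne⟩
    · omega
    rcases hcand with ⟨-, hall⟩ | ⟨y, -, hy, -⟩
    swap
    · omega
    have hexp : ∀ y ∈ S, Exposed G S (labels n aLab s1) y := by
      intro y hy
      have hb : s2.arr aBad (s1.arr aLab y) ≠ 0 := by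
        -- The mark of `y` is guaranteed only relative to a vertex of another label; one of `x` and
        -- `u` is such a vertex.
        by_cases e : s1.arr aLab x = s1.arr aLab y
        · exact hall y hy u hu (e ▸ hne)
        · exact hall y hy x hx e
      by_contra hcon
      exact hb ((hex y).2 hcon)
    have hlab : labels n aLab s3 = labels n aLab s1 := by
      unfold labels
      rw [hl3]
    refine (runs_colour hn hc3).mono ?_
    rintro t4 s4 ⟨ht4, hres⟩
    rw [hlab, hl3] at hres
    refine ⟨by omega, ?_⟩
    rcases hres with ⟨h1, h2⟩ | ⟨h1, h2, h3⟩
    · exact Or.inl ⟨h1, validBisect_of_no_colouring hclosed hsound hS hexp h2⟩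
    · refine Or.inr ⟨h1, validBisect_of_colouring hclosed hsound (hexp x hx)
        (fun v => s4.arr aCol v) (fun u _ v _ e => h2 u v e) h3, ?_⟩
      obtain ⟨i, j, k, hc⟩ := (hexp x hx).exists_conflict hclosed
      have hjk := h3 i j k hc
      obtain ⟨-, hj, hk, -⟩ := hc
      by_cases h4 : s4.arr aCol j = 1
      · exact ⟨⟨j, by simp [hj, h4]⟩, ⟨k, by simp [hk]; tauto⟩⟩
      · exact ⟨⟨k, by simp [hk]; tauto⟩, ⟨j, by simp [hj, h4]⟩⟩
  · rcases hone with ⟨-, hall⟩ | ⟨h0, -⟩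
    · refine ⟨by omega, Or.inl ⟨by simp, validBisect_of_labels_eq hsound fun u hu v hv => ?_⟩⟩
      exact hall v hv u hu
    · omega

end Machine

end HC

/-! ### Simulation of the recursion with an explicit stack -/

namespace HC

namespace Machine

variable {n : ℕ} {G : SimGraph n}

/-! ### The partial output -/

/-- If the code `o`, with answer `ans`, is completed by the codes of trees that the algorithm can
return on the sets in `L`, then the result is the code of a tree that it can return on `G`. -/
def Pending (G : SimGraph n) (L : List (Finset (Fin n))) (o : List ℕ) (ans : ℕ) : Prop :=
  ∀ Ts, List.Forall₂ (BiPartition G) L Ts → ∃ T, BiPartition G Finset.univ T ∧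
    code T = o ++ (Ts.map code).flatten ∧ (T.Proper ↔ ans = 1 ∧ ∀ T' ∈ Ts, T'.Proper)

theorem pending_init (G : SimGraph n) : Pending G [Finset.univ] [] 1 := by
  intro Ts h
  obtain ⟨T, Ts', hT, hTs, rfl⟩ := List.forall₂_cons_left_iff.1 h
  rw [List.forall₂_nil_left_iff] at hTs
  subst hTs
  exact ⟨T, hT, by simp, by simp⟩

theorem Pending.leaf {L : List (Finset (Fin n))} {o : List ℕ} {ans : ℕ} {v : Fin n}
    (h : Pending G ({v} :: L) o ans) : Pending G L (o ++ [1, (v : ℕ)]) ans := by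
  intro Ts hTs
  obtain ⟨T, h1, h2, h3⟩ := h (Tree.leaf v :: Ts) (List.Forall₂.cons (BiPartition.single v) hTs)
  exact ⟨T, h1, by simp [h2, code], by simp [h3, Tree.Proper]⟩

theorem Pending.fail {L : List (Finset (Fin n))} {o : List ℕ} {ans : ℕ} {S : Finset (Fin n)}
    (h : Pending G (S :: L) o ans) (hS : S.card ≠ 1) (hb : ValidBisect G S ∅ ∅) :
    Pending G L (o ++ [0]) 0 := by
  intro Ts hTs
  obtain ⟨T, h1, h2, h3⟩ := h (Tree.empty :: Ts)
    (List.Forall₂.cons (BiPartition.fail S ∅ ∅ hS hb (Or.inl rfl)) hTs)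
  exact ⟨T, h1, by simp [h2, code], by simp [h3, Tree.Proper]⟩

/-- In the prefix code the header of a node is followed by the codes of its children, so the two
parts replace `S` at the front of the list, in the order of the children. -/
theorem Pending.split {L : List (Finset (Fin n))} {o : List ℕ} {ans : ℕ}
    {S A B : Finset (Fin n)} (h : Pending G (S :: L) o ans) (hS : S.card ≠ 1)
    (hb : ValidBisect G S A B) (hA : A.Nonempty) (hB : B.Nonempty) :
    Pending G (A :: B :: L) (o ++ [2, 2]) ans := by
  intro Ts hTs
  obtain ⟨TA, Ts1, hTA, hTs1, rfl⟩ := List.forall₂_cons_left_iff.1 hTs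
  obtain ⟨TB, Ts2, hTB, hTs2, rfl⟩ := List.forall₂_cons_left_iff.1 hTs1
  obtain ⟨T, h1, h2, h3⟩ := h (Tree.node 2 ![TA, TB] :: Ts2)
    (List.Forall₂.cons (BiPartition.split S A B hS hb hA.ne_empty hB.ne_empty TA TB hTA hTB) hTs2)
  refine ⟨T, h1, ?_, ?_⟩
  · simp [h2, code]
  · rw [h3]
    simp [proper_node_two, and_assoc]

/-- The list `o` has been written to the output array. -/
def Written (s : State) (o : List ℕ) : Prop :=
  s.reg rOut = o.length ∧ ∀ (m : ℕ) (h : m < o.length), s.arr aOut m = o[m]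

theorem Written.append {s s' : State} {o l : List ℕ} (h : Written s o)
    (h1 : s'.reg rOut = o.length + l.length) (h2 : ∀ m, m < o.length → s'.arr aOut m = s.arr aOut m)
    (h3 : ∀ (m : ℕ) (h : m < l.length), s'.arr aOut (o.length + m) = l[m]) :
    Written s' (o ++ l) := by
  refine ⟨by simp [h1], fun m hm => ?_⟩
  by_cases hlt : m < o.length
  · rw [h2 m hlt, h.2 m hlt, List.getElem_append_left hlt]
  · rw [List.getElem_append_right (by omega)]
    have := h3 (m - o.length) (by simp at hm; omega)
    rw [← this]
    congr 1
    omega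

/-- The sets in `L` are the blocks with the numbers on the stack, from the position below `top`
downwards. -/
def Stacked (s : State) : List (Finset (Fin n)) → ℕ → Prop
  | [], top => top = 0
  | S :: L, top => ∃ p, top = p + 1 ∧ (∀ v : Fin n, v ∈ S ↔ s.arr aBlk v = s.arr aStk p) ∧
      s.arr aStk p ≤ s.reg rNew ∧ Stacked s L p

/-- Only numbers up to the old `rNew` name stacked sets. Giving a fresh larger number to vertices
outside these sets therefore changes none of them. -/
theorem Stacked.of_forall {s s' : State} {L : List (Finset (Fin n))} {top : ℕ}
    (h : Stacked s L top) (hst : ∀ p, p < top → s'.arr aStk p = s.arr aStk p)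
    (hnew : s.reg rNew ≤ s'.reg rNew)
    (hblk : ∀ S ∈ L, ∀ v : Fin n, ∀ b, b ≤ s.reg rNew → (v ∈ S ↔ s.arr aBlk v = b) →
      (s'.arr aBlk v = b ↔ s.arr aBlk v = b)) :
    Stacked s' L top := by
  induction L generalizing top with
  | nil => exact h
  | cons S L ih =>
    obtain ⟨p, rfl, h1, h2, h3⟩ := h
    have e := hst p (by omega)
    refine ⟨p, rfl, fun v => ?_, by rw [e]; omega,
      ih h3 (fun q hq => hst q (by omega)) fun T hT => hblk T (by simp [hT])⟩
    rw [e, hblk S (by simp) v _ h2 (h1 v), h1 v]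

/-- The invariant of the main loop. -/
structure MainInv (G : SimGraph n) (L : List (Finset (Fin n))) (s : State) : Prop where
  size : s.reg 0 = n
  stacked : Stacked s L (s.reg rTop)
  blk_le : ∀ v : Fin n, s.arr aBlk v ≤ s.reg rNew
  nonempty : ∀ S ∈ L, S.Nonempty
  disjoint : L.Pairwise Disjoint
  ans : s.reg rAns = 0 ∨ s.reg rAns = 1
  output : ∃ o, Written s o ∧ Pending G L o (s.reg rAns)

/-! ### The main loop -/

/-- Count the vertices of the current set, and find one of them. -/
def countBlock : Prog :=
  .seq (.assign rCount (.lit 0)) (forLoop rV (.cond (memTest rV)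
    (.seq (.assign rCount (.succ (.reg rCount))) (.assign rRep (.reg rV))) .skip))

theorem runs_countBlock (hn : 1 ≤ n) {S : Finset (Fin n)} {s : State} (hs : Current S s) :
    Runs G countBlock s fun t s' => t ≤ n * 40 ∧ s'.reg rCount = S.card ∧
      (S.Nonempty → ∃ v ∈ S, s'.reg rRep = v) := by
  simp only [countBlock, runs_seq, runs_assign, Expr.eval, Expr.cost]
  have hc0 : Current S (s.setReg rCount 0) := hs
  refine (runs_forLoop (x := rV) hc0.1 (by decide) rfl rfl
    (fun i s' => s'.reg rCount = (S.filter fun v : Fin n => (v : ℕ) < i).card ∧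
      ((∃ v ∈ S, (v : ℕ) < i) → ∃ v ∈ S, s'.reg rRep = v))
    (fun _ => 0) (fun _ => 20) (fun _ _ => rfl) (fun _ _ _ h => h) (by simp) ?_).mono ?_
  · rintro i s' hag hi ⟨hI1, hI2⟩
    have hc : Current S s' := hc0.of_agree hag rfl rfl rfl
    simp only [runs_cond, runs_seq, runs_assign, runs_skip, holds_memTest hc hi, cost_memTest,
      Expr.eval, Expr.cost, State.setReg_reg, Nat.reduceEqDiff, if_false, if_true, hi, hI1]
    refine ⟨fun h => ⟨by norm_num, ?_, fun _ => ⟨i, h, rfl⟩⟩, fun h => ⟨by norm_num, ?_, ?_⟩⟩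
    · have e : (S.filter fun v : Fin n => (v : ℕ) < i + 1) =
          insert i (S.filter fun v : Fin n => (v : ℕ) < i) := by
        ext v
        simp only [Finset.mem_filter, Finset.mem_insert, Fin.ext_iff]
        constructor
        · rintro ⟨h1, h2⟩
          by_cases hv : (v : ℕ) = i
          · exact Or.inl hv
          · exact Or.inr ⟨h1, by omega⟩
        · rintro (h1 | ⟨h1, h2⟩)
          · exact ⟨by rwa [Fin.ext h1], by omega⟩
          · exact ⟨h1, by omega⟩
      rw [e, Finset.card_insert_of_notMem (by simp)]
    · congr 1
      refine Finset.filter_congr fun v hv => ?_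
      have : (v : ℕ) ≠ i := fun e => h (Fin.ext e ▸ hv)
      omega
    · rintro ⟨v, hv, hlt⟩
      have : (v : ℕ) ≠ i := fun e => h (Fin.ext e ▸ hv)
      exact hI2 ⟨v, hv, by omega⟩
  · rintro t s' ⟨h1, h2, h3⟩
    rw [Finset.sum_const, Finset.card_range, smul_eq_mul] at h1
    refine ⟨by omega, ?_, fun ⟨v, hv⟩ => h3 ⟨v, hv, v.2⟩⟩
    rw [h2]
    congr 1
    exact Finset.filter_true_of_mem fun v _ => v.2

/-- Give the new number `rNew` to the vertices of colour `1` of the current set. -/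
def renumber : Prog :=
  forLoop rV (.cond (.and (memTest rV) (eqTest (.load aCol (.reg rV)) (.lit 1)))
    (.store aBlk (.reg rV) (.reg rNew)) .skip)

theorem runs_renumber (hn : 1 ≤ n) {s : State} (hs : s.reg 0 = n) :
    Runs G renumber s fun t s' => t ≤ n * 40 ∧ ∀ v : Fin n, s'.arr aBlk v =
      if s.arr aBlk v = s.reg rId ∧ s.arr aCol v = 1 then s.reg rNew else s.arr aBlk v := by
  refine (runs_forLoop hs (by decide) rfl rfl
    (fun i s' => ∀ v, s'.arr aBlk v = if v < i ∧ s.arr aBlk v = s.reg rId ∧ s.arr aCol v = 1 then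
      s.reg rNew else s.arr aBlk v)
    (fun _ => 0) (fun _ => 29) (fun _ _ => rfl) (fun _ _ _ h => h) (by simp) ?_).mono ?_
  · intro i s1 hag hi hI
    have h1 : s1.reg rId = s.reg rId := hag.reg rId rfl
    have h2 : s1.reg rNew = s.reg rNew := hag.reg rNew rfl
    have h3 : s1.arr aCol = s.arr aCol := hag.arr aCol rfl
    have hbi : s1.arr aBlk i = s.arr aBlk i := by simpa using hI i
    have hlt : ∀ v : ℕ, v ≠ i → (v < i + 1 ↔ v < i) := fun v hv => by omega
    simp only [runs_cond, runs_store, runs_skip, memTest, holds_eqTest, Test.Holds, Test.cost,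
      cost_eqTest, Expr.eval, Expr.cost, hi, h1, h2, h3, hbi]
    refine ⟨fun h => ⟨by norm_num, fun v => ?_⟩, fun h => ⟨by norm_num, fun v => ?_⟩⟩ <;>
    by_cases hv : v = i
    · subst hv
      simp [h]
    · simp [Function.update_of_ne hv, hI v, hlt v hv]
    · subst hv
      rw [hbi, if_neg (fun h' => h h'.2)]
    · simp only [hI v, hlt v hv]
  · rintro t s1 ⟨h1, h2⟩
    refine ⟨?_, fun v => by simpa using h2 v⟩
    rw [Finset.sum_const, Finset.card_range, smul_eq_mul] at h1
    omega

def writeLeaf : Prog :=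
  .seq (.store aOut (.reg rOut) (.lit 1)) (.seq (.store aOut (.succ (.reg rOut)) (.reg rRep))
    (.assign rOut (.succ (.succ (.reg rOut)))))

def writeFail : Prog :=
  .seq (.store aOut (.reg rOut) (.lit 0)) (.seq (.assign rOut (.succ (.reg rOut)))
    (.assign rAns (.lit 0)))

/-- Write a node with two children, and put the two blocks on the stack. -/
def writeNode : Prog :=
  .seq (.store aOut (.reg rOut) (.lit 2)) (.seq (.store aOut (.succ (.reg rOut)) (.lit 2))
    (.seq (.assign rOut (.succ (.succ (.reg rOut)))) (.seq (.assign rNew (.succ (.reg rNew)))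
      (.seq (.store aStk (.reg rTop) (.reg rId))
        (.seq (.store aStk (.succ (.reg rTop)) (.reg rNew))
          (.assign rTop (.succ (.succ (.reg rTop)))))))))

/-- Handle the set on the top of the stack. -/
def processTop : Prog :=
  .seq (.assign rTop (.pred (.reg rTop))) (.seq (.assign rId (.load aStk (.reg rTop)))
    (.seq countBlock (.cond (eqTest (.reg rCount) (.lit 1)) writeLeaf
      (.seq bisect (.cond (.lt (.lit 0) (.reg rOk)) (.seq writeNode renumber) writeFail)))))

/-- The number of iterations of the main loop that the sets in `L` need. -/
def workload (L : List (Finset (Fin n))) : ℕ := (L.map fun S => 2 * S.card - 1).sum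

/-- Each iteration emits one node of the tree and is charged 1600n³ steps: 1400n³ for the bisection,
and the rest for linear loops, constant work and the loop test. -/
theorem runs_processTop (hn : 1 ≤ n) {L : List (Finset (Fin n))} {s : State}
    (hs : MainInv G L s) (htop : 0 < s.reg rTop) :
    Runs G processTop s fun t s' => ∃ L', MainInv G L' s' ∧
      t + 3 + n * n * n * 1600 * workload L' ≤ n * n * n * 1600 * workload L := by
  have hn3 : n ≤ n * n * n := by nlinarith [Nat.mul_le_mul hn hn]
  have h13 : 1 ≤ n * n * n := hn.trans hn3
  obtain ⟨hsize, hstacked, hblk, hne, hdisj, hans, o, hw, hpend⟩ := hs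
  cases L with
  | nil =>
    have : s.reg rTop = 0 := hstacked
    omega
  | cons S L =>
  obtain ⟨p, hp, hS, hid, hrest⟩ := hstacked
  have hSne := hne S (by simp)
  simp only [processTop, runs_seq, runs_assign, Expr.eval, Expr.cost, State.setReg_reg,
    State.setReg_arr, if_true, hp, Nat.add_sub_cancel]
  set s1 := (s.setReg rTop p).setReg rId (s.arr aStk p) with hs1
  have hc1 : Current S s1 := ⟨hsize, hS⟩
  refine (runs_countBlock hn hc1).agree.mono ?_
  rintro t2 s2 ⟨⟨ht2, hcount, hrep⟩, hag2⟩
  obtain ⟨v, hvS, hv⟩ := hrep hSne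
  have hc2 : Current S s2 := hc1.of_agree hag2 rfl rfl rfl
  have hcard := hSne.card_pos
  have hload : workload (S :: L) = 2 * S.card - 1 + workload L := by simp [workload]
  rw [hload]
  have hdisjL := (List.pairwise_cons.1 hdisj).2
  have hdisjS := (List.pairwise_cons.1 hdisj).1
  have hneL : ∀ T ∈ L, T.Nonempty := fun T hT => hne T (by simp [hT])
  -- what `countBlock` and `bisect` leave unchanged
  have common : ∀ s' : State, s'.reg 0 = s1.reg 0 → s'.reg rNew = s1.reg rNew →
      s'.reg rTop = p → s'.arr aBlk = s.arr aBlk → s'.arr aStk = s.arr aStk →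
      (s'.reg rAns = 0 ∨ s'.reg rAns = 1) →
      (∃ o, Written s' o ∧ Pending G L o (s'.reg rAns)) → MainInv G L s' := by
    intro s' h0 h1 h2 h3 h4 h5 h6
    have h1' : s'.reg rNew = s.reg rNew := h1
    refine ⟨h0.trans hsize, ?_, fun v => by rw [h3, h1']; exact hblk v, hneL, hdisjL, h5, h6⟩
    rw [h2]
    exact hrest.of_forall (fun q _ => by rw [h4]) (by rw [h1']) (fun T _ v b _ _ => by rw [h3])
  simp only [runs_cond, holds_eqTest, cost_eqTest, Expr.eval, Expr.cost, hcount]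
  refine ⟨fun h1 => ?_, fun h1 => ?_⟩
  · have hSv : S = {v} := by
      obtain ⟨w, rfl⟩ := Finset.card_eq_one.1 h1
      rw [Finset.mem_singleton.1 hvS]
    have hw2 : Written s2 o := by
      refine ⟨(hag2.reg rOut rfl).trans hw.1, fun m hm => ?_⟩
      rw [hag2.arr aOut rfl]
      exact hw.2 m hm
    have hans2 : s2.reg rAns = s.reg rAns := hag2.reg rAns rfl
    simp only [writeLeaf, runs_seq, runs_store, runs_assign, Expr.eval, Expr.cost]
    refine ⟨L, common _ ?_ ?_ ?_ ?_ ?_ ?_ ⟨o ++ [1, (v : ℕ)], ?_, ?_⟩, ?_⟩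
    · exact hag2.reg 0 rfl
    · exact hag2.reg rNew rfl
    · exact hag2.reg rTop rfl
    · exact hag2.arr aBlk rfl
    · exact hag2.arr aStk rfl
    · simpa [hans2] using hans
    · refine hw2.append (by simp [hw2.1]) (fun m hm => ?_) fun m hm => ?_
      · simp [hw2.1, hm.ne, (Nat.lt_succ_of_lt hm).ne]
      · have : m = 0 ∨ m = 1 := by simp at hm; omega
        rcases this with rfl | rfl <;> simp [hw2.1, hv]
    · rw [hSv] at hpend
      simpa [hans2] using hpend.leaf
    · have e : 2 * S.card - 1 = 1 := by omega
      have e3 : n * n * n * 1600 * (2 * S.card - 1 + workload L) =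
          n * n * n * 1600 + n * n * n * 1600 * workload L := by rw [e]; ring
      omega
  · rw [runs_seq]
    refine (runs_bisect hn hSne hc2).agree.mono ?_
    rintro t3 s3 ⟨⟨ht3, hres⟩, hag3⟩
    have hw3 : Written s3 o := by
      refine ⟨((hag3.reg rOut rfl).trans (hag2.reg rOut rfl)).trans hw.1, fun m hm => ?_⟩
      rw [hag3.arr aOut rfl, hag2.arr aOut rfl]
      exact hw.2 m hm
    have hans3 : s3.reg rAns = s.reg rAns := (hag3.reg rAns rfl).trans (hag2.reg rAns rfl)
    have hsize3 : s3.reg 0 = n := ((hag3.reg 0 rfl).trans (hag2.reg 0 rfl)).trans hsize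
    have hnew3 : s3.reg rNew = s.reg rNew := (hag3.reg rNew rfl).trans (hag2.reg rNew rfl)
    have htop3 : s3.reg rTop = p := (hag3.reg rTop rfl).trans (hag2.reg rTop rfl)
    have hid3 : s3.reg rId = s.arr aStk p := (hag3.reg rId rfl).trans (hag2.reg rId rfl)
    have hblk3 : s3.arr aBlk = s.arr aBlk := (hag3.arr aBlk rfl).trans (hag2.arr aBlk rfl)
    have hstk3 : s3.arr aStk = s.arr aStk := (hag3.arr aStk rfl).trans (hag2.arr aStk rfl)
    simp only [runs_cond, Test.Holds, Test.cost, Expr.eval, Expr.cost]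
    refine ⟨fun hok => ?_, fun hok => ?_⟩
    · obtain ⟨-, hbis, hA, hB⟩ := hres.resolve_left (fun h => by omega)
      set A := S.filter fun v : Fin n => s3.arr aCol v = 1 with hAdef
      set B := S.filter fun v : Fin n => ¬ s3.arr aCol v = 1 with hBdef
      have hcardAB : A.card + B.card = S.card := Finset.card_filter_add_card_filter_not _
      simp only [writeNode, runs_seq, runs_store, runs_assign, Expr.eval, Expr.cost, State.setReg_reg,
        State.setArr_reg, Nat.reduceEqDiff, if_true, if_false]
      set s4 := ((((((s3.setArr aOut (s3.reg rOut) 2).setArr aOut (s3.reg rOut + 1)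
        2).setReg rOut (s3.reg rOut + 1 + 1)).setReg rNew (s3.reg rNew + 1)).setArr aStk
        (s3.reg rTop) (s3.reg rId)).setArr aStk (s3.reg rTop + 1) (s3.reg rNew + 1)).setReg rTop
        (s3.reg rTop + 1 + 1) with hs4
      refine Runs.mono (Q := fun t s' => t ≤ n * 40 ∧ (∀ v : Fin n, s'.arr aBlk v =
        if s3.arr aBlk v = s3.reg rId ∧ s3.arr aCol v = 1 then s3.reg rNew + 1
        else s3.arr aBlk v) ∧ Agree renumber s4 s') ?_ ?_
      · have := (runs_renumber (G := G) (s := s4) hn (by simpa [hs4] using hsize3)).agree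
        refine (Runs.mono this ?_)
        rintro t s' ⟨⟨h1, h2⟩, h3⟩
        refine ⟨h1, fun v => ?_, h3⟩
        rw [h2 v]
        simp [hs4]
      rintro t5 s5 ⟨ht5, hblk5, hag5⟩
      have hnew5 : s5.reg rNew = s.reg rNew + 1 := (hag5.reg rNew rfl).trans (by simp [hs4, hnew3])
      have htop5 : s5.reg rTop = p + 1 + 1 := (hag5.reg rTop rfl).trans (by simp [hs4, htop3])
      have hstk5 : s5.arr aStk = Function.update (Function.update (s.arr aStk) p (s.arr aStk p))
          (p + 1) (s.reg rNew + 1) :=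
        (hag5.arr aStk rfl).trans (by simp [hs4, htop3, hid3, hnew3, hstk3])
      have hout5 : s5.arr aOut = Function.update (Function.update (s3.arr aOut) o.length 2)
          (o.length + 1) 2 := (hag5.arr aOut rfl).trans (by simp [hs4, hw3.1])
      have hans5 : s5.reg rAns = s.reg rAns := (hag5.reg rAns rfl).trans (by simp [hs4, hans3])
      have hrO5 : s5.reg rOut = o.length + 2 := (hag5.reg rOut rfl).trans (by simp [hs4, hw3.1])
      have hblk5' : ∀ v : Fin n, s5.arr aBlk v = if v ∈ A then s.reg rNew + 1 else s.arr aBlk v := by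
        intro v
        rw [hblk5 v, hblk3, hid3, hnew3]
        simp only [hAdef, Finset.mem_filter, hS v]
      have hAS : A ⊆ S := Finset.filter_subset _ _
      have hBS : B ⊆ S := Finset.filter_subset _ _
      refine ⟨A :: B :: L, ⟨(hag5.reg 0 rfl).trans (by simpa [hs4] using hsize3), ?_, ?_, ?_, ?_,
        by rw [hans5]; exact hans, o ++ [2, 2], ?_, ?_⟩, ?_⟩
      -- `A` gets the fresh number and goes on top, so that it is written before `B`, which keeps
      -- the number of `S`.
      · rw [htop5]
        refine ⟨p + 1, rfl, fun v => ?_, ?_, p, rfl, fun v => ?_, ?_, ?_⟩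
        · rw [hstk5, Function.update_self, hblk5' v]
          by_cases hvA : v ∈ A
          · simp [hvA]
          · have := hblk v
            simp only [hvA, if_false, false_iff]
            omega
        · rw [hstk5, Function.update_self, hnew5]
        · have e : s5.arr aStk p = s.arr aStk p := by
            rw [hstk5, Function.update_of_ne (by omega), Function.update_self]
          rw [e, hblk5' v]
          by_cases hvA : v ∈ A
          · have hvB : v ∉ B := by
              rw [hAdef, Finset.mem_filter] at hvA
              rw [hBdef, Finset.mem_filter]
              tauto
            simp only [hvA, hvB, if_true, false_iff]
            omega
          · rw [if_neg hvA, ← hS v]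
            rw [hAdef, Finset.mem_filter] at hvA
            rw [hBdef, Finset.mem_filter]
            tauto
        · have e : s5.arr aStk p = s.arr aStk p := by
            rw [hstk5, Function.update_of_ne (by omega), Function.update_self]
          rw [e, hnew5]
          omega
        · refine hrest.of_forall (fun q hq => ?_) (by omega) (fun T hT v b hb hvT => ?_)
          · rw [hstk5, Function.update_of_ne (by omega), Function.update_of_ne (by omega)]
          · rw [hblk5' v]
            by_cases hvA : v ∈ A
            · have hvT' : v ∉ T := Finset.disjoint_left.1 (hdisjS T hT) (hAS hvA)
              rw [if_pos hvA, ← hvT]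
              simp only [hvT', iff_false]
              omega
            · rw [if_neg hvA]
      · intro v
        rw [hblk5' v, hnew5]
        have := hblk v
        split_ifs <;> omega
      · intro T hT
        simp only [List.mem_cons] at hT
        rcases hT with rfl | rfl | hT
        · exact hA
        · exact hB
        · exact hneL T hT
      · rw [List.pairwise_cons, List.pairwise_cons]
        refine ⟨?_, fun T hT => (hdisjS T hT).mono_left hBS, hdisjL⟩
        intro T hT
        rcases List.mem_cons.1 hT with rfl | hT
        · exact Finset.disjoint_filter_filter_not S S _
        · exact (hdisjS T hT).mono_left hAS
      · refine hw3.append (by simp [hrO5]) (fun m hm => ?_) fun m hm => ?_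
        · rw [hout5, Function.update_of_ne (by omega), Function.update_of_ne (by omega)]
        · have : m = 0 ∨ m = 1 := by simp at hm; omega
          rcases this with rfl | rfl <;> simp [hout5]
      · rw [hans5]
        exact hpend.split h1 hbis hA hB
      · have hA1 := hA.card_pos
        have hB1 := hB.card_pos
        -- A full binary tree with m leaves has 2m - 1 nodes; the split accounts for its root.
        have e : workload (A :: B :: L) = 2 * A.card - 1 + (2 * B.card - 1) + workload L := by
          simp [workload, add_assoc]
        have e2 : 2 * S.card - 1 + workload L = workload (A :: B :: L) + 1 := by omega
        have e3 : n * n * n * 1600 * (2 * S.card - 1 + workload L) =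
            n * n * n * 1600 * workload (A :: B :: L) + n * n * n * 1600 := by rw [e2]; ring
        omega
    · obtain ⟨hok3, hbis⟩ := hres.resolve_right (fun h => by omega)
      simp only [writeFail, runs_seq, runs_store, runs_assign, Expr.eval, Expr.cost]
      refine ⟨L, common _ ?_ ?_ ?_ ?_ ?_ (Or.inl (by simp)) ⟨o ++ [0], ?_, ?_⟩, ?_⟩
      · exact hsize3.trans hsize.symm
      · exact hnew3
      · exact htop3
      · exact hblk3
      · exact hstk3
      · refine hw3.append (by simp [hw3.1]) (fun m hm => ?_) fun m hm => ?_
        · simp [hw3.1, hm.ne]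
        · have : m = 0 := by simpa using hm
          subst this
          simp [hw3.1]
      · simpa using hpend.fail h1 hbis
      -- A failure writes a single node and forfeits the remaining workload of `S`.
      · have e : 2 * S.card - 1 + workload L = workload L + 1 + (2 * S.card - 2) := by omega
        have e3 : n * n * n * 1600 * (2 * S.card - 1 + workload L) =
            n * n * n * 1600 * workload L + n * n * n * 1600 +
              n * n * n * 1600 * (2 * S.card - 2) := by rw [e]; ring
        omega

/-- The whole program. -/
def program : Prog :=
  .seq (.assign rAns (.lit 1)) (.seq (.assign rTop (.lit 1))
    (.loop (.lt (.lit 0) (.reg rTop)) processTop))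

theorem runs_program (hn : 1 ≤ n) (G : SimGraph n) :
    Runs G program (init n) fun t s => t ≤ 3300 * n ^ 4 ∧ ∃ T, OutputTree s T ∧
      BiPartition G Finset.univ T ∧ (T.Proper → answer s = 1) ∧ (¬ T.Proper → answer s = 0) := by
  have hne : Nonempty (Fin n) := ⟨⟨0, hn⟩⟩
  simp only [program, runs_seq, runs_assign, Expr.eval, Expr.cost]
  have hinv : MainInv G [Finset.univ] (((init n).setReg rAns 1).setReg rTop 1) := by
    -- All cells are initially 0: every vertex belongs to block 0, and the only stack entry names
    -- this block.
    refine ⟨by simp [init], ⟨0, by simp, fun v => by simp [init], by simp [init], rfl⟩,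
      fun v => by simp [init], by simp [Finset.univ_nonempty], by simp, by simp, [], ?_, ?_⟩
    · exact ⟨by simp [init], fun m hm => absurd hm (by simp)⟩
    · simpa using pending_init G
  refine (runs_loop (fun c s => ∃ L, MainInv G L s ∧ c = n * n * n * 1600 * workload L)
    (by decide) ?_ ⟨_, hinv, rfl⟩).mono ?_
  · rintro c s ⟨L, hL, rfl⟩ hb
    refine (runs_processTop hn hL hb).mono ?_
    rintro t s' ⟨L', h1, h2⟩
    exact ⟨_, h2, L', h1, rfl⟩
  · rintro t s ⟨c, ht, ⟨L, hL, -⟩, hb⟩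
    have htop : s.reg rTop = 0 := by
      simpa [Test.Holds, Expr.eval] using hb
    have hnil : L = [] := by
      cases L with
      | nil => rfl
      | cons S L =>
        obtain ⟨p, hp, -⟩ := hL.stacked
        omega
    subst hnil
    obtain ⟨o, hw, hpend⟩ := hL.output
    obtain ⟨T, hT, hcode, hproper⟩ := hpend [] List.Forall₂.nil
    simp only [List.map_nil, List.flatten_nil, List.append_nil] at hcode
    simp only [List.not_mem_nil, false_imp_iff, implies_true, and_true] at hproper
    refine ⟨?_, T, ?_, hT, hproper.1, fun h => ?_⟩
    · simp only [workload, List.map_cons, List.map_nil, List.sum_cons, List.sum_nil,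
        Finset.card_univ, Fintype.card_fin, Test.cost, Expr.cost] at ht
      -- The loop costs at most 1600n³ · 2n = 3200n⁴; the spare 100n⁴ covers the initial assignments
      -- and the last test.
      have h1 : n * n * n * 1600 * (2 * n - 1 + 0) ≤ n * n * n * 1600 * (2 * n) :=
        Nat.mul_le_mul_left _ (by omega)
      have h2 : n * n * n * 1600 * (2 * n) = 3200 * n ^ 4 := by ring
      have h3 : 1 ≤ n ^ 4 := Nat.one_le_pow _ _ hn
      omega
    · intro m hm
      simp only [hcode] at hm ⊢
      exact hw.2 m hm
    · rcases hL.ans with h0 | h1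
      · exact h0
      · exact absurd (hproper.2 h1) h

end Machine

end HC

/-! ### Assembly of correctness and running time -/

theorem theorem3 :
    (∀ (n : ℕ), 1 ≤ n → ∀ (G : HC.SimGraph n) (T : HC.Tree (Fin n)),
      HC.BiPartition G Finset.univ T →
        (T.Spans ↔ HC.PerfectHC G) ∧ (T.Spans → HC.IsOptimalTree G T)) ∧
    ∃ (p : HC.Machine.Prog) (τ : ℕ → ℕ),
      ((fun n => (τ n : ℝ)) =O[Filter.atTop] fun n => (n : ℝ) ^ 4 * Real.log n) ∧
      ∀ (n : ℕ), 1 ≤ n → ∀ (G : HC.SimGraph n),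
        ∃ (t : ℕ) (s : HC.Machine.State) (T : HC.Tree (Fin n)),
          HC.Machine.Exec G p (HC.Machine.init n) t s ∧ t ≤ τ n ∧
          HC.Machine.OutputTree s T ∧ HC.BiPartition G Finset.univ T ∧
          (HC.PerfectHC G → HC.Machine.answer s = 1 ∧ HC.IsOptimalTree G T) ∧
          (¬ HC.PerfectHC G → HC.Machine.answer s = 0) := by
  have hopt : ∀ (n : ℕ), 1 ≤ n → ∀ (G : HC.SimGraph n) (T : HC.Tree (Fin n)),
      HC.BiPartition G Finset.univ T → T.Proper → HC.IsOptimalTree G T := by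
    intro n hn G T hT hp
    obtain ⟨h1, h2⟩ := hT.isHCTree_and_totalCost_eq hn hp
    exact HC.isOptimalTree_of_totalCost_eq h1 h2
  refine ⟨fun n hn G T hT => ?_, HC.Machine.program, fun n => 3300 * n ^ 4, ?_, ?_⟩
  · rw [hT.spans_iff_proper hn]
    exact ⟨hT.proper_iff_perfectHC hn, hopt n hn G T hT⟩
  · refine Asymptotics.IsBigO.of_bound 3300 ?_
    -- As e < 3, the logarithm is at least 1 from n = 3 on, so the bound 3300n⁴ is within the
    -- claimed order.
    filter_upwards [Filter.eventually_ge_atTop 3] with n hn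
    have hlog : 1 ≤ Real.log n := by
      rw [Real.le_log_iff_exp_le (by positivity)]
      have : (3 : ℝ) ≤ n := by exact_mod_cast hn
      linarith [Real.exp_one_lt_d9]
    rw [Real.norm_of_nonneg (by positivity), Real.norm_of_nonneg (by positivity)]
    push_cast
    have h4 : (0 : ℝ) ≤ (n : ℝ) ^ 4 := by positivity
    nlinarith
  · intro n hn G
    obtain ⟨t, s, hexec, ht, T, hout, hT, h1, h2⟩ := HC.Machine.runs_program hn G
    refine ⟨t, s, T, hexec, ht, hout, hT, fun h => ?_, fun h => h2 fun hp => ?_⟩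
    · have hp := (hT.proper_iff_perfectHC hn).2 h
      exact ⟨h1 hp, hopt n hn G T hT hp⟩
    · exact h ((hT.proper_iff_perfectHC hn).1 hp)
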